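/- Let $n\in\mathbb N$ and $s>1$. Let $\gamma^{(s)}(\mathbb R^n)$ be the space of all $f\in C^\infty(\mathbb R^n;\mathbb C)$ such that for every compact $K\subset\mathbb R^n$ and every $A>0$ there is $C>0$ with $|\partial^\alpha f(x)|\le C A^{|\alpha|}(\alpha!)^s$ for all $\alpha\in\mathbb N^n$ and $x\in K$, with the topology defined by the seminorms $\sup_{x\in K,\,\alpha}|\partial^\alpha f(x)|/(A^{|\alpha|}(\alpha!)^s)$, and let $\mathcal E'_{(s)}(\mathbb R^n)$ be its topological dual. Let $A(\mathbb R^n)$ be the space of complex-valued real analytic functions on $\mathbb R^n$ with its usual topology (the projective limit, over the compact sets $K\subset\mathbb R^n$, of the inductive limits, over the open neighbourhoods $\omega$ of $K$ in $\mathbb C^n$, of the spaces of holomorphic functions on $\omega$). Since $A(\mathbb R^n)\subset\gamma^{(s)}(\mathbb R^n)$, elements of $\mathcal E'_{(s)}(\mathbb R^n)$ are regarded as functionals on $A(\mathbb R^n)$ by restriction. For a continuous linear functional $v$ on $A(\mathbb R^n)$ put $\widehat v(\xi)=v(e^{-i x\cdot\xi})$, $\xi\in\mathbb R^n$; $v$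 is compactly supported if there is a compact $K\subset\mathbb R^n$ such that for every open neighbourhood $\omega$ of $K$ in $\mathbb C^n$ there is a constant $C_\omega$ with $|v(f)|\le C_\omega\sup_\omega|F|$ whenever $F$ is bounded and holomorphic on $\omega$ and $F=f$ on $\omega\cap\mathbb R^n$. With $\langle\xi\rangle=(1+|\xi|^2)^{1/2}$ and $\Lambda(\rho,s)=\rho\langle\xi\rangle^{1/s}$, let $H^l_{-\Lambda(\rho,s)}$ be the set of all continuous linear functionals $v$ on $A(\mathbb R^n)$ with $\langle\xi\rangle^l e^{-\Lambda(\rho,s)}\widehat v(\xi)\in L^2(\mathbb R^n_\xi)$. Then: (i) for every $v\in\mathcal E'_{(s)}(\mathbb R^n)$ and $l\in\mathbb R$ there exists $\rho>0$ such that $v\in H^l_{-\Lambda(\rho,s)}$ (that is, the restriction of $v$ to $A(\mathbb R^n)$ is continuous and belongs to $H^l_{-\Lambda(\rho,s)}$); (ii) for all $l\in\mathbb R$ and $\rho>0$, if $v\in H^l_{-\Lambda(\rho,s)}$ is compactly supported, then $v\in\mathcal E'_{(s)}(\mathbb R^n)$ (that is, $v$ is the restriction to $A(\mathbb R^n)$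 of an element of $\mathcal E'_{(s)}(\mathbb R^n)$). -/

import Mathlib

open scoped Nat NNReal ENNReal

noncomputable section

/-- The multi-index `α = (α₁, …, αₙ)` counted by a word `J` of length `k` in the coordinate
directions: `αᵢ` is the number of occurrences of `i` in `J`. Thus `|α| = k`, and every
multi-index arises from some word. -/
def wordIndex {n k : ℕ} (J : Fin k → Fin n) (i : Fin n) : ℕ :=
  (Finset.univ.filter fun j => J j = i).card

/-- `α! = α₁! ⋯ αₙ!` for the multi-index `α` of the word `J`. -/
def wordFactorial {n k : ℕ} (J : Fin k → Fin n) : ℕ :=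
  ∏ i, (wordIndex J i)!

/-- The mixed partial derivative `∂_{J₁} ⋯ ∂_{J_k} f (x)`, which for smooth `f` is `∂^α f (x)`,
with `α` the multi-index of the word `J`. -/
def partialDeriv {n k : ℕ} (J : Fin k → Fin n) (f : EuclideanSpace ℝ (Fin n) → ℂ)
    (x : EuclideanSpace ℝ (Fin n)) : ℂ :=
  iteratedFDeriv ℝ k f x fun j => EuclideanSpace.single (J j) (1 : ℝ)

/-! ### Real analytic functions on `ℝⁿ` -/

/-- The complex-valued real analytic functions on `ℝⁿ`, as a subspace of all functions. -/
def realAnalyticSubmodule (n : ℕ) : Submodule ℂ (EuclideanSpace ℝ (Fin n) → ℂ) where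
  carrier := {f | AnalyticOnNhd ℝ f Set.univ}
  add_mem' hf hg := hf.add hg
  zero_mem' := analyticOnNhd_const
  smul_mem' c _ hf := (analyticOnNhd_const (v := c)).smul hf

/-- The space `A(ℝⁿ)` of complex-valued real analytic functions on `ℝⁿ`. -/
def RealAnalytic (n : ℕ) : Type := realAnalyticSubmodule n

instance (n : ℕ) : AddCommGroup (RealAnalytic n) :=
  inferInstanceAs (AddCommGroup (realAnalyticSubmodule n))

instance (n : ℕ) : Module ℂ (RealAnalytic n) :=
  inferInstanceAs (Module ℂ (realAnalyticSubmodule n))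

instance (n : ℕ) : CoeFun (RealAnalytic n) fun _ => EuclideanSpace ℝ (Fin n) → ℂ :=
  ⟨fun f => f.1⟩

/-- The inclusion `ℝⁿ ⊂ ℂⁿ`. -/
def realToComplex {n : ℕ} (x : EuclideanSpace ℝ (Fin n)) : EuclideanSpace ℂ (Fin n) :=
  WithLp.toLp 2 fun i => (x i : ℂ)

/-- `q : A(ℝⁿ) → ℝ` is carried by `K ⊂ ℝⁿ`: for every open neighbourhood `ω` of `K` in `ℂⁿ` there
is a constant `C` with `q f ≤ C sup_ω |F|` whenever `f` is the restriction of a bounded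
holomorphic function `F` on `ω`. -/
def CarriedBy {n : ℕ} (q : RealAnalytic n → ℝ) (K : Set (EuclideanSpace ℝ (Fin n))) : Prop :=
  ∀ ω : Set (EuclideanSpace ℂ (Fin n)), IsOpen ω → realToComplex '' K ⊆ ω →
    ∃ C : ℝ, ∀ (f : RealAnalytic n) (F : EuclideanSpace ℂ (Fin n) → ℂ) (M : ℝ),
      DifferentiableOn ℂ F ω → (∀ x, realToComplex x ∈ ω → F (realToComplex x) = f x) →
      0 ≤ M → (∀ z ∈ ω, ‖F z‖ ≤ M) → q f ≤ C * M

/-- The continuous seminorms of `A(ℝⁿ)`: those that are carried by some compact set `K`. These are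
the seminorms of the usual topology, the projective limit over the compact sets `K ⊂ ℝⁿ` of the
inductive limits, over the complex neighbourhoods `ω` of `K`, of the holomorphic functions
on `ω`. -/
def realAnalyticSeminorms (n : ℕ) :
    SeminormFamily ℂ (RealAnalytic n)
      {q : Seminorm ℂ (RealAnalytic n) // ∃ K, IsCompact K ∧ CarriedBy q K} :=
  fun q => q.1

instance (n : ℕ) :
    Nonempty {q : Seminorm ℂ (RealAnalytic n) // ∃ K, IsCompact K ∧ CarriedBy q K} :=
  ⟨⟨0, ∅, isCompact_empty, by
    intro ω _ _
    exact ⟨0, fun f F M _ _ _ _ => by simp⟩⟩⟩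

/-- The usual locally convex topology of `A(ℝⁿ)`. -/
instance (n : ℕ) : TopologicalSpace (RealAnalytic n) :=
  (realAnalyticSeminorms n).moduleFilterBasis.topology

theorem withSeminorms_realAnalytic (n : ℕ) : WithSeminorms (realAnalyticSeminorms n) := ⟨rfl⟩

/-- A real analytic functional is compactly supported if it is carried by a compact set. -/
def IsCompactlySupported {n : ℕ} (v : RealAnalytic n →L[ℂ] ℂ) : Prop :=
  ∃ K : Set (EuclideanSpace ℝ (Fin n)), IsCompact K ∧ CarriedBy (fun f => ‖v f‖) K

/-- The function `x ↦ e^{-i x·ξ}` as an element of `A(ℝⁿ)`. -/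
def fourierExp {n : ℕ} (ξ : EuclideanSpace ℝ (Fin n)) : RealAnalytic n :=
  ⟨fun x => Complex.exp (-Complex.I * (inner ℝ x ξ : ℝ)), by
    intro x _
    have h : AnalyticAt ℝ (fun x : EuclideanSpace ℝ (Fin n) => ((inner ℝ x ξ : ℝ) : ℂ)) x := by
      have h1 := (Complex.ofRealCLM.comp (innerSL ℝ ξ)).analyticAt x
      have h2 : (fun x : EuclideanSpace ℝ (Fin n) => ((inner ℝ x ξ : ℝ) : ℂ)) =
          Complex.ofRealCLM.comp (innerSL ℝ ξ) := by
        funext x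
        simp [real_inner_comm]
      rwa [h2]
    have hc : AnalyticAt ℝ (fun _ : EuclideanSpace ℝ (Fin n) => -Complex.I) x := analyticAt_const
    exact (analyticAt_cexp (z := _)).restrictScalars.comp (hc.mul h)⟩

/-- The Fourier(-Laplace) transform `v̂(ξ) = v(e^{-i x·ξ})` of a functional on `A(ℝⁿ)`. -/
def fourierTransform {n : ℕ} (v : RealAnalytic n →L[ℂ] ℂ) (ξ : EuclideanSpace ℝ (Fin n)) : ℂ :=
  v (fourierExp ξ)

/-- The Japanese bracket `⟨ξ⟩ = (1 + |ξ|²)^{1/2}`. -/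
def japaneseBracket {n : ℕ} (ξ : EuclideanSpace ℝ (Fin n)) : ℝ :=
  √(1 + ‖ξ‖ ^ 2)

/-- The weighted Sobolev space `H^l_{-Λ(ρ,s)}`, `Λ(ρ,s) = ρ ⟨ξ⟩^{1/s}`, of all continuous linear
functionals `v` on `A(ℝⁿ)` with `⟨ξ⟩^l e^{-Λ(ρ,s)} v̂(ξ) ∈ L²(ℝⁿ)`. -/
def weightedSobolev (n : ℕ) (l ρ s : ℝ) : Set (RealAnalytic n →L[ℂ] ℂ) :=
  {v | MeasureTheory.MemLp (fun ξ : EuclideanSpace ℝ (Fin n) =>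
    ((japaneseBracket ξ ^ l * Real.exp (-(ρ * japaneseBracket ξ ^ (1 / s))) : ℝ) : ℂ) *
      fourierTransform v ξ) 2 MeasureTheory.volume}

/-! ### Gevrey Beurling functions and ultradistributions -/

/-- `f` belongs to the Gevrey Beurling class `γ^{(s)}(ℝⁿ)`: it is smooth and, for every compact
set `K` and every `A > 0`, there is `C` with `|∂^α f(x)| ≤ C A^{|α|} (α!)^s` for all multi-indices
`α` and all `x ∈ K`. -/
def IsGevreyBeurling {n : ℕ} (s : ℝ) (f : EuclideanSpace ℝ (Fin n) → ℂ) : Prop :=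
  ContDiff ℝ (⊤ : ℕ∞) f ∧ ∀ K : Set (EuclideanSpace ℝ (Fin n)), IsCompact K → ∀ A : ℝ, 0 < A →
    ∃ C : ℝ, ∀ (k : ℕ) (J : Fin k → Fin n), ∀ x ∈ K,
      ‖partialDeriv J f x‖ ≤ C * A ^ k * (wordFactorial J : ℝ) ^ s

theorem partialDeriv_add {n k : ℕ} (J : Fin k → Fin n) {f g : EuclideanSpace ℝ (Fin n) → ℂ}
    (hf : ContDiff ℝ (⊤ : ℕ∞) f) (hg : ContDiff ℝ (⊤ : ℕ∞) g) (x : EuclideanSpace ℝ (Fin n)) :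
    partialDeriv J (f + g) x = partialDeriv J f x + partialDeriv J g x := by
  have h1 : ContDiffAt ℝ k f x := (hf.of_le (by exact_mod_cast le_top)).contDiffAt
  have h2 : ContDiffAt ℝ k g x := (hg.of_le (by exact_mod_cast le_top)).contDiffAt
  simp only [partialDeriv]
  rw [iteratedFDeriv_add_apply h1 h2]
  rfl

theorem partialDeriv_smul {n k : ℕ} (J : Fin k → Fin n) {f : EuclideanSpace ℝ (Fin n) → ℂ}
    (c : ℂ) (hf : ContDiff ℝ (⊤ : ℕ∞) f) (x : EuclideanSpace ℝ (Fin n)) :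
    partialDeriv J (c • f) x = c * partialDeriv J f x := by
  have h1 : ContDiffAt ℝ k f x := (hf.of_le (by exact_mod_cast le_top)).contDiffAt
  simp only [partialDeriv]
  rw [iteratedFDeriv_const_smul_apply h1]
  rfl

/-- The Gevrey Beurling functions, as a subspace of all functions. -/
def gevreySubmodule (n : ℕ) (s : ℝ) : Submodule ℂ (EuclideanSpace ℝ (Fin n) → ℂ) where
  carrier := {f | IsGevreyBeurling s f}
  add_mem' := by
    rintro f g ⟨hf, hf'⟩ ⟨hg, hg'⟩
    refine ⟨hf.add hg, fun K hK A hA => ?_⟩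
    obtain ⟨C, hC⟩ := hf' K hK A hA
    obtain ⟨D, hD⟩ := hg' K hK A hA
    refine ⟨C + D, fun k J x hx => ?_⟩
    rw [partialDeriv_add J hf hg]
    calc _ ≤ _ := norm_add_le _ _
      _ ≤ _ := add_le_add (hC k J x hx) (hD k J x hx)
      _ = _ := by ring
  zero_mem' := by
    refine ⟨contDiff_const, fun K _ A _ => ⟨0, fun k J x _ => ?_⟩⟩
    simp [partialDeriv]
  smul_mem' := by
    rintro c f ⟨hf, hf'⟩
    refine ⟨contDiff_const.smul hf, fun K hK A hA => ?_⟩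
    obtain ⟨C, hC⟩ := hf' K hK A hA
    refine ⟨‖c‖ * C, fun k J x hx => ?_⟩
    rw [partialDeriv_smul J c hf, norm_mul]
    calc _ ≤ _ := mul_le_mul_of_nonneg_left (hC k J x hx) (norm_nonneg c)
      _ = _ := by ring

/-- The Gevrey Beurling space `γ^{(s)}(ℝⁿ)`. -/
def GevreyBeurling (n : ℕ) (s : ℝ) : Type := gevreySubmodule n s

instance (n : ℕ) (s : ℝ) : AddCommGroup (GevreyBeurling n s) :=
  inferInstanceAs (AddCommGroup (gevreySubmodule n s))

instance (n : ℕ) (s : ℝ) : Module ℂ (GevreyBeurling n s) :=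
  inferInstanceAs (Module ℂ (gevreySubmodule n s))

instance (n : ℕ) (s : ℝ) :
    CoeFun (GevreyBeurling n s) fun _ => EuclideanSpace ℝ (Fin n) → ℂ :=
  ⟨fun f => f.1⟩

theorem wordFactorial_pos {n k : ℕ} (J : Fin k → Fin n) : 0 < wordFactorial J :=
  Finset.prod_pos fun _ _ => Nat.factorial_pos _

/-- The quotient `|∂^α f(x)| / (A^{|α|} (α!)^s)`, for a point `x ∈ K` and a word `J` with
multi-index `α`. -/
def gevreyQuotient {n : ℕ} (s A : ℝ) {K : Set (EuclideanSpace ℝ (Fin n))}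
    (f : EuclideanSpace ℝ (Fin n) → ℂ) (p : K × Σ k : ℕ, (Fin k → Fin n)) : ℝ :=
  ‖partialDeriv p.2.2 f p.1‖ / (A ^ p.2.1 * (wordFactorial p.2.2 : ℝ) ^ s)

theorem gevreyQuotient_nonneg {n : ℕ} (s : ℝ) {A : ℝ} (hA : 0 < A)
    {K : Set (EuclideanSpace ℝ (Fin n))} (f : EuclideanSpace ℝ (Fin n) → ℂ)
    (p : K × Σ k : ℕ, (Fin k → Fin n)) : 0 ≤ gevreyQuotient s A f p := by
  unfold gevreyQuotient; positivity

theorem gevreyQuotient_bddAbove {n : ℕ} {s A : ℝ} (hA : 0 < A)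
    {K : Set (EuclideanSpace ℝ (Fin n))} (hK : IsCompact K) (f : GevreyBeurling n s) :
    BddAbove (Set.range (gevreyQuotient s A (K := K) f)) := by
  obtain ⟨C, hC⟩ := f.2.2 K hK A hA
  refine ⟨C, ?_⟩
  rintro _ ⟨⟨x, k, J⟩, rfl⟩
  have hJ : (0 : ℝ) < wordFactorial J := by exact_mod_cast wordFactorial_pos J
  have : 0 < A ^ k * (wordFactorial J : ℝ) ^ s := by positivity
  simp only [gevreyQuotient]
  rw [div_le_iff₀ this, ← mul_assoc]
  exact hC k J x x.2

/-- The seminorm `sup_{x ∈ K, α} |∂^α f(x)| / (A^{|α|} (α!)^s)` on `γ^{(s)}(ℝⁿ)`. -/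
def gevreySeminorm {n : ℕ} {s A : ℝ} (hA : 0 < A) {K : Set (EuclideanSpace ℝ (Fin n))}
    (hK : IsCompact K) : Seminorm ℂ (GevreyBeurling n s) :=
  Seminorm.of (fun f => ⨆ p, gevreyQuotient s A (K := K) f p)
    (fun f g => by
      refine Real.iSup_le (fun p => ?_) (add_nonneg
        (Real.iSup_nonneg fun p => gevreyQuotient_nonneg s hA _ p)
        (Real.iSup_nonneg fun p => gevreyQuotient_nonneg s hA _ p))
      refine le_trans ?_ (add_le_add (le_ciSup (gevreyQuotient_bddAbove hA hK f) p)
        (le_ciSup (gevreyQuotient_bddAbove hA hK g) p))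
      have : partialDeriv p.2.2 (f + g : GevreyBeurling n s) p.1 =
          partialDeriv p.2.2 f p.1 + partialDeriv p.2.2 g p.1 :=
        partialDeriv_add _ f.2.1 g.2.1 _
      simp only [gevreyQuotient]
      rw [this, ← add_div]
      gcongr
      exact norm_add_le _ _)
    (fun c f => by
      rw [Real.mul_iSup_of_nonneg (norm_nonneg c)]
      congr 1
      funext p
      have : partialDeriv p.2.2 (c • f : GevreyBeurling n s) p.1 =
          c * partialDeriv p.2.2 f p.1 := partialDeriv_smul _ c f.2.1 _
      simp only [gevreyQuotient]
      rw [this, norm_mul, mul_div_assoc])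

/-- The defining seminorms of `γ^{(s)}(ℝⁿ)`, indexed by the compact sets `K` and the reals
`A > 0`. -/
def gevreySeminorms (n : ℕ) (s : ℝ) :
    SeminormFamily ℂ (GevreyBeurling n s)
      ({K : Set (EuclideanSpace ℝ (Fin n)) // IsCompact K} × {A : ℝ // 0 < A}) :=
  fun i => gevreySeminorm i.2.2 i.1.2

instance (n : ℕ) : Nonempty
    ({K : Set (EuclideanSpace ℝ (Fin n)) // IsCompact K} × {A : ℝ // 0 < A}) :=
  ⟨⟨⟨∅, isCompact_empty⟩, ⟨1, one_pos⟩⟩⟩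

/-- The usual locally convex topology of `γ^{(s)}(ℝⁿ)`. -/
instance (n : ℕ) (s : ℝ) : TopologicalSpace (GevreyBeurling n s) :=
  (gevreySeminorms n s).moduleFilterBasis.topology

theorem withSeminorms_gevrey (n : ℕ) (s : ℝ) : WithSeminorms (gevreySeminorms n s) := ⟨rfl⟩

/-- The space `E'_{(s)}(ℝⁿ)` of compactly supported Gevrey Beurling ultradistributions, the
topological dual of `γ^{(s)}(ℝⁿ)`. -/
abbrev GevreyUltradistribution (n : ℕ) (s : ℝ) : Type := GevreyBeurling n s →L[ℂ] ℂ

/-! ### The inclusion `A(ℝⁿ) ⊂ γ^{(s)}(ℝⁿ)` for `s > 1` -/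

theorem sum_wordIndex {n k : ℕ} (J : Fin k → Fin n) : ∑ i, wordIndex J i = k := by
  have := Finset.card_eq_sum_card_fiberwise (f := J) (s := Finset.univ) (t := Finset.univ)
    (fun _ _ => Finset.mem_coe.2 (Finset.mem_univ _))
  simpa [wordIndex] using this.symm

theorem factorial_le_wordFactorial {n k : ℕ} (J : Fin k → Fin n) :
    k ! ≤ n ^ k * wordFactorial J := by
  have h1 : Nat.multinomial Finset.univ (wordIndex J) ≤ n ^ k := by
    have h := Finset.sum_pow_eq_sum_piAntidiag (R := ℕ) Finset.univ (fun _ : Fin n => 1) k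
    simp only [Finset.sum_const, Finset.card_univ, Fintype.card_fin, smul_eq_mul, mul_one, one_pow,
      Finset.prod_const_one, Nat.cast_id] at h
    rw [h]
    exact Finset.single_le_sum (f := fun a => Nat.multinomial Finset.univ a)
      (fun _ _ => Nat.zero_le _)
      (Finset.mem_piAntidiag.2 ⟨sum_wordIndex J, fun _ _ => Finset.mem_univ _⟩)
  have h2 := Nat.multinomial_spec Finset.univ (wordIndex J)
  rw [sum_wordIndex] at h2
  rw [← h2, mul_comm, wordFactorial]
  gcongr

/-- Locally uniform Cauchy estimates for the derivatives of an analytic function. -/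
theorem exists_cauchy_estimate {n : ℕ} {f : EuclideanSpace ℝ (Fin n) → ℂ}
    (hf : AnalyticOnNhd ℝ f Set.univ) (x₀ : EuclideanSpace ℝ (Fin n)) :
    ∃ U ∈ nhds x₀, ∃ T R : ℝ, 0 ≤ T ∧ 0 < R ∧ ∀ x ∈ U, ∀ (k : ℕ) (J : Fin k → Fin n),
      ‖partialDeriv J f x‖ ≤ T * R ^ k * k ! := by
  obtain ⟨p, r, hp⟩ := hf x₀ (Set.mem_univ _)
  obtain ⟨a, ha0, har⟩ := ENNReal.lt_iff_exists_nnreal_btwn.1 hp.r_pos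
  have ha : 0 < a := by exact_mod_cast ha0
  have hsum : ((a / 2 : ℝ≥0) + (a / 2 : ℝ≥0) : ℝ≥0∞) < p.radius := by
    rw [← ENNReal.coe_add, add_halves]
    exact har.trans_le hp.r_le
  have hS := p.changeOriginSeries_summable_aux₁ hsum
  set b : ℝ≥0 := a / 2 with hb
  have hb0 : 0 < b := by positivity
  set T : ℝ≥0 := ∑' s : Σ k l : ℕ, { s : Finset (Fin (k + l)) // s.card = l },
    ‖p (s.1 + s.2.1)‖₊ * b ^ s.2.1 * b ^ s.1 with hT
  refine ⟨Metric.ball x₀ b, Metric.ball_mem_nhds _ hb0, T, (b : ℝ)⁻¹, T.2, by positivity, ?_⟩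
  intro x hx k J
  obtain ⟨y, rfl⟩ : ∃ y, x = x₀ + y := ⟨x - x₀, by abel⟩
  have hy : ‖y‖₊ < b := by
    have : ‖y‖ < b := by simpa [mem_ball_iff_norm] using hx
    exact_mod_cast this
  have hya : (‖y‖₊ : ℝ≥0∞) < r := by
    refine lt_trans ?_ har
    have : b ≤ a := by rw [hb]; exact half_le_self ha.le
    exact_mod_cast hy.trans_le this
  have hyr : (‖y‖₊ : ℝ≥0∞) < p.radius := hya.trans_le hp.r_le
  have hq : ‖p.changeOrigin y k‖₊ * b ^ k ≤ T := by
    have h1 : ‖p.changeOrigin y k‖₊ ≤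
        ∑' s : Σ l : ℕ, { s : Finset (Fin (k + l)) // s.card = l },
          ‖p (k + s.1)‖₊ * b ^ s.1 := by
      refine (p.nnnorm_changeOrigin_le k hyr).trans ?_
      refine (p.changeOriginSeries_summable_aux₂ hyr k).tsum_le_tsum (fun s => ?_)
        (p.changeOriginSeries_summable_aux₂ (r := b) ?_ k)
      · gcongr
      · refine lt_of_le_of_lt ?_ hsum
        exact le_self_add
    calc _ ≤ _ := mul_le_mul_left h1 (b ^ k)
      _ = ∑' s : Σ l : ℕ, { s : Finset (Fin (k + l)) // s.card = l },
          ‖p (k + s.1)‖₊ * b ^ s.1 * b ^ k := by rw [NNReal.tsum_mul_right]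
      _ ≤ T := by
        rw [hT, hS.tsum_sigma' fun k => (NNReal.summable_sigma.1 hS).1 k]
        exact ((NNReal.summable_sigma.1 hS).2).le_tsum k fun _ _ => zero_le
  have hq' : ‖p.changeOrigin y k‖ ≤ T * ((b : ℝ)⁻¹) ^ k := by
    rw [inv_pow, ← div_eq_mul_inv, le_div_iff₀ (by positivity)]
    exact_mod_cast hq
  have hder := (hp.changeOrigin (y := y) hya).iteratedFDeriv_eq_sum_of_completeSpace
    (n := k) (fun j => EuclideanSpace.single (J j) (1 : ℝ))
  rw [partialDeriv, hder]
  refine (norm_sum_le _ _).trans ?_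
  calc _ ≤ ∑ _σ : Equiv.Perm (Fin k), T * ((b : ℝ)⁻¹) ^ k := by
        refine Finset.sum_le_sum fun σ _ => ?_
        refine (ContinuousMultilinearMap.le_opNorm _ _).trans ?_
        simpa using hq'
    _ = _ := by
        simp [Fintype.card_perm]; ring

theorem IsGevreyBeurling.of_analytic {n : ℕ} {s : ℝ} (hs : 1 < s)
    {f : EuclideanSpace ℝ (Fin n) → ℂ} (hf : AnalyticOnNhd ℝ f Set.univ) :
    IsGevreyBeurling s f := by
  refine ⟨hf.contDiff, fun K hK A hA => ?_⟩
  refine hK.induction_on (p := fun S => ∃ C : ℝ, ∀ (k : ℕ) (J : Fin k → Fin n), ∀ x ∈ S,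
      ‖partialDeriv J f x‖ ≤ C * A ^ k * (wordFactorial J : ℝ) ^ s) ?_ ?_ ?_ ?_
  · exact ⟨0, fun _ _ _ h => h.elim⟩
  · rintro S S' hSS' ⟨C, hC⟩
    exact ⟨C, fun k J x hx => hC k J x (hSS' hx)⟩
  · rintro S S' ⟨C, hC⟩ ⟨D, hD⟩
    refine ⟨max C D, fun k J x hx => ?_⟩
    rcases hx with hx | hx
    · refine (hC k J x hx).trans ?_
      gcongr
      exact le_max_left _ _
    · refine (hD k J x hx).trans ?_
      gcongr
      exact le_max_right _ _
  · intro x₀ _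
    obtain ⟨U, hU, T, R, hT, hR, h⟩ := exists_cauchy_estimate hf x₀
    refine ⟨U, mem_nhdsWithin_of_mem_nhds hU, ?_⟩
    set N : ℝ := n + 1 with hN
    have hN0 : 0 < N := by positivity
    have hs1 : 0 < s - 1 := sub_pos.2 hs
    set Q : ℝ := R * N ^ s / A with hQ
    have hQ0 : 0 < Q := by positivity
    set B : ℝ := Q ^ (1 / (s - 1)) with hB
    have hB0 : 0 < B := by positivity
    refine ⟨T * Real.exp B ^ (s - 1), fun k J x hx => (h x hx k J).trans ?_⟩
    have hk : (0 : ℝ) < k ! := by positivity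
    have h1 : Q ^ k ≤ Real.exp B ^ (s - 1) * (k ! : ℝ) ^ (s - 1) := by
      have e : Q ^ k = (B ^ k) ^ (s - 1) := by
        rw [hB, ← Real.rpow_natCast, ← Real.rpow_natCast, ← Real.rpow_mul hQ0.le,
          ← Real.rpow_mul hQ0.le]
        congr 1
        field_simp
      rw [e, ← Real.mul_rpow (Real.exp_pos B).le hk.le]
      refine Real.rpow_le_rpow (by positivity) ?_ hs1.le
      rw [← div_le_iff₀ hk]
      exact Real.pow_div_factorial_le_exp B hB0.le k
    have h2 : (k ! : ℝ) ≤ N ^ k * wordFactorial J := by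
      have h3 : (k ! : ℝ) ≤ (n : ℝ) ^ k * wordFactorial J := by
        exact_mod_cast factorial_le_wordFactorial J
      refine h3.trans ?_
      gcongr
      rw [hN]
      linarith
    have h3 : (k ! : ℝ) ^ s ≤ (N ^ s) ^ k * (wordFactorial J : ℝ) ^ s := by
      refine (Real.rpow_le_rpow hk.le h2 (by linarith)).trans_eq ?_
      rw [Real.mul_rpow (by positivity) (by positivity), ← Real.rpow_natCast, ← Real.rpow_natCast,
        ← Real.rpow_mul hN0.le, ← Real.rpow_mul hN0.le, mul_comm (k : ℝ)]
    have h4 : (k ! : ℝ) ^ (s - 1) * k ! = (k ! : ℝ) ^ s := by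
      rw [Real.rpow_sub_one hk.ne', div_mul_cancel₀ _ hk.ne']
    have h5 : R ^ k = Q ^ k * A ^ k / (N ^ s) ^ k := by
      rw [← mul_pow, ← div_pow]
      congr 1
      rw [hQ]
      field_simp
    have hNs : 0 < (N ^ s) ^ k := by positivity
    calc T * R ^ k * k ! = T * (Q ^ k * (A ^ k / (N ^ s) ^ k) * k !) := by rw [h5]; ring
      _ ≤ T * (Real.exp B ^ (s - 1) * (k ! : ℝ) ^ (s - 1) * (A ^ k / (N ^ s) ^ k) * k !) := by
        gcongr
      _ = T * Real.exp B ^ (s - 1) * A ^ k * ((k ! : ℝ) ^ s / (N ^ s) ^ k) := by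
        rw [← h4]; ring
      _ ≤ T * Real.exp B ^ (s - 1) * A ^ k * (wordFactorial J : ℝ) ^ s := by
        gcongr
        rw [div_le_iff₀ hNs]
        linarith

/-- The inclusion `A(ℝⁿ) ⊂ γ^{(s)}(ℝⁿ)`, for `s > 1`. -/
def RealAnalytic.toGevrey {n : ℕ} {s : ℝ} (hs : 1 < s) (f : RealAnalytic n) :
    GevreyBeurling n s :=
  ⟨f.1, IsGevreyBeurling.of_analytic hs f.2⟩

end

/-! Part (i). A continuous `v` is bounded by finitely many Gevrey seminorms, so `v̂` is estimated by
the seminorms of `e^{-ix·ξ}`. Each derivative costs at most a factor `|ξ|`, and the supremum over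
`k` of `t^k / (k!)^s` is at most `exp(s t^{1/s})`. Every seminorm of the exponential is therefore at
most `exp(c ⟨ξ⟩^{1/s})` (`gevreySeminorm_fourierExp_le`). Taking `ρ` one larger than needed leaves a
factor `e^{-⟨ξ⟩^{1/s}}`, which absorbs any power of `⟨ξ⟩` and gives square integrability. The
restriction of `v` to `A(ℝⁿ)` is continuous because Cauchy estimates bound each Gevrey seminorm over
`K` by the supremum on any complex neighbourhood of `K` (`carriedBy_gevreySeminorm`).

Part (ii). Let `χ` be a compactly supported Gevrey Beurling cutoff, equal to `1` near the carrier
`K`; such functions exist because `s > 1`. The extension is the Fourier inversion formula `v(f) =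
(2π)⁻ⁿ ∫ (∫ e^{iy·η} χ(y) f(y) dy) ŵ(η) dη`. For Gevrey Beurling `f` the inner transform decays like
`e^{-(ρ+1)|η|^{1/s}}`, with a continuous seminorm of `f` as constant
(`exists_fourierLaplace_decay`). By Cauchy–Schwarz it pairs with `ŵ`, so `v` is a continuous
functional.

The heart is that this formula returns `w f` for real analytic `f`
(`apply_eq_integral_fourierTransform`). Inserting `e^{-ε|η|²}` and replacing `ŵ(η)` by `e^{-iz·η}`
gives the convolution of `χ f` with a Gaussian, an entire function of `z`. As `ε → 0` it must
converge to the holomorphic extension `F` of `f` uniformly on a complex neighbourhood of `K`, since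
only such convergence is seen by `w`. For `z = a + ib` the contour is moved from `y` to `y + ib`,
which makes the kernel real and an ordinary approximate identity. As `F` is holomorphic, the error
involves only `dχ`, that is points `y` far from `a`, where the kernel is exponentially small
(`exists_shift_bound`, `eventually_norm_gaussConv_sub_le`). To move `w` under the integral over `η`,
it is factored by Hahn–Banach through continuous functions on a compact tube
(`exists_extension_continuousMap`), where Bochner integrals are available. -/

noncomputable section

/-! ### Gevrey cutoff functions -/

/-- The function `x ↦ x⁻ʲ exp(-x⁻ᵐ)` on `x > 0`, extended by zero. -/
def invPowExp (m j : ℕ) (x : ℝ) : ℝ :=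
  if x ≤ 0 then 0 else (x ^ j)⁻¹ * Real.exp (-(x ^ m)⁻¹)

theorem invPowExp_of_nonpos {m j : ℕ} {x : ℝ} (hx : x ≤ 0) : invPowExp m j x = 0 := if_pos hx

theorem invPowExp_of_pos {m j : ℕ} {x : ℝ} (hx : 0 < x) :
    invPowExp m j x = (x ^ j)⁻¹ * Real.exp (-(x ^ m)⁻¹) := if_neg hx.not_ge

theorem invPowExp_nonneg (m j : ℕ) (x : ℝ) : 0 ≤ invPowExp m j x := by
  unfold invPowExp; split_ifs with h
  · exact le_rfl
  · have : 0 < x := not_le.1 h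
    positivity

/-- In the variable `t = x⁻ᵐ` the function is `t^p e^{-t}` with `p = j/m`. Raising `t/p ≤ e^{t/p}`
to the power `p` bounds it by `p^p ≤ j^p`. -/
theorem invPowExp_le {m : ℕ} (hm : 0 < m) (j : ℕ) (x : ℝ) :
    invPowExp m j x ≤ (j : ℝ) ^ ((j : ℝ) / m) := by
  rcases le_or_gt x 0 with hx | hx
  · rw [invPowExp_of_nonpos hx]; positivity
  rw [invPowExp_of_pos hx]
  rcases Nat.eq_zero_or_pos j with rfl | hj
  · simp [hx.le]
  have hm' : (1 : ℝ) ≤ m := by exact_mod_cast hm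
  have hj' : (1 : ℝ) ≤ j := by exact_mod_cast hj
  set t : ℝ := (x ^ m)⁻¹ with ht
  have ht0 : 0 < t := by positivity
  set p : ℝ := (j : ℝ) / m with hp
  have hp0 : 0 < p := by positivity
  have e : (x ^ j)⁻¹ = t ^ p := by
    rw [ht, ← inv_pow, ← inv_pow, ← Real.rpow_natCast, ← Real.rpow_natCast,
      ← Real.rpow_mul (by positivity)]
    congr 1
    rw [hp]; field_simp
  have h1 : t / p ≤ Real.exp (t / p) := by
    have := Real.add_one_le_exp (t / p); linarith
  have h2 : t ^ p ≤ p ^ p * Real.exp t := by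
    have h := Real.rpow_le_rpow (by positivity) h1 hp0.le
    rw [Real.div_rpow ht0.le hp0.le, ← Real.exp_mul, div_mul_cancel₀ _ hp0.ne',
      div_le_iff₀ (by positivity)] at h
    linarith
  have h3 : p ^ p ≤ (j : ℝ) ^ p :=
    Real.rpow_le_rpow hp0.le (div_le_self (by positivity) hm') hp0.le
  rw [e, Real.exp_neg, ← div_eq_mul_inv, div_le_iff₀ (Real.exp_pos _)]
  exact h2.trans (by gcongr)

/-- The point of the second index `j` is that the family is closed under differentiation, so all
derivatives can be estimated by induction. -/
theorem hasDerivAt_invPowExp {m : ℕ} (hm : 0 < m) (j : ℕ) (x : ℝ) :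
    HasDerivAt (invPowExp m j)
      (-(j * invPowExp m (j + 1) x) + m * invPowExp m (j + m + 1) x) x := by
  rcases lt_trichotomy x 0 with hx | rfl | hx
  · rw [invPowExp_of_nonpos hx.le, invPowExp_of_nonpos hx.le]
    have : invPowExp m j =ᶠ[nhds x] fun _ => 0 := by
      filter_upwards [Iio_mem_nhds hx] with y hy using invPowExp_of_nonpos (le_of_lt hy)
    simpa using (hasDerivAt_const x (0 : ℝ)).congr_of_eventuallyEq this
  · rw [invPowExp_of_nonpos le_rfl, invPowExp_of_nonpos le_rfl]
    -- Raising the index from `j` to `j + 2` exhibits a factor `y²`, so the function is `O(y²)` at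
    -- the origin and its derivative there is zero.
    have hB : ∀ y, |invPowExp m j y| ≤ ((j + 2 : ℕ) : ℝ) ^ (((j + 2 : ℕ) : ℝ) / m) * y ^ 2 := by
      intro y
      rw [abs_of_nonneg (invPowExp_nonneg _ _ _)]
      rcases le_or_gt y 0 with hy | hy
      · rw [invPowExp_of_nonpos hy]; positivity
      have := invPowExp_le hm (j + 2) y
      have e : invPowExp m j y = invPowExp m (j + 2) y * y ^ 2 := by
        rw [invPowExp_of_pos hy, invPowExp_of_pos hy]
        field_simp
        ring
      rw [e]; gcongr
    rw [hasDerivAt_iff_isLittleO]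
    simp only [invPowExp_of_nonpos (le_refl (0 : ℝ)), sub_zero, mul_zero, neg_zero, add_zero,
      smul_zero]
    have h1 : invPowExp m j =O[nhds 0] fun y : ℝ => y ^ 2 :=
      Asymptotics.IsBigO.of_bound _ (Filter.Eventually.of_forall fun y => by
        rw [Real.norm_eq_abs, Real.norm_of_nonneg (sq_nonneg y)]; exact hB y)
    refine h1.trans_isLittleO ?_
    simpa using Asymptotics.isLittleO_pow_pow (𝕜 := ℝ) (m := 1) (n := 2) (by norm_num)
  · have hev : invPowExp m j =ᶠ[nhds x] fun y => (y ^ j)⁻¹ * Real.exp (-(y ^ m)⁻¹) := by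
      filter_upwards [Ioi_mem_nhds hx] with y hy using invPowExp_of_pos hy
    refine HasDerivAt.congr_of_eventuallyEq ?_ hev
    have h1 := (hasDerivAt_pow j x).inv (by positivity)
    have h2 := (((hasDerivAt_pow m x).inv (by positivity)).neg).exp
    convert! h1.mul h2 using 1
    rw [invPowExp_of_pos hx, invPowExp_of_pos hx]
    have hj : (j : ℝ) * x ^ (j - 1) = j * x ^ j / x := by
      rcases j with _ | j
      · simp
      · simp [pow_succ]; field_simp
    have hm' : (m : ℝ) * x ^ (m - 1) = m * x ^ m / x := by
      obtain ⟨k, rfl⟩ := Nat.exists_eq_succ_of_ne_zero hm.ne'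
      simp [pow_succ]; field_simp
    simp only [Pi.inv_apply, Pi.neg_apply]
    rw [hj, hm']
    field_simp
    ring

/-- One derivative raises the index by `1` with coefficient `j`, or by `m + 1` with coefficient `m`.
The resulting growth in `k`, up to geometric factors, is that of `k^{k(1+1/m)}`: Gevrey order `1 +
1/m`. -/
theorem invPowExp_iteratedDeriv_le {m : ℕ} (hm : 0 < m) (k : ℕ) : ∀ j : ℕ,
    ContDiff ℝ k (invPowExp m j) ∧ ∀ x, |iteratedDeriv k (invPowExp m j) x| ≤
      (m + 1 : ℝ) ^ k * ((j + (m + 1) * k : ℕ) : ℝ) ^ (((j + (m + 1) * k : ℕ) : ℝ) / m) := by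
  induction k with
  | zero =>
    intro j
    refine ⟨contDiff_zero.2 (continuous_iff_continuousAt.2 fun x =>
      (hasDerivAt_invPowExp hm j x).continuousAt), fun x => ?_⟩
    simpa [abs_of_nonneg (invPowExp_nonneg _ _ _)] using invPowExp_le hm j x
  | succ k ih =>
    intro j
    have hd : deriv (invPowExp m j) =
        fun x => -(j * invPowExp m (j + 1) x) + m * invPowExp m (j + m + 1) x :=
      funext fun x => (hasDerivAt_invPowExp hm j x).deriv
    have c1 : ContDiff ℝ k fun x => (j : ℝ) * invPowExp m (j + 1) x :=
      contDiff_const.mul (ih (j + 1)).1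
    have c2 : ContDiff ℝ k fun x => (m : ℝ) * invPowExp m (j + m + 1) x :=
      contDiff_const.mul (ih (j + m + 1)).1
    constructor
    · push_cast
      rw [contDiff_succ_iff_deriv]
      refine ⟨fun x => (hasDerivAt_invPowExp hm j x).differentiableAt, by simp, ?_⟩
      rw [hd]
      exact c1.neg.add c2
    · intro x
      rw [iteratedDeriv_succ', hd, iteratedDeriv_fun_add c1.neg.contDiffAt c2.contDiffAt,
        iteratedDeriv_fun_neg, iteratedDeriv_const_mul _ (ih (j + 1)).1.contDiffAt,
        iteratedDeriv_const_mul _ (ih (j + m + 1)).1.contDiffAt]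
      have b1 := (ih (j + 1)).2 x
      have b2 := (ih (j + m + 1)).2 x
      have hm' : (1 : ℝ) ≤ m := by exact_mod_cast hm
      set N : ℝ := ((j + (m + 1) * (k + 1) : ℕ) : ℝ) with hN
      have e2 : ((j + m + 1 + (m + 1) * k : ℕ) : ℝ) = N := by rw [hN]; push_cast; ring
      have e1 : ((j + 1 + (m + 1) * k : ℕ) : ℝ) = N - m := by rw [hN]; push_cast; ring
      rw [e2] at b2
      rw [e1] at b1
      have hNm : 1 ≤ N - m := by
        rw [← e1]; exact_mod_cast (by omega : 1 ≤ j + 1 + (m + 1) * k)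
      have hjN : (j : ℝ) ≤ N := by rw [hN]; exact_mod_cast Nat.le_add_right _ _
      have hN0 : 0 < N := by linarith
      -- The term with the large coefficient `j` has an index smaller by `m`, hence an exponent
      -- smaller by exactly one, which pays for `j ≤ N`.
      have h3 : (j : ℝ) * (N - m) ^ ((N - m) / m) ≤ N ^ (N / m) := by
        calc (j : ℝ) * (N - m) ^ ((N - m) / m) ≤ N * N ^ ((N - m) / m) := by
              gcongr
              linarith
          _ = N ^ (N / m) := by
              rw [← Real.rpow_one_add' hN0.le (by positivity)]
              congr 1; field_simp; ring
      calc |-(j * iteratedDeriv k (invPowExp m (j + 1)) x) +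
            m * iteratedDeriv k (invPowExp m (j + m + 1)) x|
          ≤ j * |iteratedDeriv k (invPowExp m (j + 1)) x| +
            m * |iteratedDeriv k (invPowExp m (j + m + 1)) x| := by
            refine (abs_add_le _ _).trans ?_
            rw [abs_neg, abs_mul, abs_mul, Nat.abs_cast, Nat.abs_cast]
        _ ≤ j * ((m + 1 : ℝ) ^ k * (N - m) ^ ((N - m) / m)) +
            m * ((m + 1 : ℝ) ^ k * N ^ (N / m)) := by gcongr
        _ = (m + 1 : ℝ) ^ k * (j * (N - m) ^ ((N - m) / m)) +
            m * ((m + 1 : ℝ) ^ k * N ^ (N / m)) := by ring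
        _ ≤ (m + 1 : ℝ) ^ k * N ^ (N / m) + m * ((m + 1 : ℝ) ^ k * N ^ (N / m)) := by gcongr
        _ = _ := by rw [pow_succ]; ring

/-- Geometric growth is dominated by any positive power of the factorial. -/
theorem exists_pow_le_factorial_rpow {Q σ : ℝ} (hQ : 0 < Q) (hσ : 0 < σ) :
    ∃ C : ℝ, 0 < C ∧ ∀ k : ℕ, Q ^ k ≤ C * (k ! : ℝ) ^ σ := by
  -- With this `B`, `Q^k = (B^k)^σ`, and `B^k ≤ e^B k!` is one term of the exponential series.
  set B : ℝ := Q ^ (1 / σ) with hB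
  have hB0 : 0 < B := by positivity
  refine ⟨Real.exp B ^ σ, by positivity, fun k => ?_⟩
  have hk : (0 : ℝ) < k ! := by positivity
  have e : Q ^ k = (B ^ k) ^ σ := by
    rw [hB, ← Real.rpow_natCast, ← Real.rpow_natCast, ← Real.rpow_mul hQ.le,
      ← Real.rpow_mul hQ.le]
    congr 1
    field_simp
  rw [e, ← Real.mul_rpow (Real.exp_pos B).le hk.le]
  refine Real.rpow_le_rpow (by positivity) ?_ hσ.le
  rw [← div_le_iff₀ hk]
  exact Real.pow_div_factorial_le_exp B hB0.le k

/-! ### Calculus of functions with uniform Gevrey Beurling bounds -/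

section UniformlyGevrey

variable {V W : Type*} [NormedAddCommGroup V] [NormedSpace ℝ V] [NormedAddCommGroup W]
  [NormedSpace ℝ W]

/-- Real-valued functions satisfying the Gevrey Beurling estimates uniformly on the whole space. -/
def IsUniformlyGevrey (s : ℝ) (f : V → ℝ) : Prop :=
  ContDiff ℝ (⊤ : ℕ∞) f ∧ ∀ A : ℝ, 0 < A → ∃ C : ℝ, ∀ (k : ℕ) (x : V),
    ‖iteratedFDeriv ℝ k f x‖ ≤ C * A ^ k * (k ! : ℝ) ^ s

theorem IsUniformlyGevrey.exists_nonneg {s : ℝ} {f : V → ℝ} (hf : IsUniformlyGevrey s f)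
    {A : ℝ} (hA : 0 < A) : ∃ C : ℝ, 0 ≤ C ∧ ∀ (k : ℕ) (x : V),
    ‖iteratedFDeriv ℝ k f x‖ ≤ C * A ^ k * (k ! : ℝ) ^ s := by
  obtain ⟨C, hC⟩ := hf.2 A hA
  refine ⟨max C 0, le_max_right _ _, fun k x => (hC k x).trans ?_⟩
  gcongr
  exact le_max_left _ _

/-- The sum in the Leibniz formula, for Gevrey bounds on the two factors. -/
theorem sum_choose_mul_gevrey_le {s A C D : ℝ} (hs : 0 ≤ s) (hA : 0 < A) (hC : 0 ≤ C)
    (hD : 0 ≤ D) (k : ℕ) :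
    ∑ i ∈ Finset.range (k + 1), (k.choose i : ℝ) * (C * A ^ i * (i ! : ℝ) ^ s) *
      (D * A ^ (k - i) * ((k - i)! : ℝ) ^ s) ≤ C * D * (2 * A) ^ k * (k ! : ℝ) ^ s := by
  calc _ ≤ ∑ i ∈ Finset.range (k + 1), (k.choose i : ℝ) * (C * D * A ^ k * (k ! : ℝ) ^ s) := by
        refine Finset.sum_le_sum fun i hi => ?_
        have hik : i ≤ k := Nat.lt_succ_iff.1 (Finset.mem_range.1 hi)
        have h1 : (i ! : ℝ) ^ s * ((k - i)! : ℝ) ^ s ≤ (k ! : ℝ) ^ s := by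
          rw [← Real.mul_rpow (by positivity) (by positivity)]
          refine Real.rpow_le_rpow (by positivity) ?_ hs
          exact_mod_cast Nat.le_of_dvd (Nat.factorial_pos k) (Nat.factorial_mul_factorial_dvd_factorial hik)
        have h2 : A ^ i * A ^ (k - i) = A ^ k := by rw [← pow_add, Nat.add_sub_cancel' hik]
        calc _ = (k.choose i : ℝ) * (C * D * (A ^ i * A ^ (k - i)) *
              ((i ! : ℝ) ^ s * ((k - i)! : ℝ) ^ s)) := by ring
          _ ≤ _ := by rw [h2]; gcongr
    _ = _ := by
        rw [← Finset.sum_mul]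
        have := Nat.sum_range_choose k
        have h : ∑ i ∈ Finset.range (k + 1), (k.choose i : ℝ) = 2 ^ k := by exact_mod_cast this
        rw [h, mul_pow]; ring

/-- The Leibniz formula costs a factor `2^k`. Since every `A > 0` is allowed, it is absorbed by
using `A/2` for both factors. -/
theorem IsUniformlyGevrey.mul {s : ℝ} (hs : 0 ≤ s) {f g : V → ℝ} (hf : IsUniformlyGevrey s f)
    (hg : IsUniformlyGevrey s g) : IsUniformlyGevrey s fun x => f x * g x := by
  refine ⟨hf.1.mul hg.1, fun A hA => ?_⟩
  obtain ⟨C, hC0, hC⟩ := hf.exists_nonneg (half_pos hA)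
  obtain ⟨D, hD0, hD⟩ := hg.exists_nonneg (half_pos hA)
  refine ⟨C * D, fun k x => ?_⟩
  refine (norm_iteratedFDeriv_mul_le hf.1 hg.1 x (n := k) (by exact_mod_cast le_top)).trans ?_
  refine le_trans ?_ ((sum_choose_mul_gevrey_le hs (half_pos hA) hC0 hD0 k).trans_eq (by
    rw [mul_div_cancel₀ _ two_ne_zero]))
  refine Finset.sum_le_sum fun i _ => ?_
  gcongr
  · exact hC i x
  · exact hD (k - i) x

theorem IsUniformlyGevrey.const (s c : ℝ) : IsUniformlyGevrey s fun _ : V => c := by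
  refine ⟨contDiff_const, fun A hA => ⟨|c|, fun k x => ?_⟩⟩
  rcases k with _ | k
  · simp
  · rw [iteratedFDeriv_const_of_ne (by simp)]
    simp; positivity

theorem IsUniformlyGevrey.comp_clm {s : ℝ} {f : W → ℝ} (hf : IsUniformlyGevrey s f)
    (L : V →L[ℝ] W) : IsUniformlyGevrey s fun x => f (L x) := by
  refine ⟨hf.1.comp L.contDiff, fun A hA => ?_⟩
  have hL : 0 < ‖L‖ + 1 := by positivity
  obtain ⟨C, hC0, hC⟩ := hf.exists_nonneg (div_pos hA hL)
  refine ⟨C, fun k x => ?_⟩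
  have h := L.iteratedFDeriv_comp_right (f := f) (hf.1.of_le (by exact_mod_cast le_top : (k : WithTop ℕ∞) ≤ _)) x (i := k) le_rfl
  change ‖iteratedFDeriv ℝ k (f ∘ L) x‖ ≤ _
  rw [h]
  refine (ContinuousMultilinearMap.norm_compContinuousLinearMap_le _ _).trans ?_
  rw [Finset.prod_const, Finset.card_univ, Fintype.card_fin]
  calc _ ≤ C * (A / (‖L‖ + 1)) ^ k * (k ! : ℝ) ^ s * (‖L‖ + 1) ^ k := by
        gcongr
        · exact hC k _
        · linarith
    _ = _ := by rw [div_pow]; field_simp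

theorem IsUniformlyGevrey.comp_add_right {s : ℝ} {f : V → ℝ} (hf : IsUniformlyGevrey s f)
    (a : V) : IsUniformlyGevrey s fun x => f (x + a) := by
  refine ⟨hf.1.comp (contDiff_id.add contDiff_const), fun A hA => ?_⟩
  obtain ⟨C, hC⟩ := hf.2 A hA
  refine ⟨C, fun k x => ?_⟩
  rw [iteratedFDeriv_comp_add_right]
  exact hC k _

theorem IsUniformlyGevrey.prod {s : ℝ} (hs : 0 ≤ s) {ι : Type*} (t : Finset ι) {f : ι → V → ℝ}
    (hf : ∀ i ∈ t, IsUniformlyGevrey s (f i)) : IsUniformlyGevrey s fun x => ∏ i ∈ t, f i x := by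
  classical
  induction t using Finset.induction_on with
  | empty => simpa using IsUniformlyGevrey.const s 1
  | insert i t hi ih =>
    simp_rw [Finset.prod_insert hi]
    exact (hf i (by simp)).mul hs (ih fun j hj => hf j (by simp [hj]))

end UniformlyGevrey

/-- The derivatives grow like a geometric factor times `(k!)^a` with `a = 1 + 1/m`. Because `a < s`,
the spare `(k!)^{s-a}` dominates any geometric factor, which gives the bound for every `A`. -/
theorem isUniformlyGevrey_invPowExp {s : ℝ} {m : ℕ} (hm : 0 < m) (hms : 1 + 1 / (m : ℝ) < s) :
    IsUniformlyGevrey s (invPowExp m 0) := by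
  refine ⟨contDiff_infty.2 fun k => (invPowExp_iteratedDeriv_le hm k 0).1, fun A hA => ?_⟩
  set a : ℝ := 1 + 1 / (m : ℝ) with ha
  have hm' : (1 : ℝ) ≤ m := by exact_mod_cast hm
  have ha0 : 0 < a := by positivity
  set M : ℝ := m + 1 with hM
  have hM0 : 0 < M := by positivity
  set Q : ℝ := M * (M * Real.exp 1) ^ a / A with hQ
  obtain ⟨C, hC0, hC⟩ := exists_pow_le_factorial_rpow (Q := Q) (σ := s - a) (by positivity)
    (sub_pos.2 hms)
  refine ⟨C, fun k x => ?_⟩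
  rw [norm_iteratedFDeriv_eq_norm_iteratedDeriv, Real.norm_eq_abs]
  refine ((invPowExp_iteratedDeriv_le hm k 0).2 x).trans ?_
  have hk : (0 : ℝ) < k ! := by positivity
  have h1 : (k : ℝ) ^ k ≤ Real.exp 1 ^ k * k ! := by
    have := Real.pow_div_factorial_le_exp (k : ℝ) (by positivity) k
    rwa [div_le_iff₀ hk, ← mul_one (k : ℝ), Real.exp_nat_mul, mul_one] at this
  have h2 : ((0 + (m + 1) * k : ℕ) : ℝ) ^ (((0 + (m + 1) * k : ℕ) : ℝ) / m) ≤
      ((M * Real.exp 1) ^ a) ^ k * (k ! : ℝ) ^ a := by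
    have e : ((0 + (m + 1) * k : ℕ) : ℝ) = M * k := by push_cast; ring
    have e' : M * k / m = k * a := by rw [ha, hM]; field_simp
    rw [e, e', Real.rpow_mul (by positivity), Real.rpow_natCast, mul_pow]
    calc (M ^ k * (k : ℝ) ^ k) ^ a ≤ (M ^ k * (Real.exp 1 ^ k * k !)) ^ a := by gcongr
      _ = _ := by
        rw [← mul_assoc, ← mul_pow, Real.mul_rpow (by positivity) hk.le, ← Real.rpow_natCast,
          ← Real.rpow_natCast, ← Real.rpow_mul (by positivity), ← Real.rpow_mul (by positivity),
          mul_comm (k : ℝ)]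
  calc (m + 1 : ℝ) ^ k * ((0 + (m + 1) * k : ℕ) : ℝ) ^ (((0 + (m + 1) * k : ℕ) : ℝ) / m)
      ≤ M ^ k * (((M * Real.exp 1) ^ a) ^ k * (k ! : ℝ) ^ a) := by gcongr
    _ = Q ^ k * A ^ k * (k ! : ℝ) ^ a := by
        rw [hQ, div_pow, mul_pow]; field_simp
    _ ≤ C * (k ! : ℝ) ^ (s - a) * A ^ k * (k ! : ℝ) ^ a := by gcongr; exact hC k
    _ = C * A ^ k * ((k ! : ℝ) ^ (s - a) * (k ! : ℝ) ^ a) := by ring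
    _ = _ := by rw [← Real.rpow_add hk, sub_add_cancel]

theorem IsUniformlyGevrey.of_hasDerivAt {s : ℝ} (hs : 0 ≤ s) {S ψ : ℝ → ℝ}
    (hψ : IsUniformlyGevrey s ψ) (hS : ∀ x, HasDerivAt S (ψ x) x) {M : ℝ} (hM : ∀ x, |S x| ≤ M) :
    IsUniformlyGevrey s S := by
  have hd : deriv S = ψ := funext fun x => (hS x).deriv
  refine ⟨?_, fun A hA => ?_⟩
  · rw [contDiff_infty_iff_deriv, hd]
    exact ⟨fun x => (hS x).differentiableAt, hψ.1⟩
  · obtain ⟨C, hC0, hC⟩ := hψ.exists_nonneg hA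
    -- `M` serves order `0`; `C / A` serves the higher orders, where a derivative of `S` is one of
    -- `ψ` of order one less.
    refine ⟨max M (C / A), fun k x => ?_⟩
    rw [norm_iteratedFDeriv_eq_norm_iteratedDeriv]
    rcases k with _ | k
    · simpa using Or.inl (hM x)
    · rw [iteratedDeriv_succ', hd, ← norm_iteratedFDeriv_eq_norm_iteratedDeriv]
      calc _ ≤ C * A ^ k * (k ! : ℝ) ^ s := hC k x
        _ ≤ C * A ^ k * ((k + 1)! : ℝ) ^ s := by
            gcongr
            exact Nat.le_succ k
        _ = C / A * A ^ (k + 1) * ((k + 1)! : ℝ) ^ s := by rw [pow_succ]; field_simp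
        _ ≤ _ := by
            gcongr
            exact le_max_right _ _

/-- For `s > 1` there is a Gevrey Beurling step function, from `0` on `x ≤ 0` to `1` on `x ≥ 1`. -/
theorem exists_gevrey_step {s : ℝ} (hs : 1 < s) :
    ∃ S : ℝ → ℝ, IsUniformlyGevrey s S ∧ (∀ x ≤ 0, S x = 0) ∧ ∀ x, 1 ≤ x → S x = 1 := by
  -- Only `1/(m+1) < s - 1` is provided, so the exponent used below is `m + 1`.
  obtain ⟨m, hm⟩ := exists_nat_one_div_lt (sub_pos.2 hs)
  have hg : IsUniformlyGevrey s (invPowExp (m + 1) 0) :=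
    isUniformlyGevrey_invPowExp (Nat.succ_pos m) (by push_cast; linarith)
  have hg' : IsUniformlyGevrey s fun x => invPowExp (m + 1) 0 (-x + 1) :=
    (hg.comp_add_right 1).comp_clm (-ContinuousLinearMap.id ℝ ℝ)
  -- A bump vanishing outside `(0,1)`; the step function is its normalised primitive.
  set ψ : ℝ → ℝ := fun x => invPowExp (m + 1) 0 x * invPowExp (m + 1) 0 (-x + 1) with hψ
  have hψG : IsUniformlyGevrey s ψ := hg.mul (by linarith) hg'
  have hψc : Continuous ψ := hψG.1.continuous
  have hψ0 : ∀ x, 0 ≤ ψ x := fun x =>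
    mul_nonneg (invPowExp_nonneg _ _ _) (invPowExp_nonneg _ _ _)
  have hψl : ∀ x ≤ 0, ψ x = 0 := fun x hx => by simp [hψ, invPowExp_of_nonpos hx]
  have hψr : ∀ x, 1 ≤ x → ψ x = 0 := fun x hx => by
    simp [hψ, invPowExp_of_nonpos (show -x + 1 ≤ 0 by linarith)]
  have hint : ∀ a b, IntervalIntegrable ψ MeasureTheory.volume a b :=
    fun a b => hψc.intervalIntegrable a b
  set I : ℝ := ∫ t in (0 : ℝ)..1, ψ t with hI
  have hI0 : 0 < I := by
    refine intervalIntegral.intervalIntegral_pos_of_pos_on (hint 0 1) (fun x hx => ?_) one_pos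
    have h1 : 0 < -x + 1 := by linarith [hx.2]
    have h0 := hx.1
    simp only [hψ]
    rw [invPowExp_of_pos h0, invPowExp_of_pos h1]
    positivity
  have hl : ∀ x ≤ 0, ∫ t in (0 : ℝ)..x, ψ t = 0 := by
    intro x hx
    refine intervalIntegral.integral_zero_ae (Filter.Eventually.of_forall fun t ht => hψl t ?_)
    rw [Set.uIoc_of_ge hx] at ht
    exact ht.2
  have hr : ∀ x, 1 ≤ x → ∫ t in (0 : ℝ)..x, ψ t = I := by
    intro x hx
    rw [← intervalIntegral.integral_add_adjacent_intervals (hint 0 1) (hint 1 x),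
      intervalIntegral.integral_zero_ae (a := 1), add_zero]
    refine Filter.Eventually.of_forall fun t ht => hψr t ?_
    rw [Set.uIoc_of_le hx] at ht
    exact ht.1.le
  refine ⟨fun x => (∫ t in (0 : ℝ)..x, ψ t) / I, ?_, fun x hx => by simp [hl x hx],
    fun x hx => by simp [hr x hx, hI0.ne']⟩
  have hψI : IsUniformlyGevrey s fun x => ψ x * I⁻¹ :=
    hψG.mul (by linarith) (IsUniformlyGevrey.const s I⁻¹)
  refine IsUniformlyGevrey.of_hasDerivAt (by linarith) hψI (fun x => ?_) (M := 1) fun x => ?_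
  · simp_rw [div_eq_mul_inv]
    exact (intervalIntegral.integral_hasDerivAt_right (hint 0 x)
      (hψc.stronglyMeasurableAtFilter _ _) hψc.continuousAt).mul_const _
  · rcases le_total x 0 with hx | hx
    · simp [hl x hx]
    rcases le_total x 1 with hx1 | hx1
    · have h0 : 0 ≤ ∫ t in (0 : ℝ)..x, ψ t :=
        intervalIntegral.integral_nonneg hx fun t _ => hψ0 t
      have h1 : 0 ≤ ∫ t in x..1, ψ t := intervalIntegral.integral_nonneg hx1 fun t _ => hψ0 t
      have h2 := intervalIntegral.integral_add_adjacent_intervals (hint 0 x) (hint x 1)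
      rw [abs_of_nonneg (by positivity), div_le_one hI0]
      linarith
    · simp [hr x hx1, hI0.ne']

/-- For `s > 1` there are compactly supported Gevrey Beurling functions that are `1` on a given
ball. -/
theorem exists_gevrey_cutoff (n : ℕ) {s : ℝ} (hs : 1 < s) (R : ℝ) :
    ∃ χ : EuclideanSpace ℝ (Fin n) → ℝ, IsUniformlyGevrey s χ ∧ HasCompactSupport χ ∧
      ∀ x, ‖x‖ ≤ R → χ x = 1 := by
  obtain ⟨S, hS, hS0, hS1⟩ := exists_gevrey_step hs
  have h1 : ∀ i : Fin n, IsUniformlyGevrey s fun x : EuclideanSpace ℝ (Fin n) =>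
      S (x i + (R + 1)) := fun i =>
    (hS.comp_add_right (R + 1)).comp_clm (EuclideanSpace.proj i : EuclideanSpace ℝ (Fin n) →L[ℝ] ℝ)
  have h2 : ∀ i : Fin n, IsUniformlyGevrey s fun x : EuclideanSpace ℝ (Fin n) =>
      S (-x i + (R + 1)) := fun i =>
    (hS.comp_add_right (R + 1)).comp_clm
      (-EuclideanSpace.proj i : EuclideanSpace ℝ (Fin n) →L[ℝ] ℝ)
  -- In each coordinate the two factors are both `1` for `|xᵢ| ≤ R`, and one of them vanishes for
  -- `|xᵢ| ≥ R + 1`.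
  refine ⟨fun x => ∏ i, S (x i + (R + 1)) * S (-x i + (R + 1)),
    IsUniformlyGevrey.prod (by linarith) _ fun i _ => (h1 i).mul (by linarith) (h2 i), ?_, ?_⟩
  · have hc : IsCompact (WithLp.toLp 2 ''
        (Set.univ.pi fun _ : Fin n => Set.Icc (-(R + 1)) (R + 1))) :=
      (isCompact_univ_pi fun _ => isCompact_Icc).image (PiLp.continuous_toLp 2 _)
    refine HasCompactSupport.intro hc fun x hx => ?_
    by_contra hne
    refine hx ⟨WithLp.ofLp x, fun i _ => ?_, rfl⟩
    have h := Finset.prod_ne_zero_iff.1 hne i (Finset.mem_univ i)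
    have ha : ¬x i + (R + 1) ≤ 0 := fun h' => h (by rw [hS0 _ h', zero_mul])
    have hb : ¬-x i + (R + 1) ≤ 0 := fun h' => h (by rw [hS0 _ h', mul_zero])
    exact ⟨by linarith, by linarith⟩
  · intro x hx
    refine Finset.prod_eq_one fun i _ => ?_
    have := abs_le.1 ((PiLp.norm_apply_le x i).trans hx)
    rw [hS1 _ (by linarith), hS1 _ (by linarith), one_mul]

/-! ### Decay of Fourier transforms of Gevrey functions -/

/-- The Fourier transform `η ↦ ∫ e^{i y·η} g(y) dy`. -/
def fourierLaplace {n : ℕ} (g : EuclideanSpace ℝ (Fin n) → ℂ) (η : EuclideanSpace ℝ (Fin n)) : ℂ :=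
  ∫ y, Complex.exp (Complex.I * (inner ℝ y η : ℝ)) * g y

theorem fourierLaplace_eq {n : ℕ} (g : EuclideanSpace ℝ (Fin n) → ℂ)
    (η : EuclideanSpace ℝ (Fin n)) :
    fourierLaplace g η = FourierTransform.fourier g (-(2 * Real.pi)⁻¹ • η) := by
  rw [fourierLaplace, Real.fourier_eq']
  congr 1
  funext y
  rw [smul_eq_mul, inner_smul_right]
  congr 2
  push_cast
  have : (Real.pi : ℂ) ≠ 0 := by exact_mod_cast Real.pi_ne_zero
  field_simp

/-- The transform of the `k`-th derivative is evaluated on `(w, …, w)`, with `w` the rescaled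
frequency. This produces `⟨w,w⟩^k = ‖w‖^{2k}`, of which one factor `‖w‖^k` is lost to the operator
norm. -/
theorem pow_mul_norm_fourierLaplace_le {n : ℕ} {g : EuclideanSpace ℝ (Fin n) → ℂ}
    (hg : ContDiff ℝ (⊤ : ℕ∞) g) (hc : HasCompactSupport g) (k : ℕ)
    (η : EuclideanSpace ℝ (Fin n)) :
    ‖η‖ ^ k * ‖fourierLaplace g η‖ ≤ ∫ y, ‖iteratedFDeriv ℝ k g y‖ := by
  set w : EuclideanSpace ℝ (Fin n) := -(2 * Real.pi)⁻¹ • η with hw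
  have hηw : ‖η‖ = 2 * Real.pi * ‖w‖ := by
    rw [hw, norm_smul, norm_neg, norm_inv, Real.norm_of_nonneg Real.two_pi_pos.le,
      mul_inv_cancel_left₀ Real.two_pi_pos.ne']
  have hint : ∀ m : ℕ, (m : ℕ∞) ≤ ⊤ → MeasureTheory.Integrable (iteratedFDeriv ℝ m g) :=
    fun m _ => (hg.continuous_iteratedFDeriv (by exact_mod_cast le_top)).integrable_of_hasCompactSupport
      (hc.iteratedFDeriv m)
  have h1 := congrFun (Real.fourier_iteratedFDeriv hg hint (n := k) le_top) w
  have h2 : ‖FourierTransform.fourier (iteratedFDeriv ℝ k g) w‖ ≤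
      ∫ y, ‖iteratedFDeriv ℝ k g y‖ :=
    VectorFourier.norm_fourierIntegral_le_integral_norm _ _ _ _ _
  have h3 := ContinuousMultilinearMap.le_opNorm
    (FourierTransform.fourier (iteratedFDeriv ℝ k g) w) fun _ => w
  rw [h1, VectorFourier.fourierPowSMulRight_apply, ← h1, Finset.prod_const, Finset.prod_const,
    Finset.card_univ, Fintype.card_fin, norm_smul, norm_smul] at h3
  have h4 : (2 * Real.pi) ^ k * (‖w‖ ^ k * ‖w‖ ^ k * ‖FourierTransform.fourier g w‖) ≤
      (∫ y, ‖iteratedFDeriv ℝ k g y‖) * ‖w‖ ^ k := by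
    refine le_trans (le_of_eq ?_) (h3.trans (mul_le_mul_of_nonneg_right h2 (by positivity)))
    have e1 : ‖((-innerSL ℝ) w) w ^ k‖ = ‖w‖ ^ k * ‖w‖ ^ k := by
      simp only [neg_apply, innerSL_apply_apply, norm_pow, norm_neg]
      rw [real_inner_self_eq_norm_mul_norm, norm_mul, norm_norm, mul_pow]
    have e2 : ‖(-(2 * (Real.pi : ℂ) * Complex.I)) ^ k‖ = (2 * Real.pi) ^ k := by
      simp [abs_of_pos Real.pi_pos]
    rw [e1, e2]
  rw [fourierLaplace_eq, ← hw, hηw, mul_pow]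
  rcases eq_or_ne (‖w‖ ^ k) 0 with h0 | h0
  · rw [h0]
    simp only [mul_zero, zero_mul]
    exact MeasureTheory.integral_nonneg fun _ => norm_nonneg _
  · have hpos : 0 < ‖w‖ ^ k := lt_of_le_of_ne (by positivity) h0.symm
    refine le_of_mul_le_mul_right ?_ hpos
    refine le_trans (le_of_eq ?_) h4
    ring

/-- Gevrey bounds for all powers give exponential decay. -/
theorem le_exp_of_forall_pow_mul_le {s A C t x : ℝ} (hs : 0 < s) (hA : 0 < A) (hC : 0 ≤ C)
    (ht : 0 ≤ t) (hx : 0 ≤ x) (h : ∀ k : ℕ, t ^ k * x ≤ C * A ^ k * (k ! : ℝ) ^ s) :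
    x ≤ 2 ^ s * C * Real.exp (-(s / (2 * A ^ (1 / s)) * t ^ (1 / s))) := by
  set y : ℝ := (t / A) ^ (1 / s) with hy
  set X : ℝ := x ^ (1 / s) with hX
  set D : ℝ := C ^ (1 / s) with hD
  have hy0 : 0 ≤ y := by positivity
  have hX0 : 0 ≤ X := by positivity
  have hD0 : 0 ≤ D := by positivity
  -- The `s`-th root of the hypothesis turns `(k!)^s` into `k!`. The extra `2^{-k}` makes the right
  -- side summable, so the left sides can be summed to `e^{y/2} X`; raising back to the power `s`
  -- gives the constants `2^s` and `s/2`.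
  have hk : ∀ k : ℕ, (y / 2) ^ k / k ! * X ≤ D * (1 / 2) ^ k := by
    intro k
    have hk : (0 : ℝ) < k ! := by positivity
    have h1 : (t / A) ^ k * x ≤ C * (k ! : ℝ) ^ s := by
      rw [div_pow, div_mul_eq_mul_div, div_le_iff₀ (by positivity)]
      linarith [h k]
    have h2 := Real.rpow_le_rpow (by positivity) h1 (one_div_nonneg.2 hs.le)
    rw [Real.mul_rpow (by positivity) hx, Real.mul_rpow hC (by positivity), ← Real.rpow_mul hk.le,
      mul_one_div_cancel hs.ne', Real.rpow_one, ← Real.rpow_natCast, ← Real.rpow_mul (by positivity),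
      mul_comm (k : ℝ), Real.rpow_mul (by positivity), Real.rpow_natCast] at h2
    rw [div_pow, div_div, div_mul_eq_mul_div, div_le_iff₀ (by positivity)]
    refine h2.trans (le_of_eq ?_)
    rw [one_div_pow]
    field_simp
    rw [hD, one_div]
  have hsum : Real.exp (y / 2) * X ≤ 2 * D := by
    have e1 : HasSum (fun k : ℕ => (y / 2) ^ k / k ! * X) (Real.exp (y / 2) * X) := by
      have := NormedSpace.expSeries_div_hasSum_exp (𝔸 := ℝ) (y / 2)
      rw [← Real.exp_eq_exp_ℝ] at this
      exact this.mul_right X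
    have e2 : HasSum (fun k : ℕ => D * (1 / 2 : ℝ) ^ k) (D * 2) := hasSum_geometric_two.mul_left D
    linarith [hasSum_le hk e1 e2]
  have hX2 : X ≤ 2 * D * Real.exp (-(y / 2)) := by
    rw [Real.exp_neg, ← div_eq_mul_inv, le_div_iff₀ (Real.exp_pos _)]
    linarith
  have h5 := Real.rpow_le_rpow hX0 hX2 hs.le
  rw [hX, ← Real.rpow_mul hx, one_div_mul_cancel hs.ne', Real.rpow_one,
    Real.mul_rpow (by positivity) (by positivity), Real.mul_rpow (by positivity) hD0, hD,
    ← Real.rpow_mul hC, one_div_mul_cancel hs.ne', Real.rpow_one, ← Real.exp_mul] at h5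
  refine h5.trans (le_of_eq ?_)
  congr 2
  rw [hy, Real.div_rpow ht hA.le]
  field_simp

/-- The operator norm of an iterated derivative is controlled by the partial derivatives. -/
theorem norm_iteratedFDeriv_le_of_partialDeriv {n k : ℕ} {f : EuclideanSpace ℝ (Fin n) → ℂ}
    {x : EuclideanSpace ℝ (Fin n)} {B : ℝ} (hB : 0 ≤ B)
    (h : ∀ J : Fin k → Fin n, ‖partialDeriv J f x‖ ≤ B) :
    ‖iteratedFDeriv ℝ k f x‖ ≤ (n : ℝ) ^ k * B := by
  refine ContinuousMultilinearMap.opNorm_le_bound (by positivity) fun v => ?_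
  have hv : v = fun i => ∑ j, v i j • EuclideanSpace.single j (1 : ℝ) := by
    funext i
    ext l
    simp [Finset.sum_apply, Pi.single_apply]
  conv_lhs => rw [hv]
  rw [ContinuousMultilinearMap.map_sum]
  refine (norm_sum_le _ _).trans ?_
  calc ∑ J : Fin k → Fin n, ‖iteratedFDeriv ℝ k f x
        fun i => v i (J i) • EuclideanSpace.single (J i) (1 : ℝ)‖
      ≤ ∑ _J : Fin k → Fin n, (∏ i, ‖v i‖) * B := by
        refine Finset.sum_le_sum fun J _ => ?_
        rw [ContinuousMultilinearMap.map_smul_univ, norm_smul, norm_prod]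
        gcongr with i
        · exact PiLp.norm_apply_le (v i) (J i)
        · exact h J
    _ = _ := by
        rw [Finset.sum_const, Finset.card_univ]
        simp
        ring

theorem wordFactorial_le_factorial {n k : ℕ} (J : Fin k → Fin n) : wordFactorial J ≤ k ! := by
  have h := Nat.prod_factorial_dvd_factorial_sum Finset.univ (wordIndex J)
  rw [sum_wordIndex] at h
  exact Nat.le_of_dvd (Nat.factorial_pos k) h

theorem norm_partialDeriv_le_gevreySeminorm {n k : ℕ} {s A : ℝ} (hA : 0 < A)
    {K : Set (EuclideanSpace ℝ (Fin n))} (hK : IsCompact K) (f : GevreyBeurling n s)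
    (J : Fin k → Fin n) {x : EuclideanSpace ℝ (Fin n)} (hx : x ∈ K) :
    ‖partialDeriv J f x‖ ≤ gevreySeminorm hA hK f * (A ^ k * (wordFactorial J : ℝ) ^ s) := by
  have hJ : (0 : ℝ) < wordFactorial J := by exact_mod_cast wordFactorial_pos J
  have h := le_ciSup (gevreyQuotient_bddAbove hA hK f) (⟨x, hx⟩, ⟨k, J⟩)
  rw [← div_le_iff₀ (by positivity)]
  exact h

/-- Passing from partial derivatives to the operator norm costs `n^k`, the number of words, and this
is moved into the parameter `A`. -/
theorem norm_iteratedFDeriv_le_gevreySeminorm {n : ℕ} {s A : ℝ} (hs : 0 ≤ s) (hA : 0 < A)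
    {K : Set (EuclideanSpace ℝ (Fin n))} (hK : IsCompact K) (f : GevreyBeurling n s) (k : ℕ)
    {x : EuclideanSpace ℝ (Fin n)} (hx : x ∈ K) :
    ‖iteratedFDeriv ℝ k f x‖ ≤ gevreySeminorm hA hK f * (n * A) ^ k * (k ! : ℝ) ^ s := by
  have hp : 0 ≤ gevreySeminorm hA hK f := apply_nonneg _ _
  refine (norm_iteratedFDeriv_le_of_partialDeriv
    (B := gevreySeminorm hA hK f * (A ^ k * (k ! : ℝ) ^ s)) (by positivity) fun J => ?_).trans_eq ?_
  · refine (norm_partialDeriv_le_gevreySeminorm hA hK f J hx).trans ?_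
    gcongr
    exact wordFactorial_le_factorial J
  · rw [mul_pow]; ring

/-- The Fourier transform of a cut-off Gevrey Beurling function decays like
`e^{-ρ |η|^{1/s}}`, for every `ρ`, with bounds by a continuous seminorm. -/
theorem exists_fourierLaplace_decay {n : ℕ} {s : ℝ} (hs : 1 < s)
    {χ : EuclideanSpace ℝ (Fin n) → ℝ} (hχ : IsUniformlyGevrey s χ) (hc : HasCompactSupport χ)
    {ρ : ℝ} (hρ : 0 < ρ) : ∃ (A : ℝ) (hA : 0 < A) (C : ℝ), 0 ≤ C ∧
      ∀ (f : GevreyBeurling n s) (η : EuclideanSpace ℝ (Fin n)),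
        ‖fourierLaplace (fun y => χ y • f y) η‖ ≤
          C * gevreySeminorm hA hc f * Real.exp (-(ρ * ‖η‖ ^ (1 / s))) := by
  have hs0 : 0 < s := by linarith
  -- Chosen so that `s / (2 (2A')^{1/s}) = ρ`, where `2A'` is the parameter after the Leibniz
  -- formula. The division by `n + 1` below compensates the factor `n` of
  -- `norm_iteratedFDeriv_le_gevreySeminorm`.
  set A' : ℝ := (s / (2 * ρ)) ^ s / 2 with hA'
  have hA'0 : 0 < A' := by positivity
  have hA : 0 < A' / (n + 1) := by positivity
  obtain ⟨D, hD0, hD⟩ := hχ.exists_nonneg hA'0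
  set v : ℝ := MeasureTheory.volume.real (tsupport χ) with hv
  refine ⟨A' / (n + 1), hA, 2 ^ s * (D * v), by positivity, fun f η => ?_⟩
  set P : ℝ := gevreySeminorm hA hc f with hP
  have hP0 : 0 ≤ P := apply_nonneg _ _
  have hg : ContDiff ℝ (⊤ : ℕ∞) fun y => χ y • f y := hχ.1.smul f.2.1
  have hgc : HasCompactSupport fun y => χ y • f y := hc.smul_right
  have hf : ∀ (k : ℕ), ∀ x ∈ tsupport χ, ‖iteratedFDeriv ℝ k f x‖ ≤ P * A' ^ k * (k ! : ℝ) ^ s := by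
    intro k x hx
    refine (norm_iteratedFDeriv_le_gevreySeminorm hs0.le hA hc f k hx).trans ?_
    gcongr
    rw [mul_div_assoc', div_le_iff₀ (by positivity)]
    nlinarith
  have hbound : ∀ (k : ℕ), ∀ x ∈ tsupport χ, ‖iteratedFDeriv ℝ k (fun y => χ y • f y) x‖ ≤
      D * P * (2 * A') ^ k * (k ! : ℝ) ^ s := by
    intro k x hx
    refine (norm_iteratedFDeriv_smul_le hχ.1 f.2.1 x (n := k) (by exact_mod_cast le_top)).trans ?_
    refine le_trans ?_ (sum_choose_mul_gevrey_le hs0.le hA'0 hD0 hP0 k)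
    refine Finset.sum_le_sum fun i _ => ?_
    gcongr
    · exact hD i x
    · exact hf (k - i) x hx
  have hint : ∀ k : ℕ, ∫ y, ‖iteratedFDeriv ℝ k (fun y => χ y • f y) y‖ ≤
      D * P * v * (2 * A') ^ k * (k ! : ℝ) ^ s := by
    intro k
    rw [← MeasureTheory.setIntegral_eq_integral_of_forall_compl_eq_zero (s := tsupport χ)]
    · refine (Real.le_norm_self _).trans ((MeasureTheory.norm_setIntegral_le_of_norm_le_const
        (C := D * P * (2 * A') ^ k * (k ! : ℝ) ^ s)
        hc.measure_lt_top fun x hx => ?_).trans_eq ?_)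
      · rw [norm_norm]; exact hbound k x hx
      · rw [hv]; ring
    · intro x hx
      have h1 : x ∉ tsupport fun y => χ y • f y :=
        fun h => hx (tsupport_smul_subset_left χ _ h)
      rw [image_eq_zero_of_notMem_tsupport fun h => h1 (tsupport_iteratedFDeriv_subset k h),
        norm_zero]
  have h := le_exp_of_forall_pow_mul_le hs0 (A := 2 * A') (C := D * P * v) (by positivity)
    (by positivity) (norm_nonneg η) (norm_nonneg (fourierLaplace (fun y => χ y • f y) η))
    fun k => (pow_mul_norm_fourierLaplace_le hg hgc k η).trans (hint k)
  have e : s / (2 * (2 * A') ^ (1 / s)) = ρ := by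
    have : 2 * A' = (s / (2 * ρ)) ^ s := by rw [hA']; ring
    rw [this, ← Real.rpow_mul (by positivity), mul_one_div_cancel hs0.ne', Real.rpow_one]
    field_simp
  rw [e] at h
  refine h.trans (le_of_eq ?_)
  ring

/-! ### Cauchy estimates in several variables -/

section CauchyEstimates

variable {V : Type*} [NormedAddCommGroup V] [NormedSpace ℂ V]

theorem hasDerivAt_comp_line {F : V → ℂ} {z v : V} {ζ : ℂ}
    (h : DifferentiableAt ℂ F (z + ζ • v)) :
    HasDerivAt (fun ζ : ℂ => F (z + ζ • v)) (fderiv ℂ F (z + ζ • v) v) ζ := by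
  have h1 : HasDerivAt (fun ζ : ℂ => z + ζ • v) v ζ := by
    simpa using ((hasDerivAt_id ζ).smul_const v).const_add z
  exact h.hasFDerivAt.comp_hasDerivAt ζ h1

/-- This is the one-variable Cauchy estimate on each complex line through `z`. It needs regularity
up to the boundary circle, so it is applied with radii `r' < r`, followed by `r' → r`. -/
theorem norm_fderiv_le_of_forall_ball {F : V → ℂ} {z : V} {r M : ℝ} (hr : 0 < r)
    (hF : DifferentiableOn ℂ F (Metric.ball z r)) (hM : ∀ w ∈ Metric.ball z r, ‖F w‖ ≤ M) :
    ‖fderiv ℂ F z‖ ≤ M / r := by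
  have hM0 : 0 ≤ M := (norm_nonneg _).trans (hM z (Metric.mem_ball_self hr))
  have key : ∀ r' : ℝ, 0 < r' → r' < r → ‖fderiv ℂ F z‖ ≤ M / r' := by
    intro r' hr' hrr'
    refine ContinuousLinearMap.opNorm_le_bound _ (by positivity) fun v => ?_
    rcases eq_or_ne v 0 with rfl | hv
    · simp
    have hv0 : 0 < ‖v‖ := norm_pos_iff.2 hv
    have hmem : ∀ ζ : ℂ, ‖ζ‖ ≤ r' / ‖v‖ → z + ζ • v ∈ Metric.ball z r := by
      intro ζ hζ
      rw [mem_ball_iff_norm, add_sub_cancel_left, norm_smul]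
      rw [le_div_iff₀ hv0] at hζ
      linarith
    have hd : DiffContOnCl ℂ (fun ζ : ℂ => F (z + ζ • v)) (Metric.ball 0 (r' / ‖v‖)) := by
      refine DifferentiableOn.diffContOnCl fun ζ hζ => ?_
      rw [closure_ball _ (by positivity), mem_closedBall_zero_iff] at hζ
      exact (hasDerivAt_comp_line (hF.differentiableAt
        (Metric.isOpen_ball.mem_nhds (hmem ζ hζ)))).differentiableAt.differentiableWithinAt
    have h := Complex.norm_deriv_le_of_forall_mem_sphere_norm_le (by positivity) hd
      (C := M) fun ζ hζ => hM _ (hmem ζ (mem_sphere_zero_iff_norm.1 hζ).le)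
    have h0 := hasDerivAt_comp_line (F := F) (z := z) (v := v) (ζ := 0)
      (hF.differentiableAt (Metric.isOpen_ball.mem_nhds (hmem 0 (by simp; positivity))))
    rw [h0.deriv] at h
    simp only [zero_smul, add_zero] at h
    refine h.trans (le_of_eq ?_)
    field_simp
  have hlim : Filter.Tendsto (fun r' : ℝ => M / r') (nhdsWithin r (Set.Iio r)) (nhds (M / r)) :=
    (tendsto_const_nhds.div (Filter.tendsto_id.mono_left nhdsWithin_le_nhds) hr.ne')
  refine ge_of_tendsto hlim ?_
  filter_upwards [Ioo_mem_nhdsLT hr] with r' hr'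
  exact key r' hr'.1 hr'.2

/-- It allows Cauchy estimates to be iterated. The Cauchy formula on the line in direction `v`
writes the directional derivative as a circle integral of `F`, which can be differentiated in `z`
under the integral sign. -/
theorem differentiableOn_fderiv_apply [FiniteDimensional ℂ V] {F : V → ℂ} {U : Set V}
    (hU : IsOpen U) (hF : DifferentiableOn ℂ F U) {M : ℝ} (hM : ∀ w ∈ U, ‖F w‖ ≤ M) (v : V) :
    DifferentiableOn ℂ (fun z => fderiv ℂ F z v) U := by
  borelize V
  have : ProperSpace V := FiniteDimensional.proper ℂ V
  intro z₀ hz₀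
  obtain ⟨ε, hε, hεU⟩ := Metric.isOpen_iff.1 hU z₀ hz₀
  -- The centre moves by less than `ε/2` and the circle by at most `ε/4`; the remaining `ε/4` is
  -- room for the Cauchy estimate that dominates the differentiated integrand.
  set r : ℝ := ε / 4 / (‖v‖ + 1) with hr
  have hr0 : 0 < r := by positivity
  have hrv : r * ‖v‖ ≤ ε / 4 := by
    rw [hr, div_mul_eq_mul_div, div_le_iff₀ (by positivity)]
    nlinarith [norm_nonneg v]
  have hmem : ∀ z ∈ Metric.ball z₀ (ε / 2), ∀ ζ : ℂ, ‖ζ‖ ≤ r →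
      Metric.ball (z + ζ • v) (ε / 4) ⊆ U := by
    intro z hz ζ hζ
    refine Set.Subset.trans (fun w hw => ?_) hεU
    rw [Metric.mem_ball] at hw hz ⊢
    have h1 : dist (z + ζ • v) z ≤ ε / 4 := by
      rw [dist_eq_norm, add_sub_cancel_left, norm_smul]
      exact (mul_le_mul_of_nonneg_right hζ (norm_nonneg v)).trans hrv
    have := dist_triangle4 w (z + ζ • v) z z₀
    linarith
  have hmem' : ∀ z ∈ Metric.ball z₀ (ε / 2), ∀ ζ : ℂ, ‖ζ‖ ≤ r → z + ζ • v ∈ U :=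
    fun z hz ζ hζ => hmem z hz ζ hζ (Metric.mem_ball_self (by positivity))
  have hcirc : ∀ θ, ‖circleMap 0 r θ‖ ≤ r := fun θ => by
    rw [norm_circleMap_zero, abs_of_pos hr0]
  have hformula : ∀ z ∈ Metric.ball z₀ (ε / 2), fderiv ℂ F z v =
      (2 * Real.pi * Complex.I : ℂ)⁻¹ • ∮ ζ in C(0, r), ((ζ - 0) ^ 2)⁻¹ • F (z + ζ • v) := by
    intro z hz
    have hop : IsOpen {ζ : ℂ | z + ζ • v ∈ U} :=
      hU.preimage (by fun_prop)
    have hd : DifferentiableOn ℂ (fun ζ : ℂ => F (z + ζ • v)) {ζ : ℂ | z + ζ • v ∈ U} :=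
      fun ζ hζ => (hasDerivAt_comp_line (hF.differentiableAt
        (hU.mem_nhds hζ))).differentiableAt.differentiableWithinAt
    rw [Complex.two_pi_I_inv_smul_circleIntegral_sub_sq_inv_smul_of_differentiable hop
      (fun ζ hζ => hmem' z hz ζ (mem_closedBall_zero_iff.1 hζ)) hd (Metric.mem_ball_self hr0),
      (hasDerivAt_comp_line (hF.differentiableAt (hU.mem_nhds
        (hmem' z hz 0 (by simpa using hr0.le))))).deriv]
    simp
  have hball : Metric.ball z₀ (ε / 2) ∈ nhds z₀ := Metric.ball_mem_nhds _ (by positivity)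
  have hcont : ∀ z ∈ Metric.ball z₀ (ε / 2), Continuous fun θ : ℝ =>
      deriv (circleMap 0 r) θ • ((circleMap 0 r θ - 0) ^ 2)⁻¹ • F (z + circleMap 0 r θ • v) := by
    intro z hz
    have h1 : Continuous fun θ : ℝ => F (z + circleMap 0 r θ • v) :=
      hF.continuousOn.comp_continuous (by fun_prop) fun θ => hmem' z hz _ (hcirc θ)
    have h2 : Continuous fun θ : ℝ => ((circleMap 0 r θ - 0) ^ 2)⁻¹ :=
      (by fun_prop : Continuous fun θ : ℝ => (circleMap 0 r θ - 0) ^ 2).inv₀ fun θ => by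
        simp [hr0.ne']
    simp only [deriv_circleMap]
    exact (by fun_prop : Continuous fun θ : ℝ => circleMap 0 r θ * Complex.I).smul (h2.smul h1)
  -- Continuity of the derivative is not yet established, but differentiation under the integral
  -- only requires measurability of the differentiated integrand.
  have hmeas : Measurable (fderiv ℂ F) := measurable_fderiv ℂ F
  have H : HasFDerivAt (fun z => ∮ ζ in C(0, r), ((ζ - 0) ^ 2)⁻¹ • F (z + ζ • v))
      (∫ θ in (0 : ℝ)..2 * Real.pi, deriv (circleMap 0 r) θ •
        ((circleMap 0 r θ - 0) ^ 2)⁻¹ • fderiv ℂ F (z₀ + circleMap 0 r θ • v)) z₀ := by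
    refine (intervalIntegral.hasFDerivAt_integral_of_dominated_of_fderiv_le (𝕜 := ℂ)
      (F := fun z θ => deriv (circleMap 0 r) θ •
        ((circleMap 0 r θ - 0) ^ 2)⁻¹ • F (z + circleMap 0 r θ • v))
      (F' := fun z θ => deriv (circleMap 0 r) θ •
        ((circleMap 0 r θ - 0) ^ 2)⁻¹ • fderiv ℂ F (z + circleMap 0 r θ • v))
      (bound := fun _ => r * ((r ^ 2)⁻¹ * (M / (ε / 4)))) (s := Metric.ball z₀ (ε / 2)) hball
      ?_ ?_ ?_ ?_ ?_ ?_)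
    · filter_upwards [hball] with z hz
      exact (hcont z hz).aestronglyMeasurable
    · exact (hcont z₀ (Metric.mem_ball_self (by positivity))).intervalIntegrable _ _
    · simp only [deriv_circleMap]
      have hm : Measurable fun θ : ℝ => fderiv ℂ F (z₀ + circleMap 0 r θ • v) :=
        hmeas.comp (by fun_prop : Continuous fun θ : ℝ => z₀ + circleMap 0 r θ • v).measurable
      have hm2 : Measurable fun θ : ℝ => circleMap 0 r θ := (continuous_circleMap 0 r).measurable
      have h3 : Measurable fun θ : ℝ => ((circleMap 0 r θ - 0) ^ 2)⁻¹ :=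
        ((hm2.sub_const 0).pow_const 2).inv
      have h4 : Measurable fun θ : ℝ => circleMap 0 r θ * Complex.I := hm2.mul_const _
      exact (h4.aestronglyMeasurable.smul (h3.aestronglyMeasurable.smul hm.aestronglyMeasurable))
    · refine Filter.Eventually.of_forall fun θ _ z hz => ?_
      have h1 := norm_fderiv_le_of_forall_ball (by positivity : 0 < ε / 4)
        (hF.mono (hmem z hz _ (hcirc θ))) fun w hw => hM w (hmem z hz _ (hcirc θ) hw)
      rw [norm_smul, norm_smul, deriv_circleMap, norm_mul, norm_inv, norm_pow, sub_zero,
        norm_circleMap_zero, abs_of_pos hr0, Complex.norm_I, mul_one]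
      gcongr
    · exact intervalIntegrable_const
    · refine Filter.Eventually.of_forall fun θ _ z hz => ?_
      have h1 : HasFDerivAt (fun z => F (z + circleMap 0 r θ • v))
          (fderiv ℂ F (z + circleMap 0 r θ • v)) z :=
        (hasFDerivAt_comp_add_right _).2 (hF.differentiableAt
          (hU.mem_nhds (hmem' z hz _ (hcirc θ)))).hasFDerivAt
      exact (h1.fun_const_smul _).fun_const_smul _
  have H2 : DifferentiableAt ℂ (fun z => fderiv ℂ F z v) z₀ := by
    refine (H.const_smul (2 * Real.pi * Complex.I : ℂ)⁻¹).differentiableAt.congr_of_eventuallyEq ?_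
    filter_upwards [hball] with z hz
    exact hformula z hz
  exact H2.differentiableWithinAt

end CauchyEstimates

/-! ### Real derivatives of restrictions of holomorphic functions -/

/-- The inclusion `ℝⁿ ⊂ ℂⁿ` as a real-linear map. -/
def realToComplexCLM (n : ℕ) : EuclideanSpace ℝ (Fin n) →L[ℝ] EuclideanSpace ℂ (Fin n) :=
  LinearMap.toContinuousLinearMap
    { toFun := realToComplex
      map_add' := fun x y => by ext i; simp [realToComplex]
      map_smul' := fun c x => by ext i; simp [realToComplex] }

@[simp] theorem realToComplexCLM_apply {n : ℕ} (x : EuclideanSpace ℝ (Fin n)) :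
    realToComplexCLM n x = realToComplex x := rfl

theorem realToComplex_apply {n : ℕ} (x : EuclideanSpace ℝ (Fin n)) (i : Fin n) :
    realToComplex x i = (x i : ℂ) := rfl

theorem norm_realToComplex {n : ℕ} (x : EuclideanSpace ℝ (Fin n)) :
    ‖realToComplex x‖ = ‖x‖ := by
  simp [EuclideanSpace.norm_eq, realToComplex_apply]

theorem continuous_realToComplex {n : ℕ} :
    Continuous (realToComplex : EuclideanSpace ℝ (Fin n) → EuclideanSpace ℂ (Fin n)) :=
  (realToComplexCLM n).continuous

theorem realToComplex_single {n : ℕ} (i : Fin n) :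
    realToComplex (EuclideanSpace.single i (1 : ℝ)) = EuclideanSpace.single i (1 : ℂ) := by
  ext j
  simp only [realToComplex_apply, PiLp.single_apply]
  split_ifs <;> simp

theorem partialDeriv_succ {n k : ℕ} (J : Fin (k + 1) → Fin n) {f : EuclideanSpace ℝ (Fin n) → ℂ}
    (hf : ContDiff ℝ (⊤ : ℕ∞) f) (x : EuclideanSpace ℝ (Fin n)) :
    partialDeriv J f x = partialDeriv (Fin.init J)
      (fun y => fderiv ℝ f y (EuclideanSpace.single (J (Fin.last k)) 1)) x := by
  have hf' : ContDiff ℝ (⊤ : ℕ∞) (fderiv ℝ f) := hf.fderiv_right (by simp)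
  rw [partialDeriv, iteratedFDeriv_succ_apply_right, partialDeriv]
  have h := (ContinuousLinearMap.apply ℝ ℂ
    (EuclideanSpace.single (J (Fin.last k)) (1 : ℝ))).iteratedFDeriv_comp_left
    (hf'.contDiffAt (x := x)) (i := k) (by exact_mod_cast le_top)
  have e : (fun y => fderiv ℝ f y (EuclideanSpace.single (J (Fin.last k)) 1)) =
    (ContinuousLinearMap.apply ℝ ℂ (EuclideanSpace.single (J (Fin.last k)) (1 : ℝ))) ∘
      fderiv ℝ f := rfl
  rw [e, h]
  rfl

/-- Each derivative uses up a layer of width `δ` of the ball and divides the bound by `δ`. Peeling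
off the last letter of the word replaces `(f, F, r, M)` by its derivative data with `r - δ` and `M /
δ`, so these are generalised in the induction. -/
theorem norm_partialDeriv_le_of_extension {n k : ℕ} (J : Fin k → Fin n) :
    ∀ {f : EuclideanSpace ℝ (Fin n) → ℂ} {F : EuclideanSpace ℂ (Fin n) → ℂ}
      {x : EuclideanSpace ℝ (Fin n)} {r δ M : ℝ}, ContDiff ℝ (⊤ : ℕ∞) f → 0 < δ → k * δ < r →
      DifferentiableOn ℂ F (Metric.ball (realToComplex x) r) →
      (∀ y, realToComplex y ∈ Metric.ball (realToComplex x) r → F (realToComplex y) = f y) →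
      (∀ z ∈ Metric.ball (realToComplex x) r, ‖F z‖ ≤ M) → ‖partialDeriv J f x‖ ≤ M / δ ^ k := by
  induction k with
  | zero =>
    intro f F x r δ M _ _ hr _ hfF hM
    have hx : realToComplex x ∈ Metric.ball (realToComplex x) r :=
      Metric.mem_ball_self (by simpa using hr)
    simpa [partialDeriv, ← hfF x hx] using hM _ hx
  | succ k ih =>
    intro f F x r δ M hf hδ hr hF hfF hM
    push_cast at hr
    rw [partialDeriv_succ J hf]
    have hkδ : (0 : ℝ) ≤ k * δ := by positivity
    have hsub : Metric.ball (realToComplex x) (r - δ) ⊆ Metric.ball (realToComplex x) r :=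
      Metric.ball_subset_ball (by linarith)
    have hsub' : ∀ z ∈ Metric.ball (realToComplex x) (r - δ),
        Metric.ball z δ ⊆ Metric.ball (realToComplex x) r := by
      intro z hz
      refine Metric.ball_subset_ball' ?_
      rw [Metric.mem_ball] at hz
      linarith
    have hF' := differentiableOn_fderiv_apply Metric.isOpen_ball hF hM
      (EuclideanSpace.single (J (Fin.last k)) (1 : ℂ))
    have h := ih (Fin.init J) (f := fun y => fderiv ℝ f y (EuclideanSpace.single (J (Fin.last k)) 1))
      (F := fun z => fderiv ℂ F z (EuclideanSpace.single (J (Fin.last k)) 1)) (x := x) (r := r - δ)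
      (δ := δ) (M := M / δ) ((hf.fderiv_right (by simp)).clm_apply contDiff_const) hδ (by linarith)
      (hF'.mono hsub) (fun y hy => ?_) (fun z hz => ?_)
    · refine h.trans (le_of_eq ?_)
      rw [div_div, pow_succ']
    · have hFy := (hF.differentiableAt (Metric.isOpen_ball.mem_nhds (hsub hy))).hasFDerivAt
      have h1 : HasFDerivAt (fun y => F (realToComplex y))
          (((fderiv ℂ F (realToComplex y)).restrictScalars ℝ).comp (realToComplexCLM n)) y :=
        (hFy.restrictScalars ℝ).comp y (realToComplexCLM n).hasFDerivAt
      have h2 : f =ᶠ[nhds y] fun y => F (realToComplex y) := by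
        filter_upwards [(Metric.isOpen_ball.preimage continuous_realToComplex).mem_nhds (hsub hy)]
          with w hw using (hfF w hw).symm
      change _ = fderiv ℝ f y _
      rw [(h1.congr_of_eventuallyEq h2).fderiv]
      simp [realToComplex_single]
    · have h1 := norm_fderiv_le_of_forall_ball hδ (hF.mono (hsub' z hz))
        fun w hw => hM w (hsub' z hz hw)
      refine (ContinuousLinearMap.le_opNorm _ _).trans ?_
      simpa using h1

/-! ### Continuity of the inclusion `A(ℝⁿ) ⊂ γ^{(s)}(ℝⁿ)` -/

/-- The inclusion `A(ℝⁿ) ⊂ γ^{(s)}(ℝⁿ)` as a linear map. -/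
def RealAnalytic.toGevreyLinear (n : ℕ) {s : ℝ} (hs : 1 < s) :
    RealAnalytic n →ₗ[ℂ] GevreyBeurling n s where
  toFun f := f.toGevrey hs
  map_add' _ _ := rfl
  map_smul' _ _ := rfl

/-- Sharing a radius `r` among `k` derivatives gives `M (k+1)^k / r^k`, which is at most a geometric
factor times `M k!`. Analytic growth `k!` is below `(k!)^s` by the factor `(k!)^{s-1}`, enough to
absorb that geometric factor and the `N^{sk}` relating `k!` to `α!`. -/
theorem carriedBy_gevreySeminorm {n : ℕ} {s A : ℝ} (hs : 1 < s) (hA : 0 < A)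
    {K : Set (EuclideanSpace ℝ (Fin n))} (hK : IsCompact K) :
    CarriedBy (fun f : RealAnalytic n => gevreySeminorm hA hK (f.toGevrey hs)) K := by
  intro ω hω hKω
  obtain ⟨r, hr, hrω⟩ := (hK.image continuous_realToComplex).exists_thickening_subset_open hω hKω
  have hball : ∀ x ∈ K, Metric.ball (realToComplex x) r ⊆ ω := fun x hx =>
    (Metric.ball_subset_thickening (Set.mem_image_of_mem _ hx) r).trans hrω
  set N : ℝ := n + 1 with hN
  have hN0 : 0 < N := by positivity
  set Q : ℝ := Real.exp 1 * N ^ s / (r * A) with hQ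
  have hQ0 : 0 < Q := by positivity
  obtain ⟨C, hC0, hC⟩ := exists_pow_le_factorial_rpow hQ0 (sub_pos.2 hs)
  refine ⟨Real.exp 1 * C, fun f F M hF hFf hM0 hM => ?_⟩
  refine Real.iSup_le (fun p => ?_) (by positivity)
  obtain ⟨⟨x, hx⟩, k, J⟩ := p
  have hwf : (0 : ℝ) < wordFactorial J := by exact_mod_cast wordFactorial_pos J
  have hk : (0 : ℝ) < k ! := by positivity
  -- The denominator is `k + 1` since `k δ` must be strictly less than `r`; this also covers `k =
  -- 0`.
  set δ : ℝ := r / (k + 1) with hδ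
  have h1 : ‖partialDeriv J f x‖ ≤ M / δ ^ k := by
    refine norm_partialDeriv_le_of_extension J (AnalyticOnNhd.contDiff f.2) (by positivity) ?_
      (hF.mono (hball x hx)) (fun y hy => hFf y (hball x hx hy)) fun z hz => hM z (hball x hx hz)
    rw [hδ, mul_div_assoc', div_lt_iff₀ (by positivity)]
    nlinarith
  have h2 : ((k : ℝ) + 1) ^ k ≤ Real.exp 1 * Real.exp 1 ^ k * k ! := by
    have h := Real.pow_div_factorial_le_exp ((k : ℝ) + 1) (by positivity) k
    rw [div_le_iff₀ hk, Real.exp_add] at h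
    have e : Real.exp 1 ^ k = Real.exp k := by rw [← Real.exp_nat_mul, mul_one]
    rw [e]
    linarith
  have h3 : (k ! : ℝ) ^ s ≤ (N ^ s) ^ k * (wordFactorial J : ℝ) ^ s := by
    have h : (k ! : ℝ) ≤ N ^ k * wordFactorial J := by
      have h3 : (k ! : ℝ) ≤ (n : ℝ) ^ k * wordFactorial J := by
        exact_mod_cast factorial_le_wordFactorial J
      refine h3.trans ?_
      gcongr
      rw [hN]
      linarith
    refine (Real.rpow_le_rpow hk.le h (by linarith)).trans_eq ?_
    rw [Real.mul_rpow (by positivity) (by positivity), ← Real.rpow_natCast, ← Real.rpow_natCast,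
      ← Real.rpow_mul hN0.le, ← Real.rpow_mul hN0.le, mul_comm (k : ℝ)]
  have h4 : (k ! : ℝ) ^ (s - 1) * k ! = (k ! : ℝ) ^ s := by
    rw [Real.rpow_sub_one hk.ne', div_mul_cancel₀ _ hk.ne']
  have hNs : 0 < (N ^ s) ^ k := by positivity
  change ‖partialDeriv J f x‖ / (A ^ k * (wordFactorial J : ℝ) ^ s) ≤ _
  rw [div_le_iff₀ (by positivity)]
  have h5 : (Real.exp 1 ^ k / r ^ k) * k ! ≤ C * A ^ k * (wordFactorial J : ℝ) ^ s := by
    have e : Real.exp 1 ^ k / r ^ k = Q ^ k * A ^ k / (N ^ s) ^ k := by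
      rw [← mul_pow, ← div_pow, ← div_pow]
      congr 1
      rw [hQ]
      field_simp
    rw [e, div_mul_eq_mul_div, div_le_iff₀ hNs]
    calc Q ^ k * A ^ k * k ! ≤ C * (k ! : ℝ) ^ (s - 1) * A ^ k * k ! := by
          gcongr
          exact hC k
      _ = C * A ^ k * (k ! : ℝ) ^ s := by rw [← h4]; ring
      _ ≤ C * A ^ k * ((N ^ s) ^ k * (wordFactorial J : ℝ) ^ s) := by gcongr
      _ = _ := by ring
  calc ‖partialDeriv J f x‖ ≤ M / δ ^ k := h1
    _ = M * ((k : ℝ) + 1) ^ k / r ^ k := by rw [hδ, div_pow]; field_simp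
    _ ≤ M * (Real.exp 1 * Real.exp 1 ^ k * k !) / r ^ k := by gcongr
    _ = M * Real.exp 1 * ((Real.exp 1 ^ k / r ^ k) * k !) := by ring
    _ ≤ M * Real.exp 1 * (C * A ^ k * (wordFactorial J : ℝ) ^ s) := by gcongr
    _ = _ := by ring

/-- The continuous inclusion `A(ℝⁿ) ⊂ γ^{(s)}(ℝⁿ)`. -/
def RealAnalytic.toGevreyCLM (n : ℕ) {s : ℝ} (hs : 1 < s) :
    RealAnalytic n →L[ℂ] GevreyBeurling n s where
  toLinearMap := RealAnalytic.toGevreyLinear n hs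
  cont := by
    refine (withSeminorms_realAnalytic n).continuous_of_isBounded (withSeminorms_gevrey n s) _
      fun i => ⟨{⟨(gevreySeminorms n s i).comp (RealAnalytic.toGevreyLinear n hs), i.1.1, i.1.2,
        carriedBy_gevreySeminorm hs i.2.2 i.1.2⟩}, 1, ?_⟩
    rw [Finset.sup_singleton, one_smul]
    exact le_rfl

/-! ### The exponentials `e^{-i z·ξ}` -/

/-- The entire function `z ↦ e^{-i z·ξ}` on `ℂⁿ`. -/
def complexFourierExp {n : ℕ} (ξ : EuclideanSpace ℝ (Fin n)) (z : EuclideanSpace ℂ (Fin n)) : ℂ :=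
  Complex.exp (-Complex.I * ∑ i, z i * (ξ i : ℂ))

theorem complexFourierExp_realToComplex {n : ℕ} (ξ x : EuclideanSpace ℝ (Fin n)) :
    complexFourierExp ξ (realToComplex x) = fourierExp ξ x := by
  change _ = Complex.exp (-Complex.I * (inner ℝ x ξ : ℝ))
  simp [complexFourierExp, realToComplex_apply, PiLp.inner_apply, mul_comm]

theorem differentiable_complexFourierExp {n : ℕ} (ξ : EuclideanSpace ℝ (Fin n)) :
    Differentiable ℂ (complexFourierExp ξ) := by
  unfold complexFourierExp
  have : ∀ i, Differentiable ℂ fun z : EuclideanSpace ℂ (Fin n) => z i := fun i =>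
    (EuclideanSpace.proj i : EuclideanSpace ℂ (Fin n) →L[ℂ] ℂ).differentiable
  fun_prop

theorem continuous_complexFourierExp {n : ℕ} : Continuous
    fun p : EuclideanSpace ℝ (Fin n) × EuclideanSpace ℂ (Fin n) => complexFourierExp p.1 p.2 := by
  unfold complexFourierExp
  fun_prop

/-- The exponentials `e^{-i z·ξ}`, as continuous functions of `z` in a set `B`. -/
def complexFourierExpMap {n : ℕ} (B : Set (EuclideanSpace ℂ (Fin n))) :
    C(EuclideanSpace ℝ (Fin n), C(B, ℂ)) :=
  ContinuousMap.curry ⟨fun p : EuclideanSpace ℝ (Fin n) × B => complexFourierExp p.1 p.2,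
    continuous_complexFourierExp.comp (f := fun p : EuclideanSpace ℝ (Fin n) × B => (p.1, p.2.1))
      (continuous_fst.prodMk (continuous_subtype_val.comp continuous_snd))⟩

@[simp] theorem complexFourierExpMap_apply {n : ℕ} (B : Set (EuclideanSpace ℂ (Fin n)))
    (ξ : EuclideanSpace ℝ (Fin n)) (z : B) :
    complexFourierExpMap B ξ z = complexFourierExp ξ z := rfl

/-- This makes Fourier transforms continuous, hence measurable. A continuous seminorm is bounded by
the supremum over a complex ball around its carrier, and there the exponentials depend continuously
on `ξ` in the uniform norm. -/
theorem continuous_fourierExp {n : ℕ} :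
    Continuous (fourierExp : EuclideanSpace ℝ (Fin n) → RealAnalytic n) := by
  refine continuous_iff_continuousAt.2 fun ξ₀ => ?_
  rw [ContinuousAt, (withSeminorms_realAnalytic n).tendsto_nhds]
  rintro ⟨q, K, hK, hq⟩ ε hε
  obtain ⟨R, hR⟩ := hK.isBounded.subset_ball 0
  have hsub : realToComplex '' K ⊆ Metric.ball 0 R := by
    rintro _ ⟨x, hx, rfl⟩
    simpa [norm_realToComplex] using hR hx
  obtain ⟨C, hC⟩ := hq _ Metric.isOpen_ball hsub
  set B : Set (EuclideanSpace ℂ (Fin n)) := Metric.closedBall 0 R with hB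
  have : CompactSpace B := isCompact_iff_compactSpace.1 (isCompact_closedBall _ _)
  have hlim : Filter.Tendsto
      (fun ξ => C * ‖complexFourierExpMap B ξ - complexFourierExpMap B ξ₀‖) (nhds ξ₀) (nhds 0) := by
    have h1 : Continuous fun ξ => C * ‖complexFourierExpMap B ξ - complexFourierExpMap B ξ₀‖ := by
      fun_prop
    simpa using h1.tendsto ξ₀
  filter_upwards [hlim.eventually (gt_mem_nhds hε)] with ξ hξ
  refine lt_of_le_of_lt (hC (fourierExp ξ - fourierExp ξ₀)
    (fun z => complexFourierExp ξ z - complexFourierExp ξ₀ z) _ ?_ ?_ (norm_nonneg _) ?_) hξ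
  · exact ((differentiable_complexFourierExp ξ).sub
      (differentiable_complexFourierExp ξ₀)).differentiableOn
  · intro x _
    rw [complexFourierExp_realToComplex, complexFourierExp_realToComplex]
    rfl
  · intro z hz
    exact ContinuousMap.norm_coe_le_norm
      (complexFourierExpMap B ξ - complexFourierExpMap B ξ₀) ⟨z, Metric.ball_subset_closedBall hz⟩

theorem continuous_fourierTransform {n : ℕ} (v : RealAnalytic n →L[ℂ] ℂ) :
    Continuous (fourierTransform v) :=
  v.continuous.comp continuous_fourierExp

theorem hasFDerivAt_fourierExp {n : ℕ} (ξ x : EuclideanSpace ℝ (Fin n)) :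
    HasFDerivAt (fourierExp ξ : EuclideanSpace ℝ (Fin n) → ℂ)
      (fourierExp ξ x • (-Complex.I • Complex.ofRealCLM.comp (innerSL ℝ ξ))) x := by
  have h1 : HasFDerivAt (fun x : EuclideanSpace ℝ (Fin n) => -Complex.I * ((inner ℝ x ξ : ℝ) : ℂ))
      (-Complex.I • Complex.ofRealCLM.comp (innerSL ℝ ξ)) x := by
    have h2 := ((Complex.ofRealCLM.comp (innerSL ℝ ξ)).hasFDerivAt (x := x)).const_smul
      (-Complex.I)
    refine h2.congr_of_eventuallyEq (Filter.Eventually.of_forall fun y => ?_)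
    simp [real_inner_comm]
  exact h1.cexp

theorem norm_fourierExp {n : ℕ} (ξ x : EuclideanSpace ℝ (Fin n)) : ‖fourierExp ξ x‖ = 1 := by
  change ‖Complex.exp (-Complex.I * (inner ℝ x ξ : ℝ))‖ = 1
  rw [Complex.norm_exp]
  simp

theorem norm_partialDeriv_fourierExp_le {n k : ℕ} (ξ x : EuclideanSpace ℝ (Fin n))
    (J : Fin k → Fin n) : ‖partialDeriv J (fourierExp ξ) x‖ ≤ ‖ξ‖ ^ k := by
  have hsm : ContDiff ℝ (⊤ : ℕ∞) (fourierExp ξ : EuclideanSpace ℝ (Fin n) → ℂ) :=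
    AnalyticOnNhd.contDiff (fourierExp ξ).2
  induction k with
  | zero => simp [partialDeriv, norm_fourierExp]
  | succ k ih =>
    have e : (fun y => fderiv ℝ (fourierExp ξ : EuclideanSpace ℝ (Fin n) → ℂ) y
        (EuclideanSpace.single (J (Fin.last k)) 1)) =
        (-Complex.I * ξ (J (Fin.last k))) • (fourierExp ξ : EuclideanSpace ℝ (Fin n) → ℂ) := by
      funext y
      rw [(hasFDerivAt_fourierExp ξ y).fderiv]
      simp [EuclideanSpace.inner_single_right]
      ring
    rw [partialDeriv_succ J hsm, e, partialDeriv_smul _ _ hsm, norm_mul, norm_mul, norm_neg,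
      Complex.norm_I, one_mul, Complex.norm_real, pow_succ']
    gcongr
    · exact PiLp.norm_apply_le ξ _
    · exact ih _

/-! ### The weights and the growth of Gevrey seminorms of exponentials -/

theorem japaneseBracket_ge_one {n : ℕ} (ξ : EuclideanSpace ℝ (Fin n)) : 1 ≤ japaneseBracket ξ := by
  rw [japaneseBracket, Real.one_le_sqrt]
  nlinarith [sq_nonneg ‖ξ‖]

theorem japaneseBracket_pos {n : ℕ} (ξ : EuclideanSpace ℝ (Fin n)) : 0 < japaneseBracket ξ :=
  one_pos.trans_le (japaneseBracket_ge_one ξ)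

theorem norm_le_japaneseBracket {n : ℕ} (ξ : EuclideanSpace ℝ (Fin n)) :
    ‖ξ‖ ≤ japaneseBracket ξ :=
  Real.le_sqrt_of_sq_le (by linarith)

theorem continuous_japaneseBracket {n : ℕ} :
    Continuous (japaneseBracket : EuclideanSpace ℝ (Fin n) → ℝ) := by
  unfold japaneseBracket
  fun_prop

theorem continuous_japaneseBracket_rpow {n : ℕ} (a : ℝ) :
    Continuous fun ξ : EuclideanSpace ℝ (Fin n) => japaneseBracket ξ ^ a :=
  continuous_japaneseBracket.rpow_const fun ξ => Or.inl (japaneseBracket_pos ξ).ne'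

/-- Raising `y^k ≤ k! e^y` to the power `s` gives `(y^s)^k ≤ (k!)^s e^{sy}`. With `y^s = N^s ⟨ξ⟩ /
A`, the factor `N^{sk}` is exactly what replacing `k!` by the smaller `α!` costs. -/
theorem gevreySeminorm_fourierExp_le {n : ℕ} {s A : ℝ} (hs : 1 < s) (hA : 0 < A)
    {K : Set (EuclideanSpace ℝ (Fin n))} (hK : IsCompact K) (ξ : EuclideanSpace ℝ (Fin n)) :
    gevreySeminorm hA hK ((fourierExp ξ).toGevrey hs) ≤
      Real.exp (s * ((n + 1 : ℝ) ^ s / A) ^ (1 / s) * japaneseBracket ξ ^ (1 / s)) := by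
  have hs0 : 0 < s := by linarith
  refine Real.iSup_le (fun p => ?_) (Real.exp_pos _).le
  obtain ⟨⟨x, hx⟩, k, J⟩ := p
  have hwf : (0 : ℝ) < wordFactorial J := by exact_mod_cast wordFactorial_pos J
  have hk : (0 : ℝ) < k ! := by positivity
  have hb := japaneseBracket_pos ξ
  set N : ℝ := n + 1 with hN
  have hN0 : 0 < N := by positivity
  set y : ℝ := (N ^ s / A * japaneseBracket ξ) ^ (1 / s) with hy
  have hy0 : 0 < y := by positivity
  have hys : y ^ s = N ^ s / A * japaneseBracket ξ := by
    rw [hy, ← Real.rpow_mul (by positivity), one_div_mul_cancel hs0.ne', Real.rpow_one]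
  have h1 : (y ^ k) ^ s ≤ Real.exp (s * y) * (k ! : ℝ) ^ s := by
    have h := Real.pow_div_factorial_le_exp y hy0.le k
    rw [div_le_iff₀ hk] at h
    refine (Real.rpow_le_rpow (by positivity) h hs0.le).trans_eq ?_
    rw [Real.mul_rpow (by positivity) hk.le, ← Real.exp_mul, mul_comm s y]
  have h3 : (k ! : ℝ) ^ s ≤ (N ^ s) ^ k * (wordFactorial J : ℝ) ^ s := by
    have h : (k ! : ℝ) ≤ N ^ k * wordFactorial J := by
      have h3 : (k ! : ℝ) ≤ (n : ℝ) ^ k * wordFactorial J := by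
        exact_mod_cast factorial_le_wordFactorial J
      refine h3.trans ?_
      gcongr
      rw [hN]
      linarith
    refine (Real.rpow_le_rpow hk.le h hs0.le).trans_eq ?_
    rw [Real.mul_rpow (by positivity) (by positivity), ← Real.rpow_natCast, ← Real.rpow_natCast,
      ← Real.rpow_mul hN0.le, ← Real.rpow_mul hN0.le, mul_comm (k : ℝ)]
  have e1 : (y ^ k) ^ s = (N ^ s) ^ k / A ^ k * japaneseBracket ξ ^ k := by
    rw [← Real.rpow_natCast, ← Real.rpow_mul hy0.le, mul_comm, Real.rpow_mul hy0.le, hys,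
      Real.rpow_natCast, mul_pow, div_pow]
  have e2 : s * y = s * (N ^ s / A) ^ (1 / s) * japaneseBracket ξ ^ (1 / s) := by
    rw [hy, Real.mul_rpow (by positivity) hb.le, mul_assoc]
  rw [← e2]
  change ‖partialDeriv J (fourierExp ξ) x‖ / (A ^ k * (wordFactorial J : ℝ) ^ s) ≤ _
  rw [div_le_iff₀ (by positivity)]
  refine (norm_partialDeriv_fourierExp_le ξ x J).trans ?_
  have hNs : 0 < (N ^ s) ^ k := by positivity
  have h4 : (N ^ s) ^ k * japaneseBracket ξ ^ k ≤
      (N ^ s) ^ k * (Real.exp (s * y) * (A ^ k * (wordFactorial J : ℝ) ^ s)) := by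
    have h5 := h1.trans (mul_le_mul_of_nonneg_left h3 (Real.exp_pos _).le)
    rw [e1, div_mul_eq_mul_div, div_le_iff₀ (by positivity)] at h5
    linarith
  exact (pow_le_pow_left₀ (norm_nonneg _) (norm_le_japaneseBracket ξ) k).trans
    (le_of_mul_le_mul_left h4 hNs)

theorem memLp_japaneseBracket_mul_exp {n : ℕ} {s : ℝ} (hs : 0 < s) (l : ℝ) :
    MeasureTheory.MemLp (fun ξ : EuclideanSpace ℝ (Fin n) =>
      japaneseBracket ξ ^ l * Real.exp (-japaneseBracket ξ ^ (1 / s))) 2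
      MeasureTheory.volume := by
  have hcont : Continuous fun ξ : EuclideanSpace ℝ (Fin n) =>
      japaneseBracket ξ ^ l * Real.exp (-japaneseBracket ξ ^ (1 / s)) :=
    (continuous_japaneseBracket_rpow l).mul
      (Real.continuous_exp.comp (continuous_japaneseBracket_rpow (1 / s)).neg)
  rw [MeasureTheory.memLp_two_iff_integrable_sq hcont.aestronglyMeasurable]
  -- This `N` gives `⟨ξ⟩^{l+n+1} ≤ (⟨ξ⟩^{1/s})^N ≤ N! e^{⟨ξ⟩^{1/s}}`. What remains is
  -- `⟨ξ⟩^{-(n+1)}`, whose square is integrable since `2(n+1) > n`.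
  obtain ⟨N, hN⟩ := exists_nat_ge (s * (l + (n + 1)))
  have hint := (integrable_rpow_neg_one_add_norm_sq (E := EuclideanSpace ℝ (Fin n))
    (μ := MeasureTheory.volume) (r := 2 * (n + 1)) (by simp; linarith)).const_mul ((N ! : ℝ) ^ 2)
  refine hint.mono' (hcont.pow 2).aestronglyMeasurable (Filter.Eventually.of_forall fun ξ => ?_)
  have hb := japaneseBracket_pos ξ
  have hb1 := japaneseBracket_ge_one ξ
  set b := japaneseBracket ξ with hbdef
  have hx1 : 1 ≤ b ^ (1 / s) := Real.one_le_rpow hb1 (by positivity)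
  have h1 : b ^ (l + (n + 1)) ≤ N ! * Real.exp (b ^ (1 / s)) := by
    have h2 : b ^ (l + (n + 1)) ≤ (b ^ (1 / s)) ^ N := by
      rw [← Real.rpow_natCast, ← Real.rpow_mul hb.le]
      refine Real.rpow_le_rpow_of_exponent_le hb1 ?_
      rw [one_div, inv_mul_eq_div, le_div_iff₀ hs]
      linarith
    have h3 := Real.pow_div_factorial_le_exp (b ^ (1 / s)) (by positivity) N
    rw [div_le_iff₀ (by positivity)] at h3
    linarith
  have h4 : b ^ l * Real.exp (-b ^ (1 / s)) ≤ N ! * b ^ (-(n + 1 : ℝ)) := by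
    rw [Real.exp_neg, ← div_eq_mul_inv, div_le_iff₀ (Real.exp_pos _)]
    have e : b ^ l = b ^ (l + (n + 1)) * b ^ (-(n + 1 : ℝ)) := by
      rw [← Real.rpow_add hb]; congr 1; ring
    rw [e]
    calc _ ≤ (N ! * Real.exp (b ^ (1 / s))) * b ^ (-(n + 1 : ℝ)) := by gcongr
      _ = _ := by ring
  rw [Real.norm_of_nonneg (by positivity)]
  refine (pow_le_pow_left₀ (by positivity) h4 2).trans_eq ?_
  have e5 : (1 : ℝ) + ‖ξ‖ ^ 2 = b ^ (2 : ℝ) := by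
    rw [hbdef, japaneseBracket, Real.rpow_two, Real.sq_sqrt (by positivity)]
  rw [mul_pow, e5, ← Real.rpow_mul hb.le, ← Real.rpow_natCast (b ^ (-(n + 1 : ℝ))),
    ← Real.rpow_mul hb.le]
  congr 2
  push_cast
  ring

/-- The restriction to `A(ℝⁿ)` of a Gevrey Beurling ultradistribution belongs to weighted Sobolev
spaces of every order. -/
theorem exists_mem_weightedSobolev {n : ℕ} {s : ℝ} (hs : 1 < s) (v : GevreyUltradistribution n s)
    (l : ℝ) : ∃ ρ : ℝ, 0 < ρ ∧
      v.comp (RealAnalytic.toGevreyCLM n hs) ∈ weightedSobolev n l ρ s := by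
  set w := v.comp (RealAnalytic.toGevreyCLM n hs) with hw
  have hq : Continuous ((normSeminorm ℂ ℂ).comp v.toLinearMap) :=
    continuous_norm.comp v.continuous
  obtain ⟨t, C, -, hC⟩ := Seminorm.bound_of_continuous (withSeminorms_gevrey n s) _ hq
  set a : ({K : Set (EuclideanSpace ℝ (Fin n)) // IsCompact K} × {A : ℝ // 0 < A}) → ℝ :=
    fun i => s * ((n + 1 : ℝ) ^ s / i.2) ^ (1 / s) with ha
  have ha0 : ∀ i, 0 ≤ a i := fun i => by
    have := i.2.2
    simp only [ha]; positivity
  -- The sum is a convenient majorant of the largest exponent. The final weight uses `ρ + 1`, the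
  -- extra unit providing the integrable decay.
  set ρ : ℝ := ∑ i ∈ t, a i with hρ
  have hρ0 : 0 ≤ ρ := Finset.sum_nonneg fun i _ => ha0 i
  have hbound : ∀ ξ, ‖fourierTransform w ξ‖ ≤
      C * Real.exp (ρ * japaneseBracket ξ ^ (1 / s)) := by
    intro ξ
    have hb := japaneseBracket_pos ξ
    refine (hC ((fourierExp ξ).toGevrey hs)).trans ?_
    rw [smul_apply, NNReal.smul_def, smul_eq_mul]
    gcongr
    refine Seminorm.finset_sup_apply_le (Real.exp_pos _).le fun i hi => ?_
    refine (gevreySeminorm_fourierExp_le hs i.2.2 i.1.2 ξ).trans ?_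
    gcongr
    exact Finset.single_le_sum (f := a) (fun i _ => ha0 i) hi
  refine ⟨ρ + 1, by linarith, ?_⟩
  have hm := (memLp_japaneseBracket_mul_exp (n := n) (s := s) (by linarith) l)
  have hcont : Continuous fun ξ : EuclideanSpace ℝ (Fin n) =>
      ((japaneseBracket ξ ^ l * Real.exp (-((ρ + 1) * japaneseBracket ξ ^ (1 / s))) : ℝ) : ℂ) *
      fourierTransform w ξ :=
    (Complex.continuous_ofReal.comp ((continuous_japaneseBracket_rpow l).mul
      (Real.continuous_exp.comp (continuous_const.mul
        (continuous_japaneseBracket_rpow (1 / s))).neg))).mul (continuous_fourierTransform w)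
  refine hm.of_le_mul (c := C) hcont.aestronglyMeasurable (Filter.Eventually.of_forall fun ξ => ?_)
  have hb := japaneseBracket_pos ξ
  rw [norm_mul, Complex.norm_real, Real.norm_of_nonneg (by positivity),
    Real.norm_of_nonneg (by positivity)]
  calc _ ≤ japaneseBracket ξ ^ l * Real.exp (-((ρ + 1) * japaneseBracket ξ ^ (1 / s))) *
        (C * Real.exp (ρ * japaneseBracket ξ ^ (1 / s))) := by
        gcongr
        exact hbound ξ
    _ = C * (japaneseBracket ξ ^ l * (Real.exp (-((ρ + 1) * japaneseBracket ξ ^ (1 / s))) *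
        Real.exp (ρ * japaneseBracket ξ ^ (1 / s)))) := by ring
    _ = _ := by
        rw [← Real.exp_add]
        congr 3
        ring_nf

/-! ### Holomorphic extension of real analytic functions -/

/-- The componentwise real part of a vector in `ℂⁿ`. -/
def rePart {n : ℕ} (z : EuclideanSpace ℂ (Fin n)) : EuclideanSpace ℝ (Fin n) :=
  WithLp.toLp 2 fun i => (z i).re

/-- The componentwise imaginary part of a vector in `ℂⁿ`. -/
def imPart {n : ℕ} (z : EuclideanSpace ℂ (Fin n)) : EuclideanSpace ℝ (Fin n) :=
  WithLp.toLp 2 fun i => (z i).im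

theorem rePart_add_I_smul_imPart {n : ℕ} (z : EuclideanSpace ℂ (Fin n)) :
    realToComplex (rePart z) + Complex.I • realToComplex (imPart z) = z := by
  ext i
  simp [realToComplex_apply, rePart, imPart, mul_comm Complex.I, Complex.re_add_im]

theorem continuous_rePart {n : ℕ} :
    Continuous (rePart : EuclideanSpace ℂ (Fin n) → EuclideanSpace ℝ (Fin n)) := by
  unfold rePart
  fun_prop

theorem continuous_imPart {n : ℕ} :
    Continuous (imPart : EuclideanSpace ℂ (Fin n) → EuclideanSpace ℝ (Fin n)) := by
  unfold imPart
  fun_prop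

theorem norm_rePart_le {n : ℕ} (z : EuclideanSpace ℂ (Fin n)) : ‖rePart z‖ ≤ ‖z‖ := by
  rw [EuclideanSpace.norm_eq, EuclideanSpace.norm_eq]
  gcongr with i
  exact Complex.abs_re_le_norm (z i)

theorem norm_rePart_sub_le {n : ℕ} (z : EuclideanSpace ℂ (Fin n)) (x : EuclideanSpace ℝ (Fin n)) :
    ‖realToComplex (rePart z) - realToComplex x‖ ≤ ‖z - realToComplex x‖ := by
  have e : realToComplex (rePart z) - realToComplex x =
      realToComplex (rePart (z - realToComplex x)) := by
    ext i
    simp [realToComplex_apply, rePart]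
  rw [e, norm_realToComplex]
  exact norm_rePart_le _

/-- The complexification of a continuous multilinear map on `ℝⁿ`. -/
def complexifyMultilinear {n k : ℕ}
    (p : ContinuousMultilinearMap ℝ (fun _ : Fin k => EuclideanSpace ℝ (Fin n)) ℂ) :
    ContinuousMultilinearMap ℂ (fun _ : Fin k => EuclideanSpace ℂ (Fin n)) ℂ :=
  ∑ J : Fin k → Fin n, p (fun i => EuclideanSpace.single (J i) (1 : ℝ)) •
    (ContinuousMultilinearMap.mkPiAlgebra ℂ (Fin k) ℂ).compContinuousLinearMap
      fun i => (EuclideanSpace.proj (J i) : EuclideanSpace ℂ (Fin n) →L[ℂ] ℂ)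

theorem complexifyMultilinear_apply {n k : ℕ}
    (p : ContinuousMultilinearMap ℝ (fun _ : Fin k => EuclideanSpace ℝ (Fin n)) ℂ)
    (z : Fin k → EuclideanSpace ℂ (Fin n)) :
    complexifyMultilinear p z =
      ∑ J : Fin k → Fin n, p (fun i => EuclideanSpace.single (J i) (1 : ℝ)) * ∏ i, z i (J i) := by
  simp [complexifyMultilinear]

theorem complexifyMultilinear_realToComplex {n k : ℕ}
    (p : ContinuousMultilinearMap ℝ (fun _ : Fin k => EuclideanSpace ℝ (Fin n)) ℂ)
    (v : Fin k → EuclideanSpace ℝ (Fin n)) :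
    complexifyMultilinear p (fun i => realToComplex (v i)) = p v := by
  have hv : v = fun i => ∑ j, v i j • EuclideanSpace.single j (1 : ℝ) := by
    funext i
    ext l
    simp [Finset.sum_apply, Pi.single_apply]
  conv_rhs => rw [hv]
  rw [ContinuousMultilinearMap.map_sum, complexifyMultilinear_apply]
  refine Finset.sum_congr rfl fun J _ => ?_
  rw [ContinuousMultilinearMap.map_smul_univ]
  simp [realToComplex_apply, mul_comm]

theorem norm_complexifyMultilinear_le {n k : ℕ}
    (p : ContinuousMultilinearMap ℝ (fun _ : Fin k => EuclideanSpace ℝ (Fin n)) ℂ) :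
    ‖complexifyMultilinear p‖ ≤ (n : ℝ) ^ k * ‖p‖ := by
  refine ContinuousMultilinearMap.opNorm_le_bound (by positivity) fun z => ?_
  rw [complexifyMultilinear_apply]
  refine (norm_sum_le _ _).trans ?_
  calc _ ≤ ∑ _J : Fin k → Fin n, ‖p‖ * ∏ i, ‖z i‖ := by
        refine Finset.sum_le_sum fun J _ => ?_
        rw [norm_mul, norm_prod]
        gcongr with i
        · refine (p.le_opNorm _).trans ?_
          simp
        · exact PiLp.norm_apply_le (z i) (J i)
    _ = _ := by
        rw [Finset.sum_const, Finset.card_univ]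
        simp
        ring

/-- The Taylor coefficients are complexified one by one. Their norms grow by at most `n^k`, so the
complex series still converges on a ball smaller by the factor `n + 1`. -/
theorem exists_local_holomorphic_extension {n : ℕ} {f : EuclideanSpace ℝ (Fin n) → ℂ}
    {x₀ : EuclideanSpace ℝ (Fin n)} (hf : AnalyticAt ℝ f x₀) :
    ∃ r : ℝ, 0 < r ∧ ∃ G : EuclideanSpace ℂ (Fin n) → ℂ,
      AnalyticOnNhd ℂ G (Metric.ball (realToComplex x₀) r) ∧
      ∀ y, realToComplex y ∈ Metric.ball (realToComplex x₀) r → G (realToComplex y) = f y := by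
  obtain ⟨p, R, hp⟩ := hf
  set P : FormalMultilinearSeries ℂ (EuclideanSpace ℂ (Fin n)) ℂ :=
    fun k => complexifyMultilinear (p k) with hP
  obtain ⟨a, ha0, haR⟩ := ENNReal.lt_iff_exists_nnreal_btwn.1 hp.r_pos
  have ha : 0 < a := by exact_mod_cast ha0
  obtain ⟨C, -, hC⟩ := p.norm_mul_pow_le_of_lt_radius (haR.trans_le hp.r_le)
  set b : ℝ≥0 := a / (n + 1) with hb
  have hb0 : 0 < b := by positivity
  have hba : b ≤ a := div_le_self (by positivity) (by simp)
  have hrad : (b : ℝ≥0∞) ≤ P.radius := by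
    refine P.le_radius_of_bound C fun k => ?_
    refine le_trans ?_ (hC k)
    calc ‖P k‖ * (b : ℝ) ^ k ≤ ((n : ℝ) ^ k * ‖p k‖) * (b : ℝ) ^ k := by
          gcongr
          exact norm_complexifyMultilinear_le (p k)
      _ = ‖p k‖ * (n * b : ℝ) ^ k := by rw [mul_pow]; ring
      _ ≤ _ := by
          gcongr
          rw [hb]
          push_cast
          rw [mul_div_assoc', div_le_iff₀ (by positivity)]
          nlinarith [a.2]
  have hPr : 0 < P.radius := lt_of_lt_of_le (by exact_mod_cast hb0) hrad
  have hsum := P.hasFPowerSeriesOnBall hPr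
  refine ⟨b, hb0, fun z => P.sum (z - realToComplex x₀), ?_, fun y hy => ?_⟩
  · intro z hz
    have h1 : AnalyticAt ℂ P.sum (z - realToComplex x₀) := by
      refine hsum.analyticAt_of_mem ?_
      rw [Metric.mem_eball, edist_zero_right]
      refine lt_of_lt_of_le ?_ hrad
      rw [enorm_eq_nnnorm]
      rw [mem_ball_iff_norm] at hz
      exact_mod_cast hz
    exact h1.comp_of_eq (analyticAt_id.sub analyticAt_const) rfl
  · have hyb : ‖y - x₀‖ < b := by
      have e : realToComplex y - realToComplex x₀ = realToComplex (y - x₀) :=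
        ((realToComplexCLM n).map_sub y x₀).symm
      rwa [mem_ball_iff_norm, e, norm_realToComplex] at hy
    have e : realToComplex y - realToComplex x₀ = realToComplex (y - x₀) :=
      ((realToComplexCLM n).map_sub y x₀).symm
    simp only [e]
    have h1 := hsum.hasSum (y := realToComplex (y - x₀)) (by
      rw [Metric.mem_eball, edist_zero_right]
      refine lt_of_lt_of_le ?_ hrad
      rw [enorm_eq_nnnorm]
      exact_mod_cast (norm_realToComplex (y - x₀)).trans_lt hyb)
    have h2 := hp.hasSum (y := y - x₀) (by
      rw [Metric.mem_eball, edist_zero_right]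
      refine lt_trans (lt_of_lt_of_le ?_ (ENNReal.coe_le_coe.2 hba)) haR
      rw [enorm_eq_nnnorm]
      exact_mod_cast hyb)
    have e3 : ∀ k, (P k fun _ : Fin k => realToComplex (y - x₀)) = p k fun _ => y - x₀ :=
      fun k => complexifyMultilinear_realToComplex (p k) fun _ => y - x₀
    simp only [e3, zero_add, add_sub_cancel] at h1 h2
    exact h1.unique h2

/-- Holomorphic functions on balls with real centres that agree at the real points agree. -/
theorem eq_of_eq_on_real {n : ℕ} {G₁ G₂ : EuclideanSpace ℂ (Fin n) → ℂ}
    {x₁ x₂ : EuclideanSpace ℝ (Fin n)} {r₁ r₂ : ℝ}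
    (h₁ : AnalyticOnNhd ℂ G₁ (Metric.ball (realToComplex x₁) r₁))
    (h₂ : AnalyticOnNhd ℂ G₂ (Metric.ball (realToComplex x₂) r₂))
    (h : ∀ y, realToComplex y ∈ Metric.ball (realToComplex x₁) r₁ →
      realToComplex y ∈ Metric.ball (realToComplex x₂) r₂ →
      G₁ (realToComplex y) = G₂ (realToComplex y))
    {z : EuclideanSpace ℂ (Fin n)} (hz₁ : z ∈ Metric.ball (realToComplex x₁) r₁)
    (hz₂ : z ∈ Metric.ball (realToComplex x₂) r₂) : G₁ z = G₂ z := by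
  set a := rePart z with ha
  set b := imPart z with hb
  set U := Metric.ball (realToComplex x₁) r₁ ∩ Metric.ball (realToComplex x₂) r₂ with hU
  have hUo : IsOpen U := Metric.isOpen_ball.inter Metric.isOpen_ball
  -- A complex line sending real parameters to real points, `0` to `Re z` and `i` to `z`. The
  -- one-variable identity theorem applies on the preimage of the intersection of the balls, which
  -- is convex and contains `0` because passing to real parts does not leave balls with real
  -- centres.
  set L : ℂ → EuclideanSpace ℂ (Fin n) := fun ζ => realToComplex a + ζ • realToComplex b with hL
  have hLI : L Complex.I = z := rePart_add_I_smul_imPart z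
  have hL0 : L 0 = realToComplex a := by simp [hL]
  have hLr : ∀ t : ℝ, L t = realToComplex (a + t • b) := by
    intro t
    ext i
    simp [hL, realToComplex_apply]
  have hLa : ∀ ζ, AnalyticAt ℂ L ζ := fun ζ =>
    analyticAt_const.add (analyticAt_id.smul analyticAt_const)
  have hLc : Continuous L := by fun_prop
  have haU : realToComplex a ∈ U := by
    constructor <;> rw [mem_ball_iff_norm]
    · exact (norm_rePart_sub_le z x₁).trans_lt (mem_ball_iff_norm.1 hz₁)
    · exact (norm_rePart_sub_le z x₂).trans_lt (mem_ball_iff_norm.1 hz₂)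
  have hconv : Convex ℝ (L ⁻¹' U) := by
    have hc : Convex ℝ U := (convex_ball _ _).inter (convex_ball _ _)
    intro ζ hζ ζ' hζ' c d hc0 hd0 hcd
    have e : L (c • ζ + d • ζ') = c • L ζ + d • L ζ' := by
      have hcd' : (c : ℂ) + d = 1 := by exact_mod_cast hcd
      ext i
      simp only [hL, PiLp.add_apply, PiLp.smul_apply, smul_eq_mul, Complex.real_smul]
      linear_combination (-(realToComplex a i)) * hcd'
    change L _ ∈ U
    rw [e]
    exact hc hζ hζ' hc0 hd0 hcd
  have g₁ : AnalyticOnNhd ℂ (fun ζ => G₁ (L ζ)) (L ⁻¹' U) :=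
    fun ζ hζ => (h₁ _ hζ.1).comp (hLa ζ)
  have g₂ : AnalyticOnNhd ℂ (fun ζ => G₂ (L ζ)) (L ⁻¹' U) :=
    fun ζ hζ => (h₂ _ hζ.2).comp (hLa ζ)
  have h0 : (0 : ℂ) ∈ L ⁻¹' U := by
    change L 0 ∈ U
    rwa [hL0]
  have hfreq : ∃ᶠ ζ in nhdsWithin (0 : ℂ) {0}ᶜ, G₁ (L ζ) = G₂ (L ζ) := by
    have ht : Filter.Tendsto (fun t : ℝ => (t : ℂ)) (nhdsWithin 0 {0}ᶜ) (nhdsWithin 0 {0}ᶜ) := by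
      refine tendsto_nhdsWithin_iff.2 ⟨?_, ?_⟩
      · exact (Complex.continuous_ofReal.tendsto' 0 0 Complex.ofReal_zero).mono_left
          nhdsWithin_le_nhds
      · filter_upwards [self_mem_nhdsWithin] with t ht
        simpa using ht
    refine ht.frequently (Filter.Eventually.frequently ?_)
    have hmem : ∀ᶠ t : ℝ in nhds 0, L t ∈ U := by
      refine (hLc.comp Complex.continuous_ofReal).continuousAt.eventually (hUo.mem_nhds ?_)
      simpa [hL0] using haU
    filter_upwards [nhdsWithin_le_nhds hmem] with t ht
    rw [hLr] at ht ⊢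
    exact h _ ht.1 ht.2
  have := g₁.eqOn_of_preconnected_of_frequently_eq g₂ hconv.isPreconnected h0 hfreq
    (show Complex.I ∈ L ⁻¹' U by change L _ ∈ U; rw [hLI]; exact ⟨hz₁, hz₂⟩)
  simpa [hLI] using this

/-- A real analytic function on `ℝⁿ` extends holomorphically to a neighbourhood of `ℝⁿ`
in `ℂⁿ`. -/
theorem exists_holomorphic_extension {n : ℕ} {f : EuclideanSpace ℝ (Fin n) → ℂ}
    (hf : AnalyticOnNhd ℝ f Set.univ) :
    ∃ (ω : Set (EuclideanSpace ℂ (Fin n))) (F : EuclideanSpace ℂ (Fin n) → ℂ), IsOpen ω ∧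
      (∀ x, realToComplex x ∈ ω) ∧ AnalyticOnNhd ℂ F ω ∧
      ∀ x, F (realToComplex x) = f x := by
  classical
  choose r hr G hG hGf using fun x => exists_local_holomorphic_extension (hf x (Set.mem_univ x))
  set F : EuclideanSpace ℂ (Fin n) → ℂ := fun z =>
    if h : ∃ x, z ∈ Metric.ball (realToComplex x) (r x) then G h.choose z else 0 with hF
  -- Local extensions agree on overlaps since they agree at the real points, so the arbitrary choice
  -- of ball in `F` is harmless.
  have hFG : ∀ x, ∀ z ∈ Metric.ball (realToComplex x) (r x), F z = G x z := by
    intro x z hz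
    have h : ∃ x, z ∈ Metric.ball (realToComplex x) (r x) := ⟨x, hz⟩
    simp only [hF, dif_pos h]
    exact eq_of_eq_on_real (hG _) (hG x)
      (fun y hy hy' => (hGf _ y hy).trans (hGf x y hy').symm) h.choose_spec hz
  have hmem : ∀ x, realToComplex x ∈ Metric.ball (realToComplex x) (r x) := fun x =>
    Metric.mem_ball_self (hr x)
  refine ⟨⋃ x, Metric.ball (realToComplex x) (r x), F, isOpen_iUnion fun _ => Metric.isOpen_ball,
    fun x => Set.mem_iUnion.2 ⟨x, hmem x⟩, fun z hz => ?_, fun x => ?_⟩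
  · obtain ⟨x, hx⟩ := Set.mem_iUnion.1 hz
    refine (hG x z hx).congr ?_
    filter_upwards [Metric.isOpen_ball.mem_nhds hx] with w hw using (hFG x w hw).symm
  · rw [hFG x _ (hmem x), hGf x x (hmem x)]

/-! ### The complex Gaussian kernel -/

/-- The normalising constant `(2π)⁻ⁿ (π/ε)^{n/2}` of the Gaussian kernel. -/
def gaussConst (n : ℕ) (ε : ℝ) : ℝ := ((2 * Real.pi) ^ n)⁻¹ * (Real.pi / ε) ^ (n / 2 : ℝ)

/-- The Gaussian kernel `z ↦ (2π)⁻ⁿ (π/ε)^{n/2} e^{-z·z/4ε}` on `ℂⁿ`. -/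
def gaussKernel {n : ℕ} (ε : ℝ) (z : EuclideanSpace ℂ (Fin n)) : ℂ :=
  gaussConst n ε * Complex.exp (-(∑ i, z i ^ 2) / (4 * ε))

theorem gaussConst_nonneg (n : ℕ) {ε : ℝ} (hε : 0 < ε) : 0 ≤ gaussConst n ε := by
  have := Real.pi_pos
  unfold gaussConst
  positivity

theorem analyticAt_gaussKernel {n : ℕ} (ε : ℝ) (z : EuclideanSpace ℂ (Fin n)) :
    AnalyticAt ℂ (gaussKernel ε) z := by
  unfold gaussKernel
  have h : ∀ i, AnalyticAt ℂ (fun z : EuclideanSpace ℂ (Fin n) => z i) z := fun i =>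
    (EuclideanSpace.proj i : EuclideanSpace ℂ (Fin n) →L[ℂ] ℂ).analyticAt z
  have h2 : AnalyticAt ℂ (fun z : EuclideanSpace ℂ (Fin n) => ∑ i, z i ^ 2) z :=
    Finset.analyticAt_fun_sum _ fun i _ => (h i).pow 2
  exact analyticAt_const.mul (h2.neg.div_const.cexp)

theorem continuous_gaussKernel {n : ℕ} (ε : ℝ) :
    Continuous (gaussKernel ε : EuclideanSpace ℂ (Fin n) → ℂ) :=
  continuous_iff_continuousAt.2 fun z => (analyticAt_gaussKernel ε z).continuousAt

/-- The kernel is exponentially small as `ε → 0` where the real part is longer than the imaginary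
part; the contour shift relies on this. -/
theorem norm_gaussKernel {n : ℕ} {ε : ℝ} (hε : 0 < ε) (a b : EuclideanSpace ℝ (Fin n)) :
    ‖gaussKernel ε (realToComplex a + Complex.I • realToComplex b)‖ =
      gaussConst n ε * Real.exp (-(‖a‖ ^ 2 - ‖b‖ ^ 2) / (4 * ε)) := by
  rw [gaussKernel, norm_mul, Complex.norm_real, Real.norm_of_nonneg (gaussConst_nonneg n hε),
    Complex.norm_exp]
  congr 2
  have e : (4 * (ε : ℂ)) = ((4 * ε : ℝ) : ℂ) := by push_cast; ring
  rw [e, Complex.div_ofReal_re, Complex.neg_re, Complex.re_sum, EuclideanSpace.norm_sq_eq,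
    EuclideanSpace.norm_sq_eq, ← Finset.sum_sub_distrib]
  congr 2
  refine Finset.sum_congr rfl fun i _ => ?_
  simp [realToComplex_apply, pow_two]

theorem gaussKernel_realToComplex {n : ℕ} (ε : ℝ) (a : EuclideanSpace ℝ (Fin n)) :
    gaussKernel ε (realToComplex a) =
      ((gaussConst n ε * Real.exp (-‖a‖ ^ 2 / (4 * ε)) : ℝ) : ℂ) := by
  rw [gaussKernel, EuclideanSpace.norm_sq_eq]
  simp [realToComplex_apply]

theorem integral_gaussKernel_one (n : ℕ) :
    ∫ u : EuclideanSpace ℝ (Fin n), gaussKernel 1 (realToComplex u) = 1 := by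
  simp_rw [gaussKernel_realToComplex]
  rw [integral_complex_ofReal, MeasureTheory.integral_const_mul]
  have h := GaussianFourier.integral_rexp_neg_mul_sq_norm (V := EuclideanSpace ℝ (Fin n))
    (b := 1 / 4) (by norm_num)
  have e : ∀ u : EuclideanSpace ℝ (Fin n), -(1 / 4) * ‖u‖ ^ 2 = -‖u‖ ^ 2 / (4 * 1) := fun u => by
    ring
  simp_rw [e] at h
  rw [h, gaussConst, finrank_euclideanSpace_fin, mul_assoc,
    ← Real.mul_rpow (by have := Real.pi_pos; positivity) (by have := Real.pi_pos; positivity)]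
  have e2 : Real.pi / 1 * (Real.pi / (1 / 4)) = (2 * Real.pi) ^ (2 : ℝ) := by
    rw [Real.rpow_two]; ring
  rw [e2, ← Real.rpow_mul Real.two_pi_pos.le, mul_div_cancel₀ _ two_ne_zero, Real.rpow_natCast,
    inv_mul_cancel₀ (pow_pos Real.two_pi_pos n).ne', Complex.ofReal_one]

/-- A non-integrable function has integral `0` by convention, so the value `1` already forces
integrability. -/
theorem integrable_gaussKernel_one (n : ℕ) :
    MeasureTheory.Integrable fun u : EuclideanSpace ℝ (Fin n) =>
      gaussKernel 1 (realToComplex u) := by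
  by_contra h
  have := integral_gaussKernel_one n
  rw [MeasureTheory.integral_undef h] at this
  exact zero_ne_one this

/-- Rescaling of convolutions with the Gaussian kernel. -/
theorem integral_mul_gaussKernel {n : ℕ} {ε : ℝ} (hε : 0 < ε) (H : EuclideanSpace ℝ (Fin n) → ℂ)
    (a : EuclideanSpace ℝ (Fin n)) :
    ∫ y, H y * gaussKernel ε (realToComplex (a - y)) =
      ∫ u, H (a - √ε • u) * gaussKernel 1 (realToComplex u) := by
  have hs : 0 < √ε := Real.sqrt_pos.2 hε
  have hn : 0 < √ε ^ n := pow_pos hs n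
  have h1 := MeasureTheory.integral_sub_left_eq_self
    (fun y => H y * gaussKernel ε (realToComplex (a - y))) MeasureTheory.volume a
  simp only [sub_sub_cancel] at h1
  have h2 := MeasureTheory.Measure.integral_comp_smul
    (MeasureTheory.volume : MeasureTheory.Measure (EuclideanSpace ℝ (Fin n)))
    (fun u => H (a - u) * gaussKernel ε (realToComplex u)) (√ε)
  rw [finrank_euclideanSpace_fin, abs_of_pos (by positivity)] at h2
  rw [← h1]
  have h3 : ∫ u, H (a - u) * gaussKernel ε (realToComplex u) =
      (√ε ^ n) • ∫ u, H (a - √ε • u) * gaussKernel ε (realToComplex (√ε • u)) := by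
    rw [h2, smul_smul, mul_inv_cancel₀ hn.ne', one_smul]
  rw [h3, ← MeasureTheory.integral_smul]
  congr 1
  funext u
  rw [Complex.real_smul, gaussKernel_realToComplex, gaussKernel_realToComplex, norm_smul,
    Real.norm_of_nonneg hs.le, mul_pow, Real.sq_sqrt hε.le]
  have e1 : -(ε * ‖u‖ ^ 2) / (4 * ε) = -‖u‖ ^ 2 / (4 * 1) := by field_simp
  have e2 : √ε ^ n * gaussConst n ε = gaussConst n 1 := by
    have : √ε ^ n = ε ^ (n / 2 : ℝ) := by
      rw [Real.sqrt_eq_rpow, ← Real.rpow_natCast, ← Real.rpow_mul hε.le]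
      congr 1; ring
    rw [gaussConst, gaussConst, this, mul_left_comm, ← Real.mul_rpow hε.le
      (by have := Real.pi_pos; positivity)]
    congr 2
    field_simp
  rw [e1, ← e2]
  push_cast
  ring

theorem norm_complexFourierExp {n : ℕ} (η : EuclideanSpace ℝ (Fin n))
    (z : EuclideanSpace ℂ (Fin n)) :
    ‖complexFourierExp η z‖ = Real.exp (inner ℝ (imPart z) η) := by
  rw [complexFourierExp, Complex.norm_exp]
  congr 1
  simp [imPart, PiLp.inner_apply, mul_comm]

theorem gaussian_fourier_integrand {n : ℕ} (ε : ℝ) (z : EuclideanSpace ℂ (Fin n))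
    (v : Fin n → ℝ) :
    (Real.exp (-ε * ‖(WithLp.toLp 2 v : EuclideanSpace ℝ (Fin n))‖ ^ 2) : ℂ) *
      complexFourierExp (WithLp.toLp 2 v) z =
    Complex.exp (-(ε : ℂ) * ∑ i, (v i : ℂ) ^ 2 + ∑ i, (-Complex.I * z i) * v i) := by
  rw [complexFourierExp, Complex.ofReal_exp, ← Complex.exp_add, EuclideanSpace.norm_sq_eq]
  congr 1
  simp [Finset.mul_sum, mul_assoc]

theorem integrable_gaussian_mul_complexFourierExp {n : ℕ} {ε : ℝ} (hε : 0 < ε)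
    (z : EuclideanSpace ℂ (Fin n)) :
    MeasureTheory.Integrable fun η : EuclideanSpace ℝ (Fin n) =>
      (Real.exp (-ε * ‖η‖ ^ 2) : ℂ) * complexFourierExp η z := by
  rw [← (PiLp.volume_preserving_toLp (Fin n)).integrable_comp_emb
    (MeasurableEquiv.toLp 2 _).measurableEmbedding]
  simp only [Function.comp_def, gaussian_fourier_integrand]
  exact GaussianFourier.integrable_cexp_neg_mul_sum_add (by simpa using hε) _

/-- The Gaussian kernel as a superposition of exponentials. -/
theorem integral_gaussian_mul_complexFourierExp {n : ℕ} {ε : ℝ} (hε : 0 < ε)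
    (z : EuclideanSpace ℂ (Fin n)) :
    ((2 * Real.pi) ^ n : ℂ)⁻¹ * ∫ η : EuclideanSpace ℝ (Fin n),
      (Real.exp (-ε * ‖η‖ ^ 2) : ℂ) * complexFourierExp η z = gaussKernel ε z := by
  rw [← (PiLp.volume_preserving_toLp (Fin n)).integral_comp
    (MeasurableEquiv.toLp 2 _).measurableEmbedding]
  simp only [gaussian_fourier_integrand]
  rw [GaussianFourier.integral_cexp_neg_mul_sum_add (by simpa using hε), gaussKernel, gaussConst,
    ← mul_assoc]
  congr 1
  · push_cast
    rw [Complex.ofReal_cpow (by have := Real.pi_pos; positivity)]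
    push_cast
    simp
  · congr 2
    rw [← Finset.sum_neg_distrib]
    refine Finset.sum_congr rfl fun i _ => ?_
    rw [mul_pow, neg_sq, Complex.I_sq]
    ring

/-! ### Shifting the contour -/

/-- The product vanishes near every point off `tsupport c`. This permits integrands built from
functions controlled only over the support of the cutoff. -/
theorem continuous_smul_of_continuousAt_tsupport {X : Type*} [TopologicalSpace X] {c : X → ℝ}
    {h : X → ℂ} (hc : Continuous c) (hh : ∀ x ∈ tsupport c, ContinuousAt h x) :
    Continuous fun x => c x • h x := by
  refine continuous_iff_continuousAt.2 fun x => ?_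
  by_cases hx : x ∈ tsupport c
  · exact hc.continuousAt.smul (hh x hx)
  · have h0 : c =ᶠ[nhds x] 0 := notMem_tsupport_iff_eventuallyEq.1 hx
    have h1 : (fun x => c x • h x) =ᶠ[nhds x] fun _ => 0 := by
      filter_upwards [h0] with y hy
      simp [hy]
    exact continuousAt_const.congr h1.symm

theorem integrable_smul_of_continuousAt_tsupport {n : ℕ} {c : EuclideanSpace ℝ (Fin n) → ℝ}
    {h : EuclideanSpace ℝ (Fin n) → ℂ} (hc : Continuous c) (hcs : HasCompactSupport c)
    (hh : ∀ x ∈ tsupport c, ContinuousAt h x) :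
    MeasureTheory.Integrable fun x => c x • h x :=
  (continuous_smul_of_continuousAt_tsupport hc hh).integrable_of_hasCompactSupport hcs.smul_right

/-- The derivative of `∫ χ(y) P(y + itb) dy` with respect to `t`, for holomorphic `P`. -/
theorem hasDerivAt_integral_shift {n : ℕ} {χ : EuclideanSpace ℝ (Fin n) → ℝ}
    (hχ : ContDiff ℝ (⊤ : ℕ∞) χ) (hc : HasCompactSupport χ) {ω : Set (EuclideanSpace ℂ (Fin n))}
    {P : EuclideanSpace ℂ (Fin n) → ℂ} (hP : AnalyticOnNhd ℂ P ω)
    {b : EuclideanSpace ℝ (Fin n)}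
    (hmem : ∀ y ∈ tsupport χ, ∀ t ∈ Set.Icc (-1 : ℝ) 2,
      realToComplex y + (Complex.I * t) • realToComplex b ∈ ω) {t : ℝ} (ht : t ∈ Set.Ioo (-1 : ℝ) 2) :
    HasDerivAt (fun t : ℝ => ∫ y, χ y • P (realToComplex y + (Complex.I * t) • realToComplex b))
      (-Complex.I * ∫ y, fderiv ℝ χ y b •
        P (realToComplex y + (Complex.I * t) • realToComplex b)) t := by
  set g : ℝ → EuclideanSpace ℝ (Fin n) → EuclideanSpace ℂ (Fin n) :=
    fun t y => realToComplex y + (Complex.I * t) • realToComplex b with hg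
  have hgc : Continuous fun p : ℝ × EuclideanSpace ℝ (Fin n) => g p.1 p.2 := by
    have h1 := continuous_realToComplex (n := n)
    have h2 : Continuous fun p : ℝ × EuclideanSpace ℝ (Fin n) => realToComplex p.2 :=
      h1.comp continuous_snd
    have h3 : Continuous fun p : ℝ × EuclideanSpace ℝ (Fin n) => (Complex.I * (p.1 : ℂ)) := by
      fun_prop
    exact h2.add (h3.smul continuous_const)
  have hgy : ∀ t, Continuous (g t) := fun t => hgc.comp (by fun_prop : Continuous fun y => (t, y))
  have hP' : AnalyticOnNhd ℂ (fun z => fderiv ℂ P z (realToComplex b)) ω := fun z hz =>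
    ((ContinuousLinearMap.apply ℂ ℂ (realToComplex b)).analyticAt _).comp (hP z hz).fderiv
  have hcont : ∀ t ∈ Set.Icc (-1 : ℝ) 2, ∀ y ∈ tsupport χ, ContinuousAt (fun y => P (g t y)) y :=
    fun t ht y hy => ContinuousAt.comp (hP _ (hmem y hy t ht)).continuousAt (hgy t).continuousAt
  have hcont' : ∀ t ∈ Set.Icc (-1 : ℝ) 2, ∀ y ∈ tsupport χ,
      ContinuousAt (fun y => fderiv ℂ P (g t y) (realToComplex b)) y :=
    fun t ht y hy => ContinuousAt.comp (f := g t)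
      (g := fun z => fderiv ℂ P z (realToComplex b))
      (hP' _ (hmem y hy t ht)).continuousAt (hgy t).continuousAt
  obtain ⟨C, hC⟩ := (isCompact_Icc.prod hc).exists_bound_of_continuousOn
    (f := fun p : ℝ × EuclideanSpace ℝ (Fin n) => fderiv ℂ P (g p.1 p.2) (realToComplex b))
    (fun p hp => (ContinuousAt.comp (f := fun p : ℝ × EuclideanSpace ℝ (Fin n) => g p.1 p.2)
      (g := fun z => fderiv ℂ P z (realToComplex b))
      (hP' _ (hmem p.2 hp.2 p.1 hp.1)).continuousAt hgc.continuousAt).continuousWithinAt)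
    (s := Set.Icc (-1 : ℝ) 2 ×ˢ tsupport χ)
  -- The interval `(-1, 2)` leaves room around `[0, 1]`, so two-sided derivatives exist also at its
  -- endpoints.
  have hnhds : Set.Ioo (-1 : ℝ) 2 ∈ nhds t := Ioo_mem_nhds ht.1 ht.2
  have ht' := Set.Ioo_subset_Icc_self ht
  have hmain := (hasDerivAt_integral_of_dominated_loc_of_deriv_le (𝕜 := ℝ)
    (μ := MeasureTheory.volume)
    (F := fun t y => χ y • P (g t y))
    (F' := fun t y => χ y • (Complex.I * fderiv ℂ P (g t y) (realToComplex b)))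
    (x₀ := t) (s := Set.Ioo (-1 : ℝ) 2) (bound := fun y => C * ‖χ y‖) hnhds
    (by
      filter_upwards [hnhds] with t ht
      exact (integrable_smul_of_continuousAt_tsupport hχ.continuous hc
        (hcont t (Set.Ioo_subset_Icc_self ht))).aestronglyMeasurable)
    (integrable_smul_of_continuousAt_tsupport hχ.continuous hc (hcont t ht'))
    (integrable_smul_of_continuousAt_tsupport hχ.continuous hc
      fun y hy => (hcont' t ht' y hy).const_mul _).aestronglyMeasurable
    (Filter.Eventually.of_forall fun y τ hτ => by
      by_cases hy : y ∈ tsupport χ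
      · have := hC (τ, y) ⟨Set.Ioo_subset_Icc_self hτ, hy⟩
        rw [norm_smul, norm_mul, Complex.norm_I, one_mul, mul_comm]
        gcongr
      · simp [image_eq_zero_of_notMem_tsupport hy])
    ((hχ.continuous.integrable_of_hasCompactSupport hc).norm.const_mul C)
    (Filter.Eventually.of_forall fun y τ hτ => by
      by_cases hy : y ∈ tsupport χ
      · refine HasDerivAt.fun_const_smul _ ?_
        have h1 : HasDerivAt (fun τ : ℝ => g τ y) (Complex.I • realToComplex b) τ := by
          have h2 : HasDerivAt (fun τ : ℝ => Complex.I * (τ : ℂ)) (Complex.I * 1) τ :=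
            (Complex.ofRealCLM.hasDerivAt (x := τ)).const_mul Complex.I
          rw [mul_one] at h2
          exact (h2.smul_const (realToComplex b)).const_add (realToComplex y)
        have h3 := ((hP _ (hmem y hy τ (Set.Ioo_subset_Icc_self
          hτ))).differentiableAt.hasFDerivAt.restrictScalars ℝ).comp_hasDerivAt τ h1
        refine h3.congr_deriv ?_
        rw [ContinuousLinearMap.coe_restrictScalars', map_smul]
        rfl
      · simpa [image_eq_zero_of_notMem_tsupport hy] using hasDerivAt_const τ (0 : ℂ))).2
  have hfd : ∀ y ∈ tsupport χ, HasFDerivAt (fun y => P (g t y))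
      (((fderiv ℂ P (g t y)).restrictScalars ℝ).comp (realToComplexCLM n)) y := by
    intro y hy
    have h1 : HasFDerivAt (g t) (realToComplexCLM n) y :=
      (realToComplexCLM n).hasFDerivAt.add_const _
    exact ((hP _ (hmem y hy t ht')).differentiableAt.hasFDerivAt.restrictScalars ℝ).comp y h1
  have hsame : ∀ y, χ y • fderiv ℝ (fun y => P (g t y)) y b =
      χ y • fderiv ℂ P (g t y) (realToComplex b) := by
    intro y
    by_cases hy : y ∈ tsupport χ
    · rw [(hfd y hy).fderiv]; rfl
    · simp [image_eq_zero_of_notMem_tsupport hy]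
  -- As `P` is holomorphic, its `t`-derivative is `i` times its real derivative in `y` along `b`;
  -- integration by parts moves that derivative onto `χ`.
  have hparts := integral_smul_fderiv_eq_neg_fderiv_smul_of_integrable (𝕜 := ℝ)
    (μ := MeasureTheory.volume) (f := χ) (g := fun y => P (g t y)) (v := b)
    (integrable_smul_of_continuousAt_tsupport
      ((hχ.continuous_fderiv (by simp)).clm_apply continuous_const)
      (hc.fderiv_apply ℝ b) fun y hy => hcont t ht' y (tsupport_fderiv_apply_subset ℝ b hy))
    (by
      simp_rw [hsame]
      exact integrable_smul_of_continuousAt_tsupport hχ.continuous hc (hcont' t ht'))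
    (integrable_smul_of_continuousAt_tsupport hχ.continuous hc (hcont t ht'))
    (fun y _ => (hχ.differentiable (by simp)).differentiableAt)
    (fun y hy => (hfd y hy).differentiableAt)
  convert! hmain using 1
  simp_rw [hsame] at hparts
  rw [neg_mul, ← mul_neg, ← hparts, ← MeasureTheory.integral_const_mul]
  congr 1
  funext y
  simp only [Complex.real_smul]
  ring

/-! ### Gaussian regularisation converges in a complex neighbourhood -/

/-- The Gaussian regularisation of `χ f`, as a function on `ℂⁿ`. -/
def gaussConv {n : ℕ} (χ : EuclideanSpace ℝ (Fin n) → ℝ) (f : EuclideanSpace ℝ (Fin n) → ℂ)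
    (ε : ℝ) (z : EuclideanSpace ℂ (Fin n)) : ℂ :=
  ∫ y, χ y • (f y * gaussKernel ε (z - realToComplex y))

section Shift

variable {n : ℕ} {χ : EuclideanSpace ℝ (Fin n) → ℝ} {R δ : ℝ}
  {ω : Set (EuclideanSpace ℂ (Fin n))} {F : EuclideanSpace ℂ (Fin n) → ℂ}
  {f : EuclideanSpace ℝ (Fin n) → ℂ}

theorem continuous_real_add_I_smul : Continuous
    fun p : EuclideanSpace ℝ (Fin n) × EuclideanSpace ℝ (Fin n) =>
      realToComplex p.1 + Complex.I • realToComplex p.2 :=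
  (continuous_realToComplex.comp continuous_fst).add
    ((continuous_realToComplex.comp continuous_snd).const_smul Complex.I)

theorem exists_bound_on_tube (hc : HasCompactSupport χ) (hF : AnalyticOnNhd ℂ F ω)
    (hω : ∀ y ∈ tsupport χ, ∀ b : EuclideanSpace ℝ (Fin n), ‖b‖ ≤ δ →
      realToComplex y + Complex.I • realToComplex b ∈ ω) :
    ∃ C : ℝ, 0 ≤ C ∧ ∀ y ∈ tsupport χ, ∀ b : EuclideanSpace ℝ (Fin n), ‖b‖ ≤ δ →
      ‖F (realToComplex y + Complex.I • realToComplex b)‖ ≤ C := by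
  obtain ⟨C, hC⟩ := (hc.prod (isCompact_closedBall (0 : EuclideanSpace ℝ (Fin n))
    δ)).exists_bound_of_continuousOn
    (f := fun p : EuclideanSpace ℝ (Fin n) × EuclideanSpace ℝ (Fin n) =>
      F (realToComplex p.1 + Complex.I • realToComplex p.2))
    (fun p hp => (ContinuousAt.comp (g := F)
      (f := fun p : EuclideanSpace ℝ (Fin n) × EuclideanSpace ℝ (Fin n) =>
        realToComplex p.1 + Complex.I • realToComplex p.2) (hF _ (hω p.1 hp.1 p.2
      (mem_closedBall_zero_iff.1 hp.2))).continuousAt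
      continuous_real_add_I_smul.continuousAt).continuousWithinAt)
    (s := tsupport χ ×ˢ Metric.closedBall 0 δ)
  refine ⟨max C 0, le_max_right _ _, fun y hy b hb => ?_⟩
  exact (hC (y, b) ⟨hy, mem_closedBall_zero_iff.2 hb⟩).trans (le_max_left _ _)

/-- Shifting the contour in the Gaussian regularisation costs an exponentially small error. -/
theorem exists_shift_bound (hχ : ContDiff ℝ (⊤ : ℕ∞) χ) (hc : HasCompactSupport χ)
    (hχ1 : ∀ x, ‖x‖ ≤ R + 2 → χ x = 1) (hF : AnalyticOnNhd ℂ F ω)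
    (hδ : 0 < δ) (hδ2 : δ ≤ 1 / 2)
    (hω : ∀ y ∈ tsupport χ, ∀ b : EuclideanSpace ℝ (Fin n), ‖b‖ ≤ 2 * δ →
      realToComplex y + Complex.I • realToComplex b ∈ ω)
    (hFf : ∀ x, F (realToComplex x) = f x) :
    ∃ D : ℝ, ∀ ε : ℝ, 0 < ε → ∀ a b : EuclideanSpace ℝ (Fin n), ‖a‖ ≤ R + 1 → ‖b‖ ≤ δ →
      ‖(∫ y, (χ y • F (realToComplex y + Complex.I • realToComplex b)) *
          gaussKernel ε (realToComplex (a - y))) -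
        gaussConv χ f ε (realToComplex a + Complex.I • realToComplex b)‖ ≤
      D * (gaussConst n ε * Real.exp (-(3 / 16) * ε⁻¹)) := by
  obtain ⟨C, hC0, hC⟩ := exists_bound_on_tube hc hF (δ := δ)
    fun y hy b hb => hω y hy b (hb.trans (by linarith))
  set I₀ : ℝ := ∫ y, ‖fderiv ℝ χ y‖ with hI₀
  refine ⟨δ * C * I₀, fun ε hε a b ha hb => ?_⟩
  set z := realToComplex a + Complex.I • realToComplex b with hz
  set κ : ℝ := gaussConst n ε * Real.exp (-(3 / 16) * ε⁻¹) with hκ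
  have hκ0 : 0 ≤ κ := mul_nonneg (gaussConst_nonneg n hε) (Real.exp_pos _).le
  set P : EuclideanSpace ℂ (Fin n) → ℂ := fun ζ => F ζ * gaussKernel ε (z - ζ) with hP
  have hPa : AnalyticOnNhd ℂ P ω := fun ζ hζ =>
    (hF ζ hζ).mul ((analyticAt_gaussKernel ε _).comp (analyticAt_const.sub analyticAt_id))
  have hpt : ∀ t : ℝ, (Complex.I * t) • realToComplex b = Complex.I • realToComplex (t • b) := by
    intro t
    ext i
    simp [realToComplex_apply, mul_assoc]
  -- Parameters up to `|t| = 2` are the reason for the tube of width `2δ` in the hypothesis.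
  have hmem : ∀ y ∈ tsupport χ, ∀ t ∈ Set.Icc (-1 : ℝ) 2,
      realToComplex y + (Complex.I * t) • realToComplex b ∈ ω := by
    intro y hy t ht
    rw [hpt]
    refine hω y hy _ ?_
    rw [norm_smul, Real.norm_eq_abs]
    have : |t| ≤ 2 := abs_le.2 ⟨by linarith [ht.1], ht.2⟩
    exact mul_le_mul this hb (norm_nonneg _) zero_le_two
  -- Mean value inequality in the shift parameter: `t = 0` is `gaussConv` on the real contour, and
  -- `t = 1` has the kernel at the real point `a - y`.
  have hkey := norm_image_sub_le_of_norm_deriv_le_segment_01'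
    (f := fun t : ℝ => ∫ y, χ y • P (realToComplex y + (Complex.I * t) • realToComplex b))
    (f' := fun t : ℝ => -Complex.I * ∫ y, fderiv ℝ χ y b •
        P (realToComplex y + (Complex.I * t) • realToComplex b)) (C := δ * C * I₀ * κ)
    (fun t ht => (hasDerivAt_integral_shift hχ hc hPa hmem
      ⟨by linarith [ht.1], by linarith [ht.2]⟩).hasDerivWithinAt)
    (fun t ht => by
      rw [norm_mul, norm_neg, Complex.norm_I, one_mul]
      have hint : MeasureTheory.Integrable fun y => ‖fderiv ℝ χ y‖ * (δ * (C * κ)) :=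
        (((hχ.continuous_fderiv (by simp)).integrable_of_hasCompactSupport
          (hc.fderiv ℝ)).norm).mul_const _
      refine (MeasureTheory.norm_integral_le_of_norm_le hint
        (Filter.Eventually.of_forall fun y => ?_)).trans_eq ?_
      · rw [norm_smul]
        by_cases hy : fderiv ℝ χ y = 0
        · simp [hy]
        have hyK : y ∈ tsupport χ :=
          tsupport_fderiv_subset ℝ (subset_tsupport _ (Function.mem_support.2 hy))
        -- The derivative of `χ` vanishes where `χ` is locally constant, so only `y` at distance at
        -- least `1` from `a` contribute.
        have hyR : R + 2 ≤ ‖y‖ := by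
          by_contra hlt
          push Not at hlt
          refine hy ?_
          have hev : χ =ᶠ[nhds y] fun _ => 1 := by
            filter_upwards [(continuous_norm.continuousAt (x := y)).eventually (gt_mem_nhds hlt)]
              with x hx using hχ1 x hx.le
          rw [hev.fderiv_eq]
          simp
        have h1 : ‖fderiv ℝ χ y b‖ ≤ ‖fderiv ℝ χ y‖ * δ :=
          (ContinuousLinearMap.le_opNorm _ _).trans (by gcongr)
        have htb : ‖t • b‖ ≤ δ := by
          rw [norm_smul, Real.norm_of_nonneg ht.1]
          nlinarith [ht.2, norm_nonneg b]
        have h2 : ‖F (realToComplex y + (Complex.I * t) • realToComplex b)‖ ≤ C := by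
          rw [hpt]; exact hC y hyK _ htb
        have h3 : ‖gaussKernel ε (z - (realToComplex y + (Complex.I * t) • realToComplex b))‖ ≤
            κ := by
          have e : z - (realToComplex y + (Complex.I * t) • realToComplex b) =
              realToComplex (a - y) + Complex.I • realToComplex ((1 - t) • b) := by
            ext i
            simp [hz, realToComplex_apply]
            ring
          rw [e, norm_gaussKernel hε, hκ]
          have := gaussConst_nonneg n hε
          gcongr
          have hay : 1 ≤ ‖a - y‖ := by
            have := norm_sub_norm_le y a
            rw [norm_sub_rev] at this
            linarith
          have htb' : ‖(1 - t) • b‖ ≤ 1 / 2 := by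
            rw [norm_smul, Real.norm_of_nonneg (by linarith [ht.2])]
            nlinarith [ht.1, norm_nonneg b]
          -- Real part at least `1` and imaginary part at most `1/2` give `1 - 1/4`; dividing by
          -- `4ε` produces the exponent `3/16 · ε⁻¹`.
          have h5 : 3 / 4 ≤ ‖a - y‖ ^ 2 - ‖(1 - t) • b‖ ^ 2 := by
            nlinarith [norm_nonneg ((1 - t) • b)]
          rw [neg_div, neg_mul, neg_le_neg_iff, ← div_eq_mul_inv, div_le_div_iff₀ hε (by positivity)]
          nlinarith
        have h4 : ‖P (realToComplex y + (Complex.I * t) • realToComplex b)‖ ≤ C * κ := by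
          simp only [hP, norm_mul]
          gcongr
        calc _ ≤ ‖fderiv ℝ χ y‖ * δ * (C * κ) := by gcongr
          _ = _ := by ring
      · rw [MeasureTheory.integral_mul_const, ← hI₀]
        ring)
  refine le_trans (le_of_eq ?_) hkey
  congr 1
  congr 1
  · congr 1
    funext y
    have e : z - (realToComplex y + (Complex.I * (1 : ℝ)) • realToComplex b) =
        realToComplex (a - y) := by
      ext i
      simp [hz, realToComplex_apply]
    simp only [hP]
    rw [e, smul_mul_assoc]
    simp
  · rw [gaussConv]
    congr 1
    funext y
    simp [hP, hFf]

/-- Uniform convergence of the shifted Gaussian regularisations. -/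
theorem eventually_norm_shift_sub_le (hχ : Continuous χ) (hc : HasCompactSupport χ)
    (hχ1 : ∀ x, ‖x‖ ≤ R + 2 → χ x = 1) (hF : AnalyticOnNhd ℂ F ω)
    (hω : ∀ y ∈ tsupport χ, ∀ b : EuclideanSpace ℝ (Fin n), ‖b‖ ≤ δ →
      realToComplex y + Complex.I • realToComplex b ∈ ω) {e : ℝ} (he : 0 < e) :
    ∀ᶠ ε : ℝ in nhdsWithin 0 (Set.Ioi 0), ∀ a b : EuclideanSpace ℝ (Fin n), ‖a‖ ≤ R + 1 →
      ‖b‖ ≤ δ →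
      ‖(∫ y, (χ y • F (realToComplex y + Complex.I • realToComplex b)) *
          gaussKernel ε (realToComplex (a - y))) -
        F (realToComplex a + Complex.I • realToComplex b)‖ < e := by
  obtain ⟨C, hC0, hC⟩ := exists_bound_on_tube hc hF hω
  set B : Set (EuclideanSpace ℝ (Fin n)) := Metric.closedBall 0 δ with hB
  have : CompactSpace B := isCompact_iff_compactSpace.1 (isCompact_closedBall _ _)
  -- Treating `b` as a variable in a compact ball makes `H` compactly supported, hence uniformly
  -- continuous, which gives estimates uniform in `b`.
  set H : EuclideanSpace ℝ (Fin n) × B → ℂ := fun p =>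
    χ p.1 • F (realToComplex p.1 + Complex.I • realToComplex p.2.1) with hH
  have hsub : tsupport (fun p : EuclideanSpace ℝ (Fin n) × B => χ p.1) ⊆
      tsupport χ ×ˢ (Set.univ : Set B) := fun p hp =>
    ⟨tsupport_comp_subset_preimage (f := Prod.fst) χ continuous_fst hp, Set.mem_univ _⟩
  have hHc : Continuous H := by
    refine continuous_smul_of_continuousAt_tsupport (hχ.comp continuous_fst) fun p hp => ?_
    exact ContinuousAt.comp (g := F) (f := fun p : EuclideanSpace ℝ (Fin n) × B =>
      realToComplex p.1 + Complex.I • realToComplex p.2.1)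
      (hF _ (hω p.1 (hsub hp).1 p.2.1 (mem_closedBall_zero_iff.1 p.2.2))).continuousAt
      (continuous_real_add_I_smul.comp (f := fun p : EuclideanSpace ℝ (Fin n) × B => (p.1, p.2.1))
        (continuous_fst.prodMk (continuous_subtype_val.comp continuous_snd))).continuousAt
  have hHs : HasCompactSupport H := by
    refine HasCompactSupport.intro (hc.prod isCompact_univ) fun p hp => ?_
    have : p.1 ∉ tsupport χ := fun h => hp ⟨h, Set.mem_univ _⟩
    simp [hH, image_eq_zero_of_notMem_tsupport this]
  have hHu : UniformContinuous H := hHs.uniformContinuous_of_continuous hHc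
  have hHb : ∀ p, ‖H p‖ ≤ (⨆ y, ‖χ y‖) * C := by
    intro p
    have hbdd : BddAbove (Set.range fun y => ‖χ y‖) := by
      obtain ⟨M, hM⟩ := hχ.bounded_above_of_compact_support hc
      exact ⟨M, by rintro _ ⟨y, rfl⟩; exact hM y⟩
    have h1 : ‖χ p.1‖ ≤ ⨆ y, ‖χ y‖ := le_ciSup hbdd p.1
    by_cases hp : p.1 ∈ tsupport χ
    · rw [hH, norm_smul]
      exact mul_le_mul h1 (hC p.1 hp p.2.1 (mem_closedBall_zero_iff.1 p.2.2)) (norm_nonneg _)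
        ((norm_nonneg _).trans h1)
    · simp only [hH, image_eq_zero_of_notMem_tsupport hp, zero_smul, norm_zero]
      exact mul_nonneg ((norm_nonneg _).trans h1) hC0
  -- Convergence along the product with `⊤` is uniform convergence in `(a, b)`, so one application
  -- of dominated convergence suffices.
  set l : Filter (ℝ × (EuclideanSpace ℝ (Fin n) × B)) :=
    nhdsWithin 0 (Set.Ioi 0) ×ˢ ⊤ with hl
  have hDCT : Filter.Tendsto (fun q : ℝ × (EuclideanSpace ℝ (Fin n) × B) =>
      ∫ u, (H (q.2.1 - √q.1 • u, q.2.2) - H q.2) * gaussKernel 1 (realToComplex u)) l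
      (nhds (∫ _u : EuclideanSpace ℝ (Fin n), (0 : ℂ))) := by
    refine MeasureTheory.tendsto_integral_filter_of_dominated_convergence
      (fun u => 2 * ((⨆ y, ‖χ y‖) * C) * ‖gaussKernel 1 (realToComplex u)‖) ?_ ?_ ?_ ?_
    · refine Filter.Eventually.of_forall fun q => Continuous.aestronglyMeasurable ?_
      have h1 : Continuous fun u : EuclideanSpace ℝ (Fin n) => H (q.2.1 - √q.1 • u, q.2.2) :=
        hHc.comp (by fun_prop)
      exact (h1.sub continuous_const).mul
        ((continuous_gaussKernel 1).comp continuous_realToComplex)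
    · refine Filter.Eventually.of_forall fun q => Filter.Eventually.of_forall fun u => ?_
      rw [norm_mul]
      gcongr
      refine (norm_sub_le _ _).trans ?_
      linarith [hHb (q.2.1 - √q.1 • u, q.2.2), hHb q.2]
    · exact (integrable_gaussKernel_one n).norm.const_mul _
    · refine Filter.Eventually.of_forall fun u => ?_
      rw [← zero_mul (gaussKernel 1 (realToComplex u))]
      refine Filter.Tendsto.mul_const _ ?_
      rw [Metric.tendsto_nhds]
      intro e' he'
      obtain ⟨d, hd, hdH⟩ := Metric.uniformContinuous_iff.1 hHu e' he'
      have hlim : Filter.Tendsto (fun ε : ℝ => ‖√ε • u‖) (nhdsWithin 0 (Set.Ioi 0)) (nhds 0) := by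
        have h1 : Continuous fun ε : ℝ => ‖√ε • u‖ := by fun_prop
        exact (h1.tendsto' 0 0 (by simp)).mono_left nhdsWithin_le_nhds
      have h2 := (hlim.eventually (gt_mem_nhds hd)).prod_inl
        (⊤ : Filter (EuclideanSpace ℝ (Fin n) × B))
      filter_upwards [h2] with q hq
      rw [dist_zero_right, ← dist_eq_norm]
      refine hdH ?_
      rw [Prod.dist_eq, dist_self, max_eq_left dist_nonneg, dist_eq_norm, sub_sub_cancel_left,
        norm_neg]
      exact hq
  rw [MeasureTheory.integral_zero] at hDCT
  have hev := Metric.tendsto_nhds.1 hDCT e he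
  rw [hl, Filter.prod_top, Filter.eventually_comap] at hev
  filter_upwards [hev, self_mem_nhdsWithin] with ε hε hε0 a b ha hb
  have h := hε (ε, (a, ⟨b, mem_closedBall_zero_iff.2 hb⟩)) rfl
  rw [dist_zero_right] at h
  have hχa : χ a = 1 := hχ1 a (by linarith)
  have e1 := integral_mul_gaussKernel hε0
    (fun y => χ y • F (realToComplex y + Complex.I • realToComplex b)) a
  simp only [e1]
  refine lt_of_eq_of_lt ?_ h
  congr 1
  simp_rw [sub_mul]
  rw [MeasureTheory.integral_sub, MeasureTheory.integral_const_mul, integral_gaussKernel_one,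
    mul_one]
  · simp [hH, hχa]
  · refine (integrable_gaussKernel_one n).bdd_mul (c := (⨆ y, ‖χ y‖) * C) ?_ ?_
    · have h1 : Continuous fun u : EuclideanSpace ℝ (Fin n) =>
          H (a - √ε • u, ⟨b, mem_closedBall_zero_iff.2 hb⟩) := hHc.comp (by fun_prop)
      exact h1.aestronglyMeasurable
    · exact Filter.Eventually.of_forall fun u => hHb _
  · exact (integrable_gaussKernel_one n).const_mul _

/-- The normalising constant grows only like the power `(ε⁻¹)^{n/2}`, which is beaten by the
exponential. -/
theorem tendsto_gaussConst_mul_exp (n : ℕ) :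
    Filter.Tendsto (fun ε : ℝ => gaussConst n ε * Real.exp (-(3 / 16) * ε⁻¹))
      (nhdsWithin 0 (Set.Ioi 0)) (nhds 0) := by
  have h := ((tendsto_rpow_mul_exp_neg_mul_atTop_nhds_zero (n / 2 : ℝ) (3 / 16)
    (by norm_num)).comp tendsto_inv_nhdsGT_zero).const_mul
    (((2 * Real.pi) ^ n)⁻¹ * Real.pi ^ (n / 2 : ℝ))
  rw [mul_zero] at h
  refine h.congr' ?_
  filter_upwards [self_mem_nhdsWithin] with ε hε
  have hε0 : 0 < ε := hε
  rw [Function.comp_apply, gaussConst, div_eq_mul_inv Real.pi ε,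
    Real.mul_rpow Real.pi_pos.le (by positivity)]
  ring

/-- The Gaussian regularisations of a real analytic function converge uniformly in a complex
neighbourhood to the holomorphic extension. -/
theorem eventually_norm_gaussConv_sub_le (hχ : ContDiff ℝ (⊤ : ℕ∞) χ) (hc : HasCompactSupport χ)
    (hχ1 : ∀ x, ‖x‖ ≤ R + 2 → χ x = 1) (hF : AnalyticOnNhd ℂ F ω)
    (hδ : 0 < δ) (hδ2 : δ ≤ 1 / 2)
    (hω : ∀ y ∈ tsupport χ, ∀ b : EuclideanSpace ℝ (Fin n), ‖b‖ ≤ 2 * δ →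
      realToComplex y + Complex.I • realToComplex b ∈ ω)
    (hFf : ∀ x, F (realToComplex x) = f x) {e : ℝ} (he : 0 < e) :
    ∀ᶠ ε : ℝ in nhdsWithin 0 (Set.Ioi 0), ∀ z : EuclideanSpace ℂ (Fin n),
      ‖rePart z‖ ≤ R + 1 → ‖imPart z‖ ≤ δ → ‖gaussConv χ f ε z - F z‖ < e := by
  obtain ⟨D, hD⟩ := exists_shift_bound hχ hc hχ1 hF hδ hδ2 hω hFf
  have h1 := eventually_norm_shift_sub_le hχ.continuous hc hχ1 hF (δ := δ)
    (fun y hy b hb => hω y hy b (hb.trans (by linarith))) (half_pos he)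
  have h2 : ∀ᶠ ε : ℝ in nhdsWithin 0 (Set.Ioi 0),
      D * (gaussConst n ε * Real.exp (-(3 / 16) * ε⁻¹)) < e / 2 := by
    have := (tendsto_gaussConst_mul_exp n).const_mul D
    rw [mul_zero] at this
    exact this.eventually (gt_mem_nhds (half_pos he))
  filter_upwards [h1, h2, self_mem_nhdsWithin] with ε h1 h2 hε z hre him
  have h3 := hD ε hε (rePart z) (imPart z) hre him
  have h4 := h1 (rePart z) (imPart z) hre him
  rw [rePart_add_I_smul_imPart] at h3 h4
  rw [norm_sub_rev] at h3
  have := norm_sub_le_norm_sub_add_norm_sub (gaussConv χ f ε z)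
    (∫ y, (χ y • F (realToComplex y + Complex.I • realToComplex (imPart z))) *
      gaussKernel ε (realToComplex (rePart z - y))) (F z)
  linarith

end Shift

/-! ### Extension of a carried functional to continuous functions -/

/-- A functional on `A(ℝⁿ)` carried by `K ⊂ ω` factors through the continuous functions on any
compact set containing the complex neighbourhood `ω`. -/
theorem exists_extension_continuousMap {n : ℕ} (w : RealAnalytic n →L[ℂ] ℂ)
    {K : Set (EuclideanSpace ℝ (Fin n))} (hw : CarriedBy (fun f => ‖w f‖) K)
    {ω B : Set (EuclideanSpace ℂ (Fin n))} [CompactSpace B] (hω : IsOpen ω)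
    (hKω : realToComplex '' K ⊆ ω) (hωB : ω ⊆ B) :
    ∃ L : C(B, ℂ) →L[ℂ] ℂ, ∀ (f : RealAnalytic n) (F : EuclideanSpace ℂ (Fin n) → ℂ)
      (g : C(B, ℂ)), DifferentiableOn ℂ F ω →
      (∀ x, realToComplex x ∈ ω → F (realToComplex x) = f x) →
      (∀ z : B, (z : EuclideanSpace ℂ (Fin n)) ∈ ω → g z = F z) → L g = w f := by
  obtain ⟨C, hC⟩ := hw ω hω hKω
  -- Pairs having a common holomorphic function on `ω`. The carrier estimate bounds `w` of the first
  -- entry by the norm of the second, so `w` descends to a bounded functional on the second entries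
  -- and extends by Hahn–Banach.
  let S : Submodule ℂ (RealAnalytic n × C(B, ℂ)) :=
    { carrier := {p | ∃ F : EuclideanSpace ℂ (Fin n) → ℂ, DifferentiableOn ℂ F ω ∧
        (∀ x, realToComplex x ∈ ω → F (realToComplex x) = p.1 x) ∧
        ∀ z : B, (z : EuclideanSpace ℂ (Fin n)) ∈ ω → p.2 z = F z}
      add_mem' := by
        rintro p q ⟨F, hF, hF1, hF2⟩ ⟨G, hG, hG1, hG2⟩
        refine ⟨F + G, hF.add hG, fun x hx => ?_, fun z hz => ?_⟩
        · rw [Pi.add_apply, hF1 x hx, hG1 x hx]; rfl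
        · rw [Pi.add_apply, ← hF2 z hz, ← hG2 z hz]; rfl
      zero_mem' := ⟨0, differentiableOn_const 0, fun _ _ => rfl, fun _ _ => rfl⟩
      smul_mem' := by
        rintro c p ⟨F, hF, hF1, hF2⟩
        refine ⟨c • F, hF.const_smul c, fun x hx => ?_, fun z hz => ?_⟩
        · rw [Pi.smul_apply, hF1 x hx]; rfl
        · rw [Pi.smul_apply, ← hF2 z hz]; rfl }
  let π₂ : S →ₗ[ℂ] C(B, ℂ) := (LinearMap.snd ℂ _ _).comp S.subtype
  let g : S →ₗ[ℂ] ℂ := (w.toLinearMap.comp (LinearMap.fst ℂ _ _)).comp S.subtype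
  have hbound : ∀ p : S, ‖g p‖ ≤ C * ‖π₂ p‖ := by
    rintro ⟨p, F, hF, hF1, hF2⟩
    refine hC p.1 F ‖p.2‖ hF hF1 (norm_nonneg _) fun z hz => ?_
    rw [← hF2 ⟨z, hωB hz⟩ hz]
    exact p.2.norm_coe_le_norm _
  obtain ⟨r, hr⟩ := π₂.rangeRestrict.exists_rightInverse_of_surjective π₂.range_rangeRestrict
  have hr' : ∀ t, π₂ (r t) = t := fun t => congrArg Subtype.val (LinearMap.congr_fun hr t)
  obtain ⟨L, hL, -⟩ := exists_extension_norm_eq π₂.range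
    ((g.comp r).mkContinuous C fun t => by
      have := hbound (r t)
      rwa [hr'] at this)
  refine ⟨L, fun f F φ₀ hF hF1 hF2 => ?_⟩
  let p : S := ⟨(f, φ₀), F, hF, hF1, hF2⟩
  have h1 : L φ₀ = g (r ⟨φ₀, ⟨p, rfl⟩⟩) := hL ⟨φ₀, ⟨p, rfl⟩⟩
  -- The chosen lift and `p` have the same second entry; the bound then forces the same value of
  -- `w`, so the lift does not matter.
  have h2 := hbound (r ⟨φ₀, ⟨p, rfl⟩⟩ - p)
  rw [map_sub, map_sub, hr'] at h2
  have h3 : (φ₀ : C(B, ℂ)) - π₂ p = 0 := sub_self _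
  simp only [h3, norm_zero, mul_zero] at h2
  rw [h1]
  exact sub_eq_zero.1 (norm_le_zero_iff.1 h2)

/-! ### Gaussian regularisations as superpositions of exponentials -/

theorem continuous_fourierLaplace {n : ℕ} {g : EuclideanSpace ℝ (Fin n) → ℂ}
    (hg : MeasureTheory.Integrable g) : Continuous (fourierLaplace g) := by
  have h : Continuous (FourierTransform.fourier g) :=
    VectorFourier.fourierIntegral_continuous Real.continuous_fourierChar continuous_inner hg
  have e : fourierLaplace g =
      fun η => FourierTransform.fourier g (-(2 * Real.pi)⁻¹ • η) := funext (fourierLaplace_eq g)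
  rw [e]
  exact h.comp (continuous_const_smul _)

theorem norm_fourierLaplace_le {n : ℕ} (g : EuclideanSpace ℝ (Fin n) → ℂ)
    (η : EuclideanSpace ℝ (Fin n)) : ‖fourierLaplace g η‖ ≤ ∫ y, ‖g y‖ := by
  refine (MeasureTheory.norm_integral_le_integral_norm _).trans_eq ?_
  congr 1
  funext y
  rw [norm_mul, Complex.norm_exp]
  simp

theorem complexFourierExp_sub_realToComplex {n : ℕ} (η y : EuclideanSpace ℝ (Fin n))
    (z : EuclideanSpace ℂ (Fin n)) : complexFourierExp η (z - realToComplex y) =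
      complexFourierExp η z * Complex.exp (Complex.I * (inner ℝ y η : ℝ)) := by
  rw [complexFourierExp, complexFourierExp, ← Complex.exp_add]
  congr 1
  simp only [PiLp.sub_apply, realToComplex_apply, PiLp.inner_apply, sub_mul,
    Finset.sum_sub_distrib, mul_sub]
  simp [mul_comm]

/-- The Gaussian regularisation is a superposition of exponentials. -/
theorem gaussConv_eq_integral {n : ℕ} {χ : EuclideanSpace ℝ (Fin n) → ℝ}
    {f : EuclideanSpace ℝ (Fin n) → ℂ} (hg : MeasureTheory.Integrable fun y => χ y • f y)
    {ε : ℝ} (hε : 0 < ε) (z : EuclideanSpace ℂ (Fin n)) :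
    gaussConv χ f ε z = ∫ η, ((2 * Real.pi) ^ n : ℂ)⁻¹ *
      ((Real.exp (-ε * ‖η‖ ^ 2) : ℂ) * fourierLaplace (fun y => χ y • f y) η) *
        complexFourierExp η z := by
  have hE := integrable_gaussian_mul_complexFourierExp hε z
  have hprod : MeasureTheory.Integrable
      (fun p : EuclideanSpace ℝ (Fin n) × EuclideanSpace ℝ (Fin n) =>
        ((Real.exp (-ε * ‖p.1‖ ^ 2) : ℂ) * complexFourierExp p.1 z) *
          (Complex.exp (Complex.I * (inner ℝ p.2 p.1 : ℝ)) * (χ p.2 • f p.2)))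
      (MeasureTheory.volume.prod MeasureTheory.volume) := by
    have h1 := (hE.mul_prod hg).bdd_mul (c := 1)
      (f := fun p : EuclideanSpace ℝ (Fin n) × EuclideanSpace ℝ (Fin n) =>
        Complex.exp (Complex.I * (inner ℝ p.2 p.1 : ℝ)))
      (by fun_prop : Continuous
        (fun p : EuclideanSpace ℝ (Fin n) × EuclideanSpace ℝ (Fin n) =>
          Complex.exp (Complex.I * (inner ℝ p.2 p.1 : ℝ)))).aestronglyMeasurable
      (Filter.Eventually.of_forall fun p => by
        rw [Complex.norm_exp]
        simp)
    refine h1.congr (Filter.Eventually.of_forall fun p => ?_)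
    simp only
    ring
  have hswap := MeasureTheory.integral_integral_swap (f := fun η y =>
        ((Real.exp (-ε * ‖η‖ ^ 2) : ℂ) * complexFourierExp η z) *
          (Complex.exp (Complex.I * (inner ℝ y η : ℝ)) * (χ y • f y))) hprod
  have e1 : ∀ η : EuclideanSpace ℝ (Fin n), ((2 * Real.pi) ^ n : ℂ)⁻¹ *
      ((Real.exp (-ε * ‖η‖ ^ 2) : ℂ) * fourierLaplace (fun y => χ y • f y) η) *
        complexFourierExp η z = ((2 * Real.pi) ^ n : ℂ)⁻¹ *
      ∫ y, ((Real.exp (-ε * ‖η‖ ^ 2) : ℂ) * complexFourierExp η z) *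
          (Complex.exp (Complex.I * (inner ℝ y η : ℝ)) * (χ y • f y)) := by
    intro η
    rw [MeasureTheory.integral_const_mul, fourierLaplace]
    ring
  simp_rw [e1]
  rw [MeasureTheory.integral_const_mul, hswap, ← MeasureTheory.integral_const_mul, gaussConv]
  congr 1
  funext y
  rw [← integral_gaussian_mul_complexFourierExp hε, mul_left_comm, ← mul_smul_comm]
  congr 1
  rw [← smul_mul_assoc, ← MeasureTheory.integral_const_mul]
  congr 1
  funext η
  rw [complexFourierExp_sub_realToComplex]
  ring

/-- On the tube the exponential grows like `e^{δ‖η‖}`. Completing the square, half of the Gaussian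
absorbs this at the cost of the constant `e^{δ²/2ε}`. -/
theorem integrable_smul_complexFourierExpMap {n : ℕ} {B : Set (EuclideanSpace ℂ (Fin n))}
    [CompactSpace B] {δ : ℝ} (hB : ∀ z ∈ B, ‖imPart z‖ ≤ δ) {ε : ℝ} (hε : 0 < ε)
    {G : EuclideanSpace ℝ (Fin n) → ℂ} (hG : Continuous G) {M : ℝ} (hM : ∀ η, ‖G η‖ ≤ M) :
    MeasureTheory.Integrable fun η : EuclideanSpace ℝ (Fin n) =>
      ((Real.exp (-ε * ‖η‖ ^ 2) : ℂ) * G η) • complexFourierExpMap B η := by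
  have hM0 : 0 ≤ M := (norm_nonneg _).trans (hM 0)
  have hdom := ((integrable_gaussian_mul_complexFourierExp (n := n) (half_pos hε) 0).norm).const_mul
    (M * Real.exp (δ ^ 2 / (2 * ε)))
  refine hdom.mono' ?_ (Filter.Eventually.of_forall fun η => ?_)
  · have h1 : Continuous fun η : EuclideanSpace ℝ (Fin n) => (Real.exp (-ε * ‖η‖ ^ 2) : ℂ) := by
      fun_prop
    exact ((h1.mul hG).smul (complexFourierExpMap B).continuous).aestronglyMeasurable
  · have h1 : ‖complexFourierExpMap B η‖ ≤ Real.exp (δ * ‖η‖) := by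
      rw [ContinuousMap.norm_le _ (Real.exp_pos _).le]
      intro z
      rw [complexFourierExpMap_apply, norm_complexFourierExp]
      gcongr
      refine (real_inner_le_norm _ _).trans ?_
      gcongr
      exact hB z z.2
    have h0 : ‖complexFourierExp η 0‖ = 1 := by simp [complexFourierExp]
    rw [norm_smul, norm_mul, norm_mul, h0, mul_one, Complex.norm_real, Complex.norm_real,
      Real.norm_of_nonneg (Real.exp_pos _).le, Real.norm_of_nonneg (Real.exp_pos _).le]
    calc _ ≤ Real.exp (-ε * ‖η‖ ^ 2) * M * Real.exp (δ * ‖η‖) := by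
          gcongr
          exact hM η
      _ = M * Real.exp (-ε * ‖η‖ ^ 2 + δ * ‖η‖) := by rw [Real.exp_add]; ring
      _ ≤ M * Real.exp (δ ^ 2 / (2 * ε) + -(ε / 2) * ‖η‖ ^ 2) := by
          refine mul_le_mul_of_nonneg_left (Real.exp_le_exp.2 ?_) hM0
          have h2 : 0 ≤ (ε * ‖η‖ - δ) ^ 2 / (2 * ε) := by positivity
          have h3 : (ε * ‖η‖ - δ) ^ 2 / (2 * ε) =
              ε / 2 * ‖η‖ ^ 2 - δ * ‖η‖ + δ ^ 2 / (2 * ε) := by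
            field_simp
            ring
          rw [h3] at h2
          linarith
      _ = _ := by rw [Real.exp_add]; ring

/-- The compact tube `{|Re z| ≤ r, |Im z| ≤ δ}`. -/
def closedTube (n : ℕ) (r δ : ℝ) : Set (EuclideanSpace ℂ (Fin n)) :=
  {z | ‖rePart z‖ ≤ r ∧ ‖imPart z‖ ≤ δ}

theorem isCompact_closedTube (n : ℕ) (r δ : ℝ) : IsCompact (closedTube n r δ) := by
  have h := ((isCompact_closedBall (0 : EuclideanSpace ℝ (Fin n)) r).prod
    (isCompact_closedBall (0 : EuclideanSpace ℝ (Fin n)) δ)).image continuous_real_add_I_smul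
  refine h.of_isClosed_subset ?_ fun z hz => ⟨(rePart z, imPart z), ⟨?_, ?_⟩,
    rePart_add_I_smul_imPart z⟩
  · exact (isClosed_le continuous_rePart.norm continuous_const).inter
      (isClosed_le continuous_imPart.norm continuous_const)
  · exact mem_closedBall_zero_iff.2 hz.1
  · exact mem_closedBall_zero_iff.2 hz.2

theorem rePart_realToComplex {n : ℕ} (x : EuclideanSpace ℝ (Fin n)) :
    rePart (realToComplex x) = x := by
  ext i
  simp [rePart, realToComplex_apply]

theorem imPart_realToComplex {n : ℕ} (x : EuclideanSpace ℝ (Fin n)) :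
    imPart (realToComplex x) = 0 := by
  ext i
  simp [imPart, realToComplex_apply]

/-! ### Fourier inversion on real analytic functions -/

/-- Fourier inversion for compactly supported functionals on `A(ℝⁿ)`. -/
theorem apply_eq_integral_fourierTransform {n : ℕ} (w : RealAnalytic n →L[ℂ] ℂ)
    {K : Set (EuclideanSpace ℝ (Fin n))} (hw : CarriedBy (fun f => ‖w f‖) K) {R : ℝ}
    (hR : ∀ x ∈ K, ‖x‖ ≤ R) {χ : EuclideanSpace ℝ (Fin n) → ℝ}
    (hχ : ContDiff ℝ (⊤ : ℕ∞) χ) (hc : HasCompactSupport χ) (hχ1 : ∀ x, ‖x‖ ≤ R + 2 → χ x = 1)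
    (f : RealAnalytic n)
    (hint : MeasureTheory.Integrable fun η =>
      fourierLaplace (fun y => χ y • f y) η * fourierTransform w η) :
    w f = ((2 * Real.pi) ^ n : ℂ)⁻¹ *
      ∫ η, fourierLaplace (fun y => χ y • f y) η * fourierTransform w η := by
  obtain ⟨ω₀, F, hω₀, hreal, hF, hFf⟩ := exists_holomorphic_extension f.2
  obtain ⟨d, hd, hdω⟩ := (hc.isCompact.image continuous_realToComplex).exists_thickening_subset_open
    hω₀ (by rintro _ ⟨x, -, rfl⟩; exact hreal x)
  -- Then `2δ ≤ d/2 < d` keeps the tube of width `2δ` inside the domain of `F`, and `δ ≤ 1/2` is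
  -- what the contour shift requires.
  set δ : ℝ := min (1 / 2) (d / 4) with hδ
  have hδ0 : 0 < δ := by positivity
  have hδ2 : δ ≤ 1 / 2 := min_le_left _ _
  have hω : ∀ y ∈ tsupport χ, ∀ b : EuclideanSpace ℝ (Fin n), ‖b‖ ≤ 2 * δ →
      realToComplex y + Complex.I • realToComplex b ∈ ω₀ := by
    intro y hy b hb
    refine hdω (Metric.mem_thickening_iff.2 ⟨_, Set.mem_image_of_mem _ hy, ?_⟩)
    rw [dist_eq_norm, add_sub_cancel_left, norm_smul, Complex.norm_I, one_mul, norm_realToComplex]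
    have : δ ≤ d / 4 := min_le_right _ _
    linarith
  set B := closedTube n (R + 1) δ with hB
  have : CompactSpace B := isCompact_iff_compactSpace.1 (isCompact_closedTube n (R + 1) δ)
  have hBω₀ : ∀ z ∈ B, z ∈ ω₀ := by
    intro z hz
    rw [← rePart_add_I_smul_imPart z]
    refine hω _ (subset_tsupport _ (Function.mem_support.2 ?_)) _ (hz.2.trans (by linarith))
    rw [hχ1 _ (hz.1.trans (by linarith))]
    exact one_ne_zero
  set ω : Set (EuclideanSpace ℂ (Fin n)) := {z | ‖rePart z‖ < R + 1 ∧ ‖imPart z‖ < δ} with hωdef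
  have hωo : IsOpen ω := (isOpen_lt continuous_rePart.norm continuous_const).inter
    (isOpen_lt continuous_imPart.norm continuous_const)
  have hωB : ω ⊆ B := fun z hz => ⟨hz.1.le, hz.2.le⟩
  have hKω : realToComplex '' K ⊆ ω := by
    rintro _ ⟨x, hx, rfl⟩
    refine ⟨?_, ?_⟩
    · rw [rePart_realToComplex]
      linarith [hR x hx]
    · rwa [imPart_realToComplex, norm_zero]
  obtain ⟨L, hL⟩ := exists_extension_continuousMap w hw hωo hKω hωB
  let FB : C(B, ℂ) := ⟨fun z => F z, by
    refine continuous_iff_continuousAt.2 fun z => ?_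
    exact ContinuousAt.comp (g := F) (hF z (hBω₀ z z.2)).continuousAt
      continuous_subtype_val.continuousAt⟩
  have hLF : L FB = w f := hL f F FB
    (fun z hz => (hF z (hBω₀ z (hωB hz))).differentiableAt.differentiableWithinAt)
    (fun x _ => hFf x) fun z _ => rfl
  have hLe : ∀ η, L (complexFourierExpMap B η) = fourierTransform w η := fun η =>
    hL (fourierExp η) (complexFourierExp η) _ (differentiable_complexFourierExp η).differentiableOn
      (fun x _ => complexFourierExp_realToComplex η x) fun z _ => rfl
  have hfc : Continuous f.1 := (AnalyticOnNhd.contDiff (n := 0) f.2).continuous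
  have hg : MeasureTheory.Integrable fun y => χ y • f y :=
    (hχ.continuous.smul hfc).integrable_of_hasCompactSupport hc.smul_right
  set G := fourierLaplace (fun y => χ y • f y) with hG
  set c : ℂ := ((2 * Real.pi) ^ n : ℂ)⁻¹ with hcdef
  let Φ : ℝ → C(B, ℂ) := fun ε =>
    c • ∫ η, ((Real.exp (-ε * ‖η‖ ^ 2) : ℂ) * G η) • complexFourierExpMap B η
  have hΦint : ∀ ε : ℝ, 0 < ε → MeasureTheory.Integrable fun η =>
      ((Real.exp (-ε * ‖η‖ ^ 2) : ℂ) * G η) • complexFourierExpMap B η := fun ε hε =>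
    integrable_smul_complexFourierExpMap (fun z hz => hz.2) hε
      (continuous_fourierLaplace hg) (norm_fourierLaplace_le _)
  have hΦ : ∀ ε : ℝ, 0 < ε → ∀ z : B, Φ ε z = gaussConv χ f ε z := by
    intro ε hε z
    rw [gaussConv_eq_integral hg hε]
    have h1 := (ContinuousMap.evalCLM ℂ z).integral_comp_comm (hΦint ε hε)
    change c • (ContinuousMap.evalCLM ℂ z)
      (∫ η, ((Real.exp (-ε * ‖η‖ ^ 2) : ℂ) * G η) • complexFourierExpMap B η) = _
    rw [← h1, ← MeasureTheory.integral_smul]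
    congr 1
    funext η
    change c * (((Real.exp (-ε * ‖η‖ ^ 2) : ℂ) * G η) * complexFourierExp η z) = _
    rw [← mul_assoc]
  have hLΦ : ∀ ε : ℝ, 0 < ε → L (Φ ε) =
      c * ∫ η, (Real.exp (-ε * ‖η‖ ^ 2) : ℂ) * (G η * fourierTransform w η) := by
    intro ε hε
    have h1 := L.integral_comp_comm (hΦint ε hε)
    change L (c • ∫ η, ((Real.exp (-ε * ‖η‖ ^ 2) : ℂ) * G η) • complexFourierExpMap B η) = _
    rw [map_smul, ← h1, smul_eq_mul]
    congr 2
    funext η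
    rw [map_smul, hLe, smul_eq_mul, mul_assoc]
  -- The limit is taken twice: uniformly on the tube, where `L` turns it into `w f`, and under the
  -- `η`-integral, where integrability of the undamped integrand gives the inversion formula.
  have hlim1 : Filter.Tendsto Φ (nhdsWithin 0 (Set.Ioi 0)) (nhds FB) := by
    rw [Metric.tendsto_nhds]
    intro e he
    filter_upwards [eventually_norm_gaussConv_sub_le hχ hc hχ1 hF hδ0 hδ2 hω hFf (half_pos he),
      self_mem_nhdsWithin] with ε hε hε0
    rw [dist_eq_norm]
    refine lt_of_le_of_lt ?_ (half_lt_self he)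
    rw [ContinuousMap.norm_le _ (half_pos he).le]
    intro z
    rw [ContinuousMap.sub_apply, hΦ ε hε0]
    exact (hε z z.2.1 z.2.2).le
  have hlim2 : Filter.Tendsto
      (fun ε : ℝ => ∫ η, (Real.exp (-ε * ‖η‖ ^ 2) : ℂ) * (G η * fourierTransform w η))
      (nhdsWithin 0 (Set.Ioi 0)) (nhds (∫ η, G η * fourierTransform w η)) := by
    refine MeasureTheory.tendsto_integral_filter_of_dominated_convergence
      (fun η => ‖G η * fourierTransform w η‖) ?_ ?_ hint.norm ?_
    · refine Filter.Eventually.of_forall fun ε => ?_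
      have h1 : Continuous fun η : EuclideanSpace ℝ (Fin n) =>
        (Real.exp (-ε * ‖η‖ ^ 2) : ℂ) := by fun_prop
      exact h1.aestronglyMeasurable.mul hint.aestronglyMeasurable
    · filter_upwards [self_mem_nhdsWithin] with ε hε
      refine Filter.Eventually.of_forall fun η => ?_
      rw [norm_mul]
      refine mul_le_of_le_one_left (norm_nonneg _) ?_
      rw [Complex.norm_real, Real.norm_of_nonneg (Real.exp_pos _).le, Real.exp_le_one_iff]
      have hε0 : 0 < ε := hε
      nlinarith [sq_nonneg ‖η‖, mul_nonneg hε0.le (sq_nonneg ‖η‖)]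
    · refine Filter.Eventually.of_forall fun η => ?_
      have h1 : Continuous fun ε : ℝ =>
        (Real.exp (-ε * ‖η‖ ^ 2) : ℂ) * (G η * fourierTransform w η) := by fun_prop
      exact (h1.tendsto' 0 _ (by simp)).mono_left nhdsWithin_le_nhds
  have hlim3 := (L.continuous.tendsto FB).comp hlim1
  have hlim4 : Filter.Tendsto (L ∘ Φ) (nhdsWithin 0 (Set.Ioi 0))
      (nhds (c * ∫ η, G η * fourierTransform w η)) := by
    refine (hlim2.const_mul c).congr' ?_
    filter_upwards [self_mem_nhdsWithin] with ε hε
    exact (hLΦ ε hε).symm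
  rw [← hLF]
  exact tendsto_nhds_unique hlim3 hlim4

/-! ### Pairing with the weighted spaces and the extended functional -/

theorem japaneseBracket_rpow_le {n : ℕ} (ξ : EuclideanSpace ℝ (Fin n)) {a : ℝ} (ha : 0 ≤ a)
    (ha1 : a ≤ 1) : japaneseBracket ξ ^ a ≤ 1 + ‖ξ‖ ^ a := by
  have h1 : japaneseBracket ξ ≤ 1 + ‖ξ‖ := by
    refine Real.sqrt_le_iff.2 ⟨by positivity, ?_⟩
    nlinarith [norm_nonneg ξ]
  refine (Real.rpow_le_rpow (japaneseBracket_pos ξ).le h1 ha).trans ?_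
  refine (Real.rpow_add_le_add_rpow zero_le_one (norm_nonneg ξ) ha ha1).trans_eq ?_
  rw [Real.one_rpow]

/-- If `ŵ` is square integrable against the weight of `H^l_{-Λ(ρ,s)}`, then it pairs with the
functions that decay faster than the inverse weight. -/
theorem exists_integrable_mul_fourierTransform {n : ℕ} {l ρ s : ℝ} (hs : 1 < s) (hρ : 0 < ρ)
    {w : RealAnalytic n →L[ℂ] ℂ} (hw : w ∈ weightedSobolev n l ρ s) :
    ∃ I : ℝ, ∀ (P : ℝ) (G : EuclideanSpace ℝ (Fin n) → ℂ), Continuous G →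
      (∀ η, ‖G η‖ ≤ P * Real.exp (-((ρ + 1) * ‖η‖ ^ (1 / s)))) →
      MeasureTheory.Integrable (fun η => G η * fourierTransform w η) ∧
      ‖∫ η, G η * fourierTransform w η‖ ≤ I * P := by
  have hs0 : 0 < s := by linarith
  have hD := memLp_japaneseBracket_mul_exp (n := n) hs0 (-l)
  -- Cauchy–Schwarz: one `L²` factor is the weighted `ŵ`, the other the remaining weight `⟨ξ⟩^{-l}
  -- e^{-⟨ξ⟩^{1/s}}`.
  have hI := hD.integrable_mul hw.norm
  set S : EuclideanSpace ℝ (Fin n) → ℝ := (fun ξ : EuclideanSpace ℝ (Fin n) =>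
      japaneseBracket ξ ^ (-l) * Real.exp (-japaneseBracket ξ ^ (1 / s))) *
    fun ξ => ‖((japaneseBracket ξ ^ l * Real.exp (-(ρ * japaneseBracket ξ ^ (1 / s))) : ℝ) : ℂ) *
      fourierTransform w ξ‖ with hS
  -- The factor `e^{ρ+1}` pays for replacing `|η|^{1/s}` by `⟨η⟩^{1/s} - 1`.
  refine ⟨Real.exp (ρ + 1) * ∫ ξ, S ξ, fun P G hG hGb => ?_⟩
  have hP : 0 ≤ P := by
    by_contra! h
    have h1 := (norm_nonneg _).trans (hGb 0)
    have h2 := mul_neg_of_neg_of_pos h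
      (Real.exp_pos (-((ρ + 1) * ‖(0 : EuclideanSpace ℝ (Fin n))‖ ^ (1 / s))))
    linarith
  have hbound : ∀ η, ‖G η * fourierTransform w η‖ ≤ P * Real.exp (ρ + 1) * S η := by
    intro η
    have hb := japaneseBracket_pos η
    have h1 : ‖η‖ ^ (1 / s) ≥ japaneseBracket η ^ (1 / s) - 1 := by
      have := japaneseBracket_rpow_le η (a := 1 / s) (by positivity)
        ((div_le_one hs0).2 hs.le)
      linarith
    have h2 : Real.exp (-((ρ + 1) * ‖η‖ ^ (1 / s))) ≤
        Real.exp (ρ + 1) * (Real.exp (-japaneseBracket η ^ (1 / s)) *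
          Real.exp (-(ρ * japaneseBracket η ^ (1 / s)))) := by
      rw [← Real.exp_add, ← Real.exp_add, Real.exp_le_exp]
      nlinarith
    have h3 : japaneseBracket η ^ (-l) * japaneseBracket η ^ l = 1 := by
      rw [← Real.rpow_add hb, neg_add_cancel, Real.rpow_zero]
    rw [norm_mul, hS, Pi.mul_apply, norm_mul, Complex.norm_real, Real.norm_of_nonneg (by positivity)]
    calc _ ≤ P * (Real.exp (ρ + 1) * (Real.exp (-japaneseBracket η ^ (1 / s)) *
          Real.exp (-(ρ * japaneseBracket η ^ (1 / s))))) * ‖fourierTransform w η‖ := by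
          gcongr
          exact (hGb η).trans (by gcongr)
      _ = P * (Real.exp (ρ + 1) * ((japaneseBracket η ^ (-l) * japaneseBracket η ^ l) *
          Real.exp (-japaneseBracket η ^ (1 / s)) *
          Real.exp (-(ρ * japaneseBracket η ^ (1 / s))))) * ‖fourierTransform w η‖ := by
          rw [h3, one_mul]
      _ = _ := by ring
  refine ⟨(hI.const_mul _).mono' (hG.mul (continuous_fourierTransform w)).aestronglyMeasurable
    (Filter.Eventually.of_forall hbound), ?_⟩
  refine (MeasureTheory.norm_integral_le_of_norm_le (hI.const_mul _)
    (Filter.Eventually.of_forall hbound)).trans_eq ?_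
  rw [MeasureTheory.integral_const_mul]
  ring

theorem fourierLaplace_add {n : ℕ} {f g : EuclideanSpace ℝ (Fin n) → ℂ}
    (hf : MeasureTheory.Integrable f) (hg : MeasureTheory.Integrable g)
    (η : EuclideanSpace ℝ (Fin n)) :
    fourierLaplace (f + g) η = fourierLaplace f η + fourierLaplace g η := by
  have key : ∀ {h : EuclideanSpace ℝ (Fin n) → ℂ}, MeasureTheory.Integrable h →
      MeasureTheory.Integrable fun y => Complex.exp (Complex.I * (inner ℝ y η : ℝ)) * h y := by
    intro h hh
    refine hh.bdd_mul (c := 1) (by fun_prop : Continuous fun y : EuclideanSpace ℝ (Fin n) =>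
      Complex.exp (Complex.I * (inner ℝ y η : ℝ))).aestronglyMeasurable
      (Filter.Eventually.of_forall fun y => ?_)
    rw [Complex.norm_exp]
    simp
  simp only [fourierLaplace]
  rw [← MeasureTheory.integral_add (key hf) (key hg)]
  simp only [Pi.add_apply, mul_add]

theorem fourierLaplace_const_mul {n : ℕ} (c : ℂ) (f : EuclideanSpace ℝ (Fin n) → ℂ)
    (η : EuclideanSpace ℝ (Fin n)) :
    fourierLaplace (fun y => c * f y) η = c * fourierLaplace f η := by
  simp only [fourierLaplace]
  rw [← MeasureTheory.integral_const_mul]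
  congr 1
  funext y
  ring

/-- A compactly supported element of a weighted Sobolev space is the restriction of a Gevrey
Beurling ultradistribution. -/
theorem exists_gevreyUltradistribution {n : ℕ} {l ρ s : ℝ} (hs : 1 < s) (hρ : 0 < ρ)
    {w : RealAnalytic n →L[ℂ] ℂ} (hw : w ∈ weightedSobolev n l ρ s)
    (hc : IsCompactlySupported w) :
    ∃ v : GevreyUltradistribution n s, ∀ f : RealAnalytic n, w f = v (f.toGevrey hs) := by
  obtain ⟨K, hK, hwK⟩ := hc
  obtain ⟨R, hR⟩ := hK.isBounded.exists_norm_le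
  -- The margin `2` beyond the carrier is split into `1` for the tube around `K` and `1` for the
  -- distance from that tube to the support of `dχ`.
  obtain ⟨χ, hχ, hχc, hχ1⟩ := exists_gevrey_cutoff n hs (R + 2)
  obtain ⟨A, hA, C, hC0, hC⟩ := exists_fourierLaplace_decay hs hχ hχc (ρ := ρ + 1) (by linarith)
  obtain ⟨I, hI⟩ := exists_integrable_mul_fourierTransform hs hρ hw
  have hint : ∀ f : GevreyBeurling n s, MeasureTheory.Integrable fun y => χ y • f y := fun f =>
    (hχ.1.continuous.smul f.2.1.continuous).integrable_of_hasCompactSupport hχc.smul_right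
  have hG : ∀ f : GevreyBeurling n s, _ := fun f =>
    hI (C * gevreySeminorm hA hχc f) _ (continuous_fourierLaplace (hint f)) (hC f)
  set c : ℂ := ((2 * Real.pi) ^ n : ℂ)⁻¹ with hc
  let v₀ : GevreyBeurling n s →ₗ[ℂ] ℂ :=
    { toFun := fun f => c * ∫ η, fourierLaplace (fun y => χ y • f y) η * fourierTransform w η
      map_add' := fun f g => by
        rw [← mul_add, ← MeasureTheory.integral_add (hG f).1 (hG g).1]
        congr 2
        funext η
        rw [← add_mul, ← fourierLaplace_add (hint f) (hint g)]
        congr 2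
        funext y
        exact smul_add _ _ _
      map_smul' := fun a f => by
        rw [RingHom.id_apply, smul_eq_mul, mul_left_comm, ← MeasureTheory.integral_const_mul a]
        congr 2
        funext η
        rw [← mul_assoc, ← fourierLaplace_const_mul]
        congr 2
        funext y
        exact smul_comm (χ y) a (f y) }
  have hv₀ : ∀ f, ‖v₀ f‖ ≤ ‖c‖ * |I| * C * gevreySeminorm hA hχc f := by
    intro f
    have hp : 0 ≤ gevreySeminorm hA hχc f := apply_nonneg _ _
    change ‖c * _‖ ≤ _
    rw [norm_mul]
    calc _ ≤ ‖c‖ * (I * (C * gevreySeminorm hA hχc f)) := by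
          gcongr
          exact (hG f).2
      _ ≤ ‖c‖ * (|I| * (C * gevreySeminorm hA hχc f)) := by
          gcongr
          exact le_abs_self I
      _ = _ := by ring
  have hcont : Continuous v₀ := by
    refine (withSeminorms_gevrey n s).continuous_normedSpace_rng ℂ v₀
      ⟨{⟨⟨tsupport χ, hχc⟩, ⟨A, hA⟩⟩}, (‖c‖ * |I| * C).toNNReal, fun f => ?_⟩
    rw [Finset.sup_singleton]
    refine (hv₀ f).trans_eq ?_
    rw [smul_apply, NNReal.smul_def, smul_eq_mul,
      Real.coe_toNNReal _ (by positivity)]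
    rfl
  exact ⟨⟨v₀, hcont⟩, fun f => apply_eq_integral_fourierTransform w hwK hR hχ.1 hχc hχ1 f
    (hG (f.toGevrey hs)).1⟩

end

theorem mainTheorem6 (n : ℕ) (s : ℝ) (hs : 1 < s) :
    (∀ (v : GevreyUltradistribution n s) (l : ℝ), ∃ ρ : ℝ, 0 < ρ ∧
      ∃ w ∈ weightedSobolev n l ρ s, ∀ f : RealAnalytic n, w f = v (f.toGevrey hs)) ∧
    (∀ l ρ : ℝ, 0 < ρ → ∀ w ∈ weightedSobolev n l ρ s, IsCompactlySupported w →
      ∃ v : GevreyUltradistribution n s, ∀ f : RealAnalytic n, w f = v (f.toGevrey hs)) := by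
  refine ⟨fun v l => ?_, fun l ρ hρ w hw hc => exists_gevreyUltradistribution hs hρ hw hc⟩
  obtain ⟨ρ, hρ, hw⟩ := exists_mem_weightedSobolev hs v l
  exact ⟨ρ, hρ, _, hw, fun f => rfl⟩
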